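/- A leader contributor system consists of a finite data domain with an initial memory value $a^0$, and of two finite automata, the leader $P_L$ (states $Q_L$, initial state $q^0_L$, transitions $\delta_L$) and the contributor $P_C$ (states $Q_C$, initial state $q^0_C$, transitions $\delta_C$). The transitions are labelled by a read $?b$ or a write $!b$ of a symbol $b$ of the domain, or by the empty word $\varepsilon$. A configuration $(q,a,\mathit{pc})$ consists of a leader state $q$, a memory value $a$ and the states $\mathit{pc}(1),\dots,\mathit{pc}(t)$ of $t$ contributors, where $t\in\mathbb{N}$ is arbitrary but does not change during a computation. In one step, either the leader or one contributor takes a transition of its automaton: a write $!b$ sets the memory value to $b$, a read $?b$ is possible only if the memory value is $b$ and leaves it unchanged, and an $\varepsilon$-transition leaves it unchanged. We write $c\to^+ c'$ for a computation (a finite sequence of steps) from $c$ to $c'$ whose word of memory operations has length at least $1$ ($\varepsilon$-transitions contribute nothing to the word). A cycle $c\to^+ c$ is saturated, written $c\to^+_{\mathit{sat}}c$, if every configuration on it has only contributor states that already occur in $c$. An interface is a triple $I=(S,q,a)$ with $S\subseteq Q_C$, a leader state $q$ and a memory value $a$; a configuration $c$ matches $I$, written $I(c)$, if its set of contributor states is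 exactly $S$, its leader state is $q$ and its memory value is $a$. The saturated cycle problem $\mathsf{CYC}$ is: given a leader contributor system and an interface $I$, is there a number $t$ of contributors and a computation $c\to^+_{\mathit{sat}}c$ with $I(c)$? Let $\mathtt{L}=|Q_L|$, $\mathtt{C}=|Q_C|$, and let $\mathtt{D}$ be the size of the data domain. Theorem. $\mathsf{CYC}$ can be solved in time $\mathcal{O}\big(\mathtt{D}^{2}\cdot(\mathtt{C}^{2}+\mathtt{L}^{2}\cdot\mathtt{D}^{2})\big)$. That is, there are a program of a unit-cost random access machine with words of $\mathcal{O}(\log(\mathtt{L}+\mathtt{C}+\mathtt{D}))$ bits and a constant $K$ such that on every instance, given by the numbers $\mathtt{L},\mathtt{C},\mathtt{D}$, the initial states and the initial memory value, the lists of transitions $\delta_L$ and $\delta_C$ (in any order, without repetition) and the interface $I=(S,q,a)$ with $S$ as a bit vector, the program halts with the correct answer after at most $K\cdot \mathtt{D}^{2}\cdot(\mathtt{C}^{2}+\mathtt{L}^{2}\cdot\mathtt{D}^{2})$ steps. -/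

import Mathlib

namespace LeaderContributor

/-! ### Leader contributor systems -/

/-- Memory operations over the data domain `D`: a read or a write of a symbol. -/
inductive MemOp (D : Type) : Type
  | rd (b : D)
  | wr (b : D)

/-- Transitions `(source, label, target)` of a thread. The label `none` is the empty word,
that is, an internal transition. -/
abbrev Transition (Q D : Type) : Type := Q × Option (MemOp D) × Q

/-- A thread: an automaton over the memory operations. -/
structure Thread (Q D : Type) : Type where
  init : Q
  trans : Set (Transition Q D)

/-- A leader contributor system with leader states `QL`, contributor states `QC` and
data domain `D`. -/
structure LCSystem (QL QC D : Type) : Type where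
  initMem : D
  leader : Thread QL D
  contributor : Thread QC D

/-- Configurations with `t` contributors. -/
structure Config (QL QC D : Type) (t : ℕ) : Type where
  leader : QL
  mem : D
  pc : Fin t → QC

/-- The set of contributor states present in a configuration. -/
def Config.contribStates {QL QC D : Type} {t : ℕ} (c : Config QL QC D t) : Set QC :=
  Set.range c.pc

/-- `MemEffect x a b`: the label `x` can be executed on memory value `a` and leaves `b`. -/
def MemEffect {D : Type} : Option (MemOp D) → D → D → Prop
  | none, a, b => b = a
  | some (MemOp.rd s), a, b => a = s ∧ b = a
  | some (MemOp.wr s), _, b => b = s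

/-- The labelled transition relation among configurations. -/
inductive Step {QL QC D : Type} (Sys : LCSystem QL QC D) {t : ℕ} :
    Config QL QC D t → Option (MemOp D) → Config QL QC D t → Prop
  | leader {q q' : QL} {a b : D} {x : Option (MemOp D)} {pc : Fin t → QC}
      (htrans : (q, x, q') ∈ Sys.leader.trans) (hmem : MemEffect x a b) :
      Step Sys ⟨q, a, pc⟩ x ⟨q', b, pc⟩
  | contributor {q : QL} {a b : D} {x : Option (MemOp D)} {pc : Fin t → QC} {p' : QC}
      (i : Fin t) (htrans : (pc i, x, p') ∈ Sys.contributor.trans) (hmem : MemEffect x a b) :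
      Step Sys ⟨q, a, pc⟩ x ⟨q, b, Function.update pc i p'⟩

/-- `Computation Sys c w cs d`: a finite computation from `c` to `d` whose word of memory
operations is `w` (internal transitions contribute the empty word) and whose sequence of
configurations, including `c` and `d`, is `cs`. -/
inductive Computation {QL QC D : Type} (Sys : LCSystem QL QC D) {t : ℕ} :
    Config QL QC D t → List (MemOp D) → List (Config QL QC D t) → Config QL QC D t → Prop
  | refl (c : Config QL QC D t) : Computation Sys c [] [c] c
  | step {c c' d : Config QL QC D t} {x : Option (MemOp D)} {w : List (MemOp D)}
      {cs : List (Config QL QC D t)}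
      (hstep : Step Sys c x c') (hrest : Computation Sys c' w cs d) :
      Computation Sys c (x.toList ++ w) (c :: cs) d

/-- There is a saturated cycle on `c` whose word has length at least one: every configuration
of the cycle only has contributor states that are already present in `c`. -/
def HasSatCycleAt {QL QC D : Type} (Sys : LCSystem QL QC D) {t : ℕ}
    (c : Config QL QC D t) : Prop :=
  ∃ (w : List (MemOp D)) (cs : List (Config QL QC D t)),
    Computation Sys c w cs c ∧ 1 ≤ w.length ∧ ∀ c' ∈ cs, c'.contribStates ⊆ c.contribStates

/-- Interfaces: a set of contributor states, a leader state and a memory value. -/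
structure Interface (QL QC D : Type) : Type where
  contribs : Set QC
  leader : QL
  mem : D

/-- The configuration `c` matches the interface. -/
def Interface.Matches {QL QC D : Type} (I : Interface QL QC D) {t : ℕ}
    (c : Config QL QC D t) : Prop :=
  c.contribStates = I.contribs ∧ c.leader = I.leader ∧ c.mem = I.mem

/-- Instances of the saturated cycle problem. States and symbols are numbered. -/
structure CycInstance : Type where
  /-- number of leader states -/
  L : ℕ
  /-- number of contributor states -/
  C : ℕ
  /-- size of the data domain -/
  D : ℕ
  system : LCSystem (Fin L) (Fin C) (Fin D)
  iface : Interface (Fin L) (Fin C) (Fin D)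

/-- The question of the saturated cycle problem. The number of contributors is arbitrary. -/
def CYC (P : CycInstance) : Prop :=
  ∃ (t : ℕ) (c : Config (Fin P.L) (Fin P.C) (Fin P.D) t),
    P.iface.Matches c ∧ HasSatCycleAt P.system c

/-! ### A word RAM with a step count

Programs are structured programs over registers and arrays of natural numbers. Every
operation has unit cost, and all numbers that occur have to fit into a machine word. -/

namespace Ram

/-- Memory: registers, and arrays given by a name and an index. -/
structure State : Type where
  reg : ℕ → ℕ
  arr : ℕ → ℕ → ℕ

/-- Expressions. `sub` is truncated subtraction; `lt` and `eq` return `1` or `0`. -/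
inductive Expr : Type
  | const (n : ℕ)
  | reg (x : ℕ)
  | arr (k : ℕ) (e : Expr)
  | add (e f : Expr)
  | sub (e f : Expr)
  | mul (e f : Expr)
  | lt (e f : Expr)
  | eq (e f : Expr)

def Expr.eval (σ : State) : Expr → ℕ
  | const n => n
  | reg x => σ.reg x
  | arr k e => σ.arr k (e.eval σ)
  | add e f => e.eval σ + f.eval σ
  | sub e f => e.eval σ - f.eval σ
  | mul e f => e.eval σ * f.eval σ
  | lt e f => if e.eval σ < f.eval σ then 1 else 0
  | eq e f => if e.eval σ = f.eval σ then 1 else 0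

/-- All values that occur in the evaluation of the expression, array indices included, are
smaller than `W`. -/
def Expr.Fits (W : ℕ) (σ : State) : Expr → Prop
  | const n => n < W
  | reg x => σ.reg x < W
  | arr k e => e.Fits W σ ∧ σ.arr k (e.eval σ) < W
  | add e f => e.Fits W σ ∧ f.Fits W σ ∧ e.eval σ + f.eval σ < W
  | sub e f => e.Fits W σ ∧ f.Fits W σ
  | mul e f => e.Fits W σ ∧ f.Fits W σ ∧ e.eval σ * f.eval σ < W
  | lt e f => e.Fits W σ ∧ f.Fits W σ ∧ 1 < W
  | eq e f => e.Fits W σ ∧ f.Fits W σ ∧ 1 < W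

/-- The number of operations in an expression. -/
def Expr.cost : Expr → ℕ
  | const _ => 1
  | reg _ => 1
  | arr _ e => e.cost + 1
  | add e f => e.cost + f.cost + 1
  | sub e f => e.cost + f.cost + 1
  | mul e f => e.cost + f.cost + 1
  | lt e f => e.cost + f.cost + 1
  | eq e f => e.cost + f.cost + 1

/-- Programs. A test is passed if the value of the expression is not `0`. -/
inductive Prog : Type
  | skip
  | assign (x : ℕ) (e : Expr)
  | store (k : ℕ) (e f : Expr)
  | seq (p r : Prog)
  | cond (e : Expr) (p r : Prog)
  | loop (e : Expr) (p : Prog)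

def State.setReg (σ : State) (x v : ℕ) : State :=
  { σ with reg := Function.update σ.reg x v }

def State.setArr (σ : State) (k i v : ℕ) : State :=
  { σ with arr := Function.update σ.arr k (Function.update (σ.arr k) i v) }

/-- `Exec W p σ n σ'`: started in `σ`, the program `p` halts in `σ'` after `n` steps, and all
values that it evaluates are smaller than `W`. -/
inductive Exec (W : ℕ) : Prog → State → ℕ → State → Prop
  | skip (σ : State) : Exec W Prog.skip σ 1 σ
  | assign (σ : State) (x : ℕ) (e : Expr) (he : e.Fits W σ) :
      Exec W (Prog.assign x e) σ (e.cost + 1) (σ.setReg x (e.eval σ))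
  | store (σ : State) (k : ℕ) (e f : Expr) (he : e.Fits W σ) (hf : f.Fits W σ) :
      Exec W (Prog.store k e f) σ (e.cost + f.cost + 1) (σ.setArr k (e.eval σ) (f.eval σ))
  | seq {σ₁ σ₂ σ₃ : State} {m n : ℕ} {p r : Prog}
      (hp : Exec W p σ₁ m σ₂) (hr : Exec W r σ₂ n σ₃) :
      Exec W (Prog.seq p r) σ₁ (m + n) σ₃
  | cond_true {σ σ' : State} {n : ℕ} {e : Expr} {p : Prog} (r : Prog)
      (he : e.Fits W σ) (htest : e.eval σ ≠ 0) (hp : Exec W p σ n σ') :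
      Exec W (Prog.cond e p r) σ (e.cost + 1 + n) σ'
  | cond_false {σ σ' : State} {n : ℕ} {e : Expr} (p : Prog) {r : Prog}
      (he : e.Fits W σ) (htest : e.eval σ = 0) (hr : Exec W r σ n σ') :
      Exec W (Prog.cond e p r) σ (e.cost + 1 + n) σ'
  | loop_true {σ₁ σ₂ σ₃ : State} {m n : ℕ} {e : Expr} {p : Prog}
      (he : e.Fits W σ₁) (htest : e.eval σ₁ ≠ 0) (hp : Exec W p σ₁ m σ₂)
      (hloop : Exec W (Prog.loop e p) σ₂ n σ₃) :
      Exec W (Prog.loop e p) σ₁ (e.cost + 1 + m + n) σ₃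
  | loop_false {σ : State} {e : Expr} (p : Prog)
      (he : e.Fits W σ) (htest : e.eval σ = 0) :
      Exec W (Prog.loop e p) σ (e.cost + 1) σ

/-- The decision problem `problem` can be solved in time `O(bound)` on a word RAM: a single
program decides all instances (with the answer `1` or `0` in register `0`), for all admissible
encodings of the instance as an initial memory. It takes at most `K * bound` steps, for a
constant `K`, and its words are shorter than `k * log (size)` bits, for a constant `k`. -/
def SolvableInTime {Inst : Type} (IsInput : Inst → State → Prop) (size : Inst → ℕ)
    (problem : Inst → Prop) (bound : Inst → ℕ) : Prop :=
  ∃ (p : Prog) (k K : ℕ), ∀ (P : Inst) (σ : State), IsInput P σ →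
    ∃ (n : ℕ) (σ' : State), Exec (size P ^ k) p σ n σ' ∧ n ≤ K * bound P ∧
      (problem P → σ'.reg 0 = 1) ∧ (¬ problem P → σ'.reg 0 = 0)

end Ram

/-! ### Instances as inputs of the machine -/

/-- The kind of a label: internal `0`, read `1`, write `2`. -/
def labelKind {d : ℕ} : Option (MemOp (Fin d)) → ℕ
  | none => 0
  | some (MemOp.rd _) => 1
  | some (MemOp.wr _) => 2

/-- The symbol of a label (`0` for internal transitions). -/
def labelSymbol {d : ℕ} : Option (MemOp (Fin d)) → ℕ
  | none => 0
  | some (MemOp.rd b) => b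
  | some (MemOp.wr b) => b

/-- The list `l` enumerates the set `A`, in some order and without repetition. -/
def Enumerates {α : Type} (l : List α) (A : Set α) : Prop :=
  l.Nodup ∧ ∀ x, x ∈ l ↔ x ∈ A

open Classical in
/-- The initial memory for an instance whose transitions are listed in `lL` and `lC`.
Registers hold the sizes, the initial states, the initial memory value, the leader state and
memory value of the interface and the numbers of transitions. Array `0` is the bit vector of
the contributor states of the interface, arrays `1` to `4` list sources, kinds, symbols and
targets of the leader transitions, arrays `5` to `8` those of the contributor transitions.
All other cells are `0`. -/
noncomputable def CycInstance.inputState (P : CycInstance)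
    (lL : List (Transition (Fin P.L) (Fin P.D)))
    (lC : List (Transition (Fin P.C) (Fin P.D))) : Ram.State where
  reg
    | 0 => P.L
    | 1 => P.C
    | 2 => P.D
    | 3 => P.system.leader.init
    | 4 => P.system.contributor.init
    | 5 => P.system.initMem
    | 6 => P.iface.leader
    | 7 => P.iface.mem
    | 8 => lL.length
    | 9 => lC.length
    | _ => 0
  arr
    | 0 => fun i => if ∃ s ∈ P.iface.contribs, (s : ℕ) = i then 1 else 0
    | 1 => fun i => (lL.map fun e => (e.1 : ℕ)).getD i 0
    | 2 => fun i => (lL.map fun e => labelKind e.2.1).getD i 0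
    | 3 => fun i => (lL.map fun e => labelSymbol e.2.1).getD i 0
    | 4 => fun i => (lL.map fun e => (e.2.2 : ℕ)).getD i 0
    | 5 => fun i => (lC.map fun e => (e.1 : ℕ)).getD i 0
    | 6 => fun i => (lC.map fun e => labelKind e.2.1).getD i 0
    | 7 => fun i => (lC.map fun e => labelSymbol e.2.1).getD i 0
    | 8 => fun i => (lC.map fun e => (e.2.2 : ℕ)).getD i 0
    | _ => fun _ => 0

/-- `σ` is an initial memory for the instance: the transitions of both threads are listed in
an arbitrary order and without repetition. -/
def CycInstance.IsInput (P : CycInstance) (σ : Ram.State) : Prop :=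
  ∃ (lL : List (Transition (Fin P.L) (Fin P.D))) (lC : List (Transition (Fin P.C) (Fin P.D))),
    Enumerates lL P.system.leader.trans ∧ Enumerates lC P.system.contributor.trans ∧
      σ = P.inputState lL lC

/-- The sum of the three parameters. -/
def CycInstance.size (P : CycInstance) : ℕ := P.L + P.C + P.D

end LeaderContributor

/-!
Since the number of contributors is free, whether a saturated cycle exists depends only on which
symbols contributors can write repeatedly (a set `A`) and which memory values occur on the cycle
(a set `B`). Given `A`, the leader and the memory form a finite graph, `LeaderEdge`, in which
contributors may write any symbol of `A` at any time. Given `B`, a contributor can use the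
transitions inside the interface whose symbols are in `B`, the graph `ContribEdge`. A symbol can
be written repeatedly if some transition that writes it lies inside a strongly connected component
of the second graph (`nextWritable`), and a value occurs if it occurs in the component of the
interface in the first graph (`nextVisited`). A saturated cycle exists if and only if some pair
with `A ⊆ nextWritable B` and `B ⊆ nextVisited A` has a memory operation inside one of these
components, `cyc_iff_postfixpoint`. A cycle gives such a pair directly. Conversely, each
contributor transition inside a component is put on a closed walk, and many contributors are
placed at every position of each of these walks. While the leader runs through one closed walk
that visits all values of `B`, every contributor takes one transition: a transition on the
symbol `b` is harmless when the memory value is `b`, and a contributor that is about to write `b`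
waits for the last visit of `b`, in case the leader needs that write before
(`satComp_of_leaderWalk`). Each round rotates the contributors on their walks, and after a common
multiple of the lengths all of them are back (`exists_satCycle`).

Both maps are monotone, so it suffices to test the greatest fixpoint, which is reached from the
full sets in `2 * D` rounds. One round builds both graphs as one adjacency matrix with
`N = C + L * D` vertices and computes its strongly connected components by path contraction, in
`2 * N` steps of time linear in `N`. As `N ^ 2` is at most `2 * (C ^ 2 + L ^ 2 * D ^ 2)` and the
lists of transitions have at most `3 * C ^ 2 * D` and `3 * L ^ 2 * D` entries, one round takes time
linear in `D * (C ^ 2 + L ^ 2 * D ^ 2)` (`round_cost_le`).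

The program is written in a language of counting loops, `Ram.Cmd`, where every program has a
final state that is a function of the initial one. A single theorem, `Ram.Cmd.exec_compile`,
shows that its translation reaches this state within a time bound that can be read off, and that
all values fit into machine words.
-/

namespace LeaderContributor

open Relation

/-! ### A fixpoint characterization of saturated cycles -/

section Characterization

variable {QL QC D : Type}

/-- The symbol of the label, if there is one, belongs to `B`. -/
def LabelIn (B : Set D) : Option (MemOp D) → Prop
  | none => True
  | some (MemOp.rd b) => b ∈ B
  | some (MemOp.wr b) => b ∈ B

/-- Mutual reachability in the graph of `r`. -/
def StronglyConn {α : Type} (r : α → α → Prop) (u v : α) : Prop :=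
  ReflTransGen r u v ∧ ReflTransGen r v u

/-- The contributor automaton inside the state set `S`, restricted to symbols of `B`. -/
def ContribEdge (Sys : LCSystem QL QC D) (S : Set QC) (B : Set D) (u v : QC) : Prop :=
  ∃ x, (u, x, v) ∈ Sys.contributor.trans ∧ u ∈ S ∧ v ∈ S ∧ LabelIn B x

/-- The leader together with the memory, when contributors can write the symbols of `A` at any
time. -/
def LeaderEdge (Sys : LCSystem QL QC D) (A : Set D) (c d : QL × D) : Prop :=
  (∃ x, (c.1, x, d.1) ∈ Sys.leader.trans ∧ MemEffect x c.2 d.2) ∨ (d.1 = c.1 ∧ d.2 ∈ A)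

/-- The symbols of `B` that contributors can write over and over again, if they may read and
write the symbols of `B`. -/
def nextWritable (Sys : LCSystem QL QC D) (I : Interface QL QC D) (B : Set D) : Set D :=
  {y | ∃ u v, (u, some (MemOp.wr y), v) ∈ Sys.contributor.trans ∧ u ∈ I.contribs ∧
    v ∈ I.contribs ∧ y ∈ B ∧ StronglyConn (ContribEdge Sys I.contribs B) u v}

/-- The memory values on closed walks of the leader through the interface, if contributors write
the symbols of `A`. -/
def nextVisited (Sys : LCSystem QL QC D) (I : Interface QL QC D) (A : Set D) : Set D :=
  {y | ∃ p, StronglyConn (LeaderEdge Sys A) (I.leader, I.mem) (p, y)}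

/-- Some memory operation can be executed on a cycle: one of the leader on a closed walk through
the interface, or one of the contributors. -/
def OpOnCycle (Sys : LCSystem QL QC D) (I : Interface QL QC D) (A B : Set D) : Prop :=
  (∃ p o p' x y, (p, some o, p') ∈ Sys.leader.trans ∧ MemEffect (some o) x y ∧
    StronglyConn (LeaderEdge Sys A) (I.leader, I.mem) (p, x) ∧
    StronglyConn (LeaderEdge Sys A) (I.leader, I.mem) (p', y)) ∨
  (∃ u o v, (u, some o, v) ∈ Sys.contributor.trans ∧ u ∈ I.contribs ∧ v ∈ I.contribs ∧
    LabelIn B (some o) ∧ StronglyConn (ContribEdge Sys I.contribs B) u v)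

theorem LabelIn.mono {A B : Set D} (h : A ⊆ B) {x : Option (MemOp D)} (hx : LabelIn A x) :
    LabelIn B x := by
  rcases x with _ | _ | _
  · trivial
  · exact h hx
  · exact h hx

theorem StronglyConn.mono {α : Type} {r s : α → α → Prop} (h : ∀ a b, r a b → s a b) {u v : α}
    (huv : StronglyConn r u v) : StronglyConn s u v :=
  ⟨ReflTransGen.mono h _ _ huv.1, ReflTransGen.mono h _ _ huv.2⟩

theorem ContribEdge.mono {Sys : LCSystem QL QC D} {S : Set QC} {A B : Set D} (h : A ⊆ B)
    (u v : QC) : ContribEdge Sys S A u v → ContribEdge Sys S B u v := by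
  rintro ⟨x, h1, h2, h3, h4⟩
  exact ⟨x, h1, h2, h3, h4.mono h⟩

theorem LeaderEdge.mono {Sys : LCSystem QL QC D} {A B : Set D} (h : A ⊆ B) (c d : QL × D) :
    LeaderEdge Sys A c d → LeaderEdge Sys B c d := by
  rintro (h1 | ⟨h1, h2⟩)
  · exact Or.inl h1
  · exact Or.inr ⟨h1, h h2⟩

theorem nextWritable_mono {Sys : LCSystem QL QC D} {I : Interface QL QC D} {A B : Set D}
    (h : A ⊆ B) : nextWritable Sys I A ⊆ nextWritable Sys I B := by
  rintro y ⟨u, v, h1, h2, h3, h4, h5⟩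
  exact ⟨u, v, h1, h2, h3, h h4, h5.mono (ContribEdge.mono h)⟩

theorem nextVisited_mono {Sys : LCSystem QL QC D} {I : Interface QL QC D} {A B : Set D}
    (h : A ⊆ B) : nextVisited Sys I A ⊆ nextVisited Sys I B := by
  rintro y ⟨p, h1⟩
  exact ⟨p, h1.mono (LeaderEdge.mono h)⟩

theorem OpOnCycle.mono {Sys : LCSystem QL QC D} {I : Interface QL QC D} {A B A' B' : Set D}
    (hA : A ⊆ A') (hB : B ⊆ B') (h : OpOnCycle Sys I A B) : OpOnCycle Sys I A' B' := by
  rcases h with ⟨p, o, p', x, y, h1, h2, h3, h4⟩ | ⟨u, o, v, h1, h2, h3, h4, h5⟩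
  · exact Or.inl ⟨p, o, p', x, y, h1, h2, h3.mono (LeaderEdge.mono hA),
      h4.mono (LeaderEdge.mono hA)⟩
  · exact Or.inr ⟨u, o, v, h1, h2, h3, h4.mono hB, h5.mono (ContribEdge.mono hB)⟩

/-! ### From a cycle to a post-fixpoint -/

/-- A step between configurations whose contributor states belong to `S`. -/
def SatStep (Sys : LCSystem QL QC D) (S : Set QC) {t : ℕ} (c d : Config QL QC D t) : Prop :=
  ∃ x, Step Sys c x d ∧ c.contribStates ⊆ S ∧ d.contribStates ⊆ S

theorem Computation.head_mem {Sys : LCSystem QL QC D} {t : ℕ} {c d : Config QL QC D t}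
    {w : List (MemOp D)} {cs : List (Config QL QC D t)} (h : Computation Sys c w cs d) :
    c ∈ cs := by
  cases h <;> simp

theorem Computation.satReach {Sys : LCSystem QL QC D} {S : Set QC} {t : ℕ}
    {c d : Config QL QC D t} {w : List (MemOp D)} {cs : List (Config QL QC D t)}
    (h : Computation Sys c w cs d) (hS : ∀ c' ∈ cs, c'.contribStates ⊆ S) :
    ReflTransGen (SatStep Sys S) c d := by
  induction h with
  | refl c => exact ReflTransGen.refl
  | step hstep hrest ih =>
    have h1 := hS _ (List.mem_cons_self ..)
    have h2 := hS _ (List.mem_cons_of_mem _ hrest.head_mem)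
    exact ReflTransGen.head ⟨_, hstep, h1, h2⟩ (ih fun c' hc' => hS _ (List.mem_cons_of_mem _ hc'))

theorem Computation.exists_op {Sys : LCSystem QL QC D} {S : Set QC} {t : ℕ}
    {c d : Config QL QC D t} {w : List (MemOp D)} {cs : List (Config QL QC D t)}
    (h : Computation Sys c w cs d) (hS : ∀ c' ∈ cs, c'.contribStates ⊆ S) (hw : 1 ≤ w.length) :
    ∃ e o e', ReflTransGen (SatStep Sys S) c e ∧ Step Sys e (some o) e' ∧
      SatStep Sys S e e' ∧ ReflTransGen (SatStep Sys S) e' d := by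
  induction h with
  | refl c => simp at hw
  | @step c c' d x w cs hstep hrest ih =>
    have h1 := hS _ (List.mem_cons_self ..)
    have h2 := hS _ (List.mem_cons_of_mem _ hrest.head_mem)
    have h3 : ∀ c'' ∈ cs, c''.contribStates ⊆ S := fun c' hc' => hS _ (List.mem_cons_of_mem _ hc')
    rcases x with _ | o
    · obtain ⟨e, o, e', h4, h5⟩ := ih h3 (by simpa using hw)
      exact ⟨e, o, e', ReflTransGen.head ⟨_, hstep, h1, h2⟩ h4, h5⟩
    · exact ⟨c, o, c', ReflTransGen.refl, hstep, ⟨_, hstep, h1, h2⟩, hrest.satReach h3⟩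

/-- The configurations that lie on a saturated cycle through `c`. -/
def OnCycle (Sys : LCSystem QL QC D) (S : Set QC) {t : ℕ} (c e : Config QL QC D t) : Prop :=
  StronglyConn (SatStep Sys S) c e

/-- The memory values on saturated cycles through `c`. -/
def cycleMem (Sys : LCSystem QL QC D) (S : Set QC) {t : ℕ} (c : Config QL QC D t) : Set D :=
  {b | ∃ e, OnCycle Sys S c e ∧ e.mem = b}

/-- The symbols that contributors write on saturated cycles through `c`. -/
def cycleWrites (Sys : LCSystem QL QC D) (S : Set QC) {t : ℕ} (c : Config QL QC D t) : Set D :=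
  {y | ∃ e i p, OnCycle Sys S c e ∧
    OnCycle Sys S c ⟨e.leader, y, Function.update e.pc i p⟩ ∧
    (e.pc i, some (MemOp.wr y), p) ∈ Sys.contributor.trans ∧ e.pc i ∈ S ∧ p ∈ S}

theorem labelIn_cycleMem {Sys : LCSystem QL QC D} {S : Set QC} {t : ℕ}
    {c e : Config QL QC D t} {b : D} {x : Option (MemOp D)} {i : Fin t} {p : QC}
    (he : OnCycle Sys S c e) (he' : OnCycle Sys S c ⟨e.leader, b, Function.update e.pc i p⟩)
    (hm : MemEffect x e.mem b) :
    LabelIn (cycleMem Sys S c) x := by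
  rcases x with _ | s | s
  · trivial
  · exact ⟨e, he, hm.1⟩
  · exact ⟨_, he', hm⟩

/-- A step on a saturated cycle moves the leader with the memory along an edge, or not at all,
and likewise every contributor. -/
theorem onCycle_step {Sys : LCSystem QL QC D} {S : Set QC} {t : ℕ} {c e f : Config QL QC D t}
    (he : OnCycle Sys S c e) (hf : OnCycle Sys S c f) (h : SatStep Sys S e f) :
    ReflTransGen (LeaderEdge Sys (cycleWrites Sys S c)) (e.leader, e.mem) (f.leader, f.mem) ∧
      ∀ j, ReflTransGen (ContribEdge Sys S (cycleMem Sys S c)) (e.pc j) (f.pc j) := by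
  obtain ⟨x, hs, hS, hS'⟩ := h
  cases hs with
  | leader htrans hmem =>
    exact ⟨ReflTransGen.single (Or.inl ⟨_, htrans, hmem⟩), fun j => ReflTransGen.refl⟩
  | @contributor q a b x pc p i htrans hmem =>
    have h1 : pc i ∈ S := hS ⟨i, rfl⟩
    have h2 : p ∈ S := hS' ⟨i, by simp⟩
    have h3 := labelIn_cycleMem (e := ⟨q, a, pc⟩) he hf hmem
    refine ⟨?_, fun j => ?_⟩
    · rcases x with _ | s | s
      · cases hmem; exact ReflTransGen.refl
      · obtain ⟨-, rfl⟩ := hmem; exact ReflTransGen.refl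
      · cases hmem
        exact ReflTransGen.single (Or.inr ⟨rfl, ⟨q, a, pc⟩, i, p, he, hf, htrans, h1, h2⟩)
    · by_cases hj : j = i
      · subst hj
        simpa using ReflTransGen.single (r := ContribEdge Sys S (cycleMem Sys S c))
          ⟨x, htrans, h1, h2, h3⟩
      · simp only [Function.update_of_ne hj]
        exact ReflTransGen.refl

theorem onCycle_reach {Sys : LCSystem QL QC D} {S : Set QC} {t : ℕ} {c e f : Config QL QC D t}
    (he : ReflTransGen (SatStep Sys S) c e) (hf : ReflTransGen (SatStep Sys S) f c)
    (h : ReflTransGen (SatStep Sys S) e f) :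
    ReflTransGen (LeaderEdge Sys (cycleWrites Sys S c)) (e.leader, e.mem) (f.leader, f.mem) ∧
      ∀ j, ReflTransGen (ContribEdge Sys S (cycleMem Sys S c)) (e.pc j) (f.pc j) := by
  induction h using ReflTransGen.head_induction_on with
  | refl => exact ⟨ReflTransGen.refl, fun _ => ReflTransGen.refl⟩
  | @head e e₁ h1 h2 ih =>
    have h3 := ih (he.tail h1)
    have h4 := onCycle_step ⟨he, ReflTransGen.head h1 (h2.trans hf)⟩ ⟨he.tail h1, h2.trans hf⟩ h1
    exact ⟨h4.1.trans h3.1, fun j => (h4.2 j).trans (h3.2 j)⟩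

theorem onCycle_stronglyConn {Sys : LCSystem QL QC D} {S : Set QC} {t : ℕ}
    {c e f : Config QL QC D t} (he : OnCycle Sys S c e) (hf : OnCycle Sys S c f) :
    StronglyConn (LeaderEdge Sys (cycleWrites Sys S c)) (e.leader, e.mem) (f.leader, f.mem) ∧
      ∀ j, StronglyConn (ContribEdge Sys S (cycleMem Sys S c)) (e.pc j) (f.pc j) := by
  have h1 := onCycle_reach he.1 hf.2 (he.2.trans hf.1)
  have h2 := onCycle_reach hf.1 he.2 (hf.2.trans he.1)
  exact ⟨⟨h1.1, h2.1⟩, fun j => ⟨h1.2 j, h2.2 j⟩⟩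

/-- The memory values and the contributor writes that occur on saturated cycles through `c` form
a post-fixpoint. -/
theorem postfixpoint_of_satCycle {Sys : LCSystem QL QC D} {I : Interface QL QC D} {t : ℕ}
    {c : Config QL QC D t} (hI : I.Matches c) (hc : HasSatCycleAt Sys c) :
    ∃ A B, A ⊆ nextWritable Sys I B ∧ B ⊆ nextVisited Sys I A ∧ OpOnCycle Sys I A B := by
  obtain ⟨hS, hq, ha⟩ := hI
  obtain ⟨w, cs, hcomp, hw, hsat⟩ := hc
  rw [hS] at hsat
  have hcc : OnCycle Sys I.contribs c c := ⟨ReflTransGen.refl, ReflTransGen.refl⟩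
  refine ⟨cycleWrites Sys I.contribs c, cycleMem Sys I.contribs c, ?_, ?_, ?_⟩
  · rintro y ⟨e, i, p, he, he', htr, h1, h2⟩
    have h3 := (onCycle_stronglyConn he he').2 i
    exact ⟨e.pc i, p, htr, h1, h2, ⟨_, he', rfl⟩, by simpa using h3⟩
  · rintro y ⟨e, he, rfl⟩
    have h3 := (onCycle_stronglyConn hcc he).1
    rw [hq, ha] at h3
    exact ⟨e.leader, h3⟩
  · obtain ⟨e, o, e', h1, h2, h3, h4⟩ := hcomp.exists_op hsat hw
    have he : OnCycle Sys I.contribs c e := ⟨h1, ReflTransGen.head h3 h4⟩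
    have he' : OnCycle Sys I.contribs c e' := ⟨h1.tail h3, h4⟩
    have h5 := onCycle_stronglyConn hcc he
    have h6 := onCycle_stronglyConn hcc he'
    have h7 := onCycle_stronglyConn he he'
    rw [hq, ha] at h5 h6
    obtain ⟨-, -, hS1, hS2⟩ := h3
    cases h2 with
    | leader htrans hmem => exact Or.inl ⟨_, o, _, _, _, htrans, hmem, h5.1, h6.1⟩
    | @contributor q a b x pc p i htrans hmem =>
      have g1 : pc i ∈ I.contribs := hS1 ⟨i, rfl⟩
      have g2 : p ∈ I.contribs := hS2 ⟨i, by simp⟩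
      have g3 := labelIn_cycleMem (e := ⟨q, a, pc⟩) he he' hmem
      exact Or.inr ⟨_, o, _, htrans, g1, g2, g3, by simpa using h7.2 i⟩

/-! ### From a post-fixpoint to a cycle -/

/-- A computation with at least `n` memory operations whose configurations only have contributor
states of `S`. -/
def SatComp (Sys : LCSystem QL QC D) (S : Set QC) {t : ℕ} (c : Config QL QC D t) (n : ℕ)
    (d : Config QL QC D t) : Prop :=
  ∃ w cs, Computation Sys c w cs d ∧ n ≤ w.length ∧ ∀ c' ∈ cs, c'.contribStates ⊆ S

theorem SatComp.refl {Sys : LCSystem QL QC D} {S : Set QC} {t : ℕ} {c : Config QL QC D t}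
    (hc : c.contribStates ⊆ S) : SatComp Sys S c 0 c :=
  ⟨_, _, Computation.refl c, le_rfl, by simpa using hc⟩

theorem SatComp.head {Sys : LCSystem QL QC D} {S : Set QC} {t : ℕ} {c c' d : Config QL QC D t}
    {x : Option (MemOp D)} {n : ℕ} (hc : c.contribStates ⊆ S) (h : Step Sys c x c')
    (hd : SatComp Sys S c' n d) : SatComp Sys S c (x.toList.length + n) d := by
  obtain ⟨w, cs, h1, h2, h3⟩ := hd
  refine ⟨_, _, Computation.step h h1, by simpa using h2, ?_⟩
  simpa using ⟨hc, h3⟩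

theorem SatComp.weaken {Sys : LCSystem QL QC D} {S : Set QC} {t : ℕ} {c d : Config QL QC D t}
    {m n : ℕ} (h : SatComp Sys S c n d) (hmn : m ≤ n) : SatComp Sys S c m d := by
  obtain ⟨w, cs, h1, h2, h3⟩ := h
  exact ⟨w, cs, h1, hmn.trans h2, h3⟩

theorem SatComp.trans {Sys : LCSystem QL QC D} {S : Set QC} {t : ℕ} {c d e : Config QL QC D t}
    {m n : ℕ} (h : SatComp Sys S c m d) (h' : SatComp Sys S d n e) :
    SatComp Sys S c (m + n) e := by
  obtain ⟨w, cs, h1, h2, h3⟩ := h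
  induction h1 generalizing m with
  | refl c => exact h'.weaken (by simp at h2; omega)
  | @step c c' d x w cs hstep hrest ih =>
    have h4 := ih h' le_rfl (fun c' hc' => h3 _ (List.mem_cons_of_mem _ hc'))
    refine (h4.head (h3 _ (List.mem_cons_self ..)) hstep).weaken ?_
    simp at h2 ⊢
    omega

/-- Walks of the leader with the memory, where contributors can write the symbols of `A`.
`LeaderWalk Sys A c ms ws n d` leads from `c` to `d`, visits the memory values `ms`, uses the
contributor writes `ws`, and has `n` memory operations of the leader. -/
inductive LeaderWalk (Sys : LCSystem QL QC D) (A : Set D) :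
    QL × D → List D → List D → ℕ → QL × D → Prop
  | nil (q : QL) (a : D) : LeaderWalk Sys A (q, a) [a] [] 0 (q, a)
  | leader {p p' : QL} {a b : D} {d : QL × D} {x : Option (MemOp D)} {ms ws : List D} {n : ℕ}
      (htrans : (p, x, p') ∈ Sys.leader.trans) (hmem : MemEffect x a b)
      (h : LeaderWalk Sys A (p', b) ms ws n d) :
      LeaderWalk Sys A (p, a) (a :: ms) ws (x.toList.length + n) d
  | write {p : QL} {a b : D} {d : QL × D} {ms ws : List D} {n : ℕ} (hb : b ∈ A)
      (h : LeaderWalk Sys A (p, b) ms ws n d) :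
      LeaderWalk Sys A (p, a) (a :: ms) (b :: ws) n d

theorem LeaderWalk.head_mem {Sys : LCSystem QL QC D} {A : Set D} {c d : QL × D} {ms ws : List D}
    {n : ℕ} (h : LeaderWalk Sys A c ms ws n d) : c.2 ∈ ms := by
  cases h <;> simp

theorem LeaderWalk.writes_subset {Sys : LCSystem QL QC D} {A : Set D} {c d : QL × D}
    {ms ws : List D} {n : ℕ} (h : LeaderWalk Sys A c ms ws n d) :
    ∀ y ∈ ws, y ∈ ms ∧ y ∈ A := by
  induction h with
  | nil q a => simp
  | leader htrans hmem h ih =>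
    intro y hy
    exact ⟨List.mem_cons_of_mem _ (ih y hy).1, (ih y hy).2⟩
  | write hb h ih =>
    intro y hy
    rcases List.mem_cons.1 hy with rfl | hy
    · exact ⟨List.mem_cons_of_mem _ h.head_mem, hb⟩
    · exact ⟨List.mem_cons_of_mem _ (ih y hy).1, (ih y hy).2⟩

theorem LeaderWalk.trans {Sys : LCSystem QL QC D} {A : Set D} {c d e : QL × D}
    {ms ws ms' ws' : List D} {n n' : ℕ} (h : LeaderWalk Sys A c ms ws n d)
    (h' : LeaderWalk Sys A d ms' ws' n' e) :
    ∃ ms'' ws'', LeaderWalk Sys A c ms'' ws'' (n + n') e ∧ ms ⊆ ms'' ∧ ms' ⊆ ms'' := by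
  induction h with
  | nil q a => exact ⟨ms', ws', by simpa using h', by simpa using h'.head_mem, List.Subset.refl _⟩
  | leader htrans hmem h ih =>
    obtain ⟨ms'', ws'', h1, h2, h3⟩ := ih h'
    refine ⟨_, ws'', ?_, List.cons_subset_cons _ h2, List.subset_cons_of_subset _ h3⟩
    rw [add_assoc]
    exact LeaderWalk.leader htrans hmem h1
  | write hb h ih =>
    obtain ⟨ms'', ws'', h1, h2, h3⟩ := ih h'
    exact ⟨_, _, LeaderWalk.write hb h1, List.cons_subset_cons _ h2,
      List.subset_cons_of_subset _ h3⟩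

theorem exists_leaderWalk {Sys : LCSystem QL QC D} {A : Set D} {c d : QL × D}
    (h : ReflTransGen (LeaderEdge Sys A) c d) :
    ∃ ms ws n, LeaderWalk Sys A c ms ws n d := by
  induction h using ReflTransGen.head_induction_on with
  | refl => exact ⟨_, _, _, LeaderWalk.nil d.1 d.2⟩
  | @head c c' h1 h2 ih =>
    obtain ⟨ms, ws, n, h3⟩ := ih
    rcases h1 with ⟨x, h4, h5⟩ | ⟨h4, h5⟩
    · exact ⟨_, _, _, LeaderWalk.leader h4 h5 h3⟩
    · obtain ⟨p, a⟩ := c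
      obtain ⟨p', a'⟩ := c'
      obtain rfl : p' = p := h4
      exact ⟨_, _, _, LeaderWalk.write h5 h3⟩

/-- A closed walk through all memory values of `B`. -/
theorem exists_covering_walk [Finite D] {Sys : LCSystem QL QC D} {A : Set D} {c : QL × D}
    (B : Set D) (hB : ∀ b ∈ B, ∃ p, StronglyConn (LeaderEdge Sys A) c (p, b)) :
    ∃ ms ws n, LeaderWalk Sys A c ms ws n c ∧ ∀ b ∈ B, b ∈ ms := by
  induction B, B.toFinite using Set.Finite.induction_on with
  | empty => exact ⟨_, _, _, LeaderWalk.nil c.1 c.2, by simp⟩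
  | @insert b s hb hs ih =>
    obtain ⟨ms, ws, n, h1, h2⟩ := ih fun b' hb' => hB b' (Set.mem_insert_of_mem _ hb')
    obtain ⟨p, h3, h4⟩ := hB b (Set.mem_insert ..)
    obtain ⟨ms₁, ws₁, n₁, w₁⟩ := exists_leaderWalk h3
    obtain ⟨ms₂, ws₂, n₂, w₂⟩ := exists_leaderWalk h4
    obtain ⟨ms₃, ws₃, w₃, -, h5⟩ := w₁.trans w₂
    obtain ⟨ms₄, ws₄, w₄, h6, h7⟩ := h1.trans w₃
    refine ⟨ms₄, ws₄, _, w₄, ?_⟩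
    rintro b' (rfl | hb')
    · exact h7 (h5 w₂.head_mem)
    · exact h6 (h2 b' hb')

end Characterization

/-! ### One round of a post-fixpoint -/

section Round

open scoped Classical

variable {QL QC D : Type} {t : ℕ}

/-- The contributor states when the contributors in `U` still have to move from `src` to `dst`
and the others have done so. -/
def mix (src dst : Fin t → QC) (U : Finset (Fin t)) (i : Fin t) : QC :=
  if i ∈ U then src i else dst i

theorem mix_erase (src dst : Fin t → QC) (U : Finset (Fin t)) (i : Fin t) :
    mix src dst (U.erase i) = Function.update (mix src dst U) i (dst i) := by
  funext j
  by_cases hj : j = i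
  · subst hj; simp [mix]
  · simp [mix, hj]

theorem mix_contribStates {S : Set QC} {src dst : Fin t → QC} (hsrc : ∀ i, src i ∈ S)
    (hdst : ∀ i, dst i ∈ S) (U : Finset (Fin t)) (q : QL) (a : D) :
    (Config.mk q a (mix src dst U)).contribStates ⊆ S := by
  rintro _ ⟨i, rfl⟩
  simp only [mix]
  split_ifs
  · exact hsrc i
  · exact hdst i

/-- The number of memory operations that the contributors in `U` still have to execute. -/
def opCount (op : Fin t → Option (MemOp D)) (U : Finset (Fin t)) : ℕ :=
  ∑ i ∈ U, (op i).toList.length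

variable {Sys : LCSystem QL QC D} {S : Set QC} {src dst : Fin t → QC}
  {op : Fin t → Option (MemOp D)}

theorem step_mix {U : Finset (Fin t)} {i : Fin t} {q : QL} {a b : D} (hi : i ∈ U)
    (htrans : (src i, op i, dst i) ∈ Sys.contributor.trans) (hmem : MemEffect (op i) a b) :
    Step Sys ⟨q, a, mix src dst U⟩ (op i) ⟨q, b, mix src dst (U.erase i)⟩ := by
  rw [mix_erase]
  refine Step.contributor i ?_ hmem
  simpa [mix, hi] using htrans

/-- While the memory value is `a`, all contributors that read or write `a` can move, and so can
those with internal transitions: none of them changes the memory. -/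
theorem flush {q : QL} {a : D} (hsrc : ∀ i, src i ∈ S) (hdst : ∀ i, dst i ∈ S)
    (F : Finset (Fin t)) : ∀ (U : Finset (Fin t)), F ⊆ U →
    (∀ i ∈ F, (src i, op i, dst i) ∈ Sys.contributor.trans) → (∀ i ∈ F, MemEffect (op i) a a) →
    SatComp Sys S ⟨q, a, mix src dst U⟩ (opCount op F) ⟨q, a, mix src dst (U \ F)⟩ := by
  induction F using Finset.induction_on with
  | empty =>
    intro U _ _ _
    simpa [opCount] using SatComp.refl (mix_contribStates hsrc hdst U q a)
  | @insert i F hi ih =>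
    intro U hU htrans hmem
    have h1 : F ⊆ U.erase i := fun j hj =>
      Finset.mem_erase.2 ⟨fun h => hi (h ▸ hj), hU (Finset.mem_insert_of_mem hj)⟩
    have h2 := ih (U.erase i) h1 (fun j hj => htrans j (Finset.mem_insert_of_mem hj))
      (fun j hj => hmem j (Finset.mem_insert_of_mem hj))
    have h3 : U \ insert i F = U.erase i \ F := by
      ext j; simp; tauto
    rw [h3, opCount, Finset.sum_insert hi]
    exact h2.head (mix_contribStates hsrc hdst U q a)
      (step_mix (hU (Finset.mem_insert_self ..)) (htrans i (Finset.mem_insert_self ..))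
        (hmem i (Finset.mem_insert_self ..)))

/-- When the value `a` is visited for the last time, all contributors that have to read or write
it move. When it is visited again later, they wait: their writes may still be needed. -/
theorem flush_last_visit {q : QL} {a : D} {ms ws : List D} {U : Finset (Fin t)}
    (hsrc : ∀ i, src i ∈ S) (hdst : ∀ i, dst i ∈ S)
    (htrans : ∀ i ∈ U, (src i, op i, dst i) ∈ Sys.contributor.trans)
    (hin : ∀ i ∈ U, LabelIn {y | y ∈ a :: ms} (op i))
    (hcount : ∀ y, ws.count y ≤ (U.filter fun i => op i = some (MemOp.wr y)).card)
    (hws : ∀ y ∈ ws, y ∈ ms) :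
    ∃ U' ⊆ U, ∃ n, n + opCount op U' = opCount op U ∧
      SatComp Sys S ⟨q, a, mix src dst U⟩ n ⟨q, a, mix src dst U'⟩ ∧
      (∀ i ∈ U', LabelIn {y | y ∈ ms} (op i)) ∧
      ∀ y, ws.count y ≤ (U'.filter fun i => op i = some (MemOp.wr y)).card := by
  by_cases ha : a ∈ ms
  · refine ⟨U, Finset.Subset.refl _, 0, by simp,
      SatComp.refl (mix_contribStates hsrc hdst U q a), ?_, hcount⟩
    intro i hi
    refine (hin i hi).mono ?_
    rintro y (_ | ⟨_, hy⟩)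
    · exact ha
    · exact hy
  · set F := U.filter fun i => op i = some (MemOp.rd a) ∨ op i = some (MemOp.wr a) with hF
    refine ⟨U \ F, Finset.sdiff_subset, opCount op F, ?_, ?_, ?_, ?_⟩
    · rw [add_comm]; exact Finset.sum_sdiff (Finset.filter_subset _ _)
    · refine flush hsrc hdst F U (Finset.filter_subset _ _)
        (fun i hi => htrans i (Finset.mem_filter.1 hi).1) ?_
      intro i hi
      rcases (Finset.mem_filter.1 hi).2 with h | h <;> rw [h] <;> simp [MemEffect]
    · intro i hi
      rw [Finset.mem_sdiff] at hi
      have h1 := hin i hi.1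
      have h2 : ¬ (op i = some (MemOp.rd a) ∨ op i = some (MemOp.wr a)) := fun h =>
        hi.2 (Finset.mem_filter.2 ⟨hi.1, h⟩)
      revert h1 h2
      rcases op i with _ | b | b
      · intros; trivial
      · intro h1 h2
        rcases List.mem_cons.1 h1 with rfl | h1
        · simp at h2
        · exact h1
      · intro h1 h2
        rcases List.mem_cons.1 h1 with rfl | h1
        · simp at h2
        · exact h1
    · intro y
      by_cases hy : y ∈ ws
      · have hya : y ≠ a := fun h => ha (h ▸ hws y hy)
        refine (hcount y).trans (Finset.card_le_card ?_)
        intro i hi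
        rw [Finset.mem_filter] at hi
        refine Finset.mem_filter.2 ⟨Finset.mem_sdiff.2 ⟨hi.1, ?_⟩, hi.2⟩
        rw [hF, Finset.mem_filter, hi.2]
        simp [hya]
      · rw [List.count_eq_zero_of_not_mem hy]; exact Nat.zero_le _

/-- A closed walk of the leader lets every contributor take one transition, provided that it
visits all symbols of these transitions, and that enough contributors are about to write what
the walk needs. -/
theorem satComp_of_leaderWalk {A : Set D} {c d : QL × D} {ms ws : List D} {n : ℕ}
    (h : LeaderWalk Sys A c ms ws n d) (hsrc : ∀ i, src i ∈ S) (hdst : ∀ i, dst i ∈ S) :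
    ∀ U : Finset (Fin t), (∀ i ∈ U, (src i, op i, dst i) ∈ Sys.contributor.trans) →
    (∀ i ∈ U, LabelIn {y | y ∈ ms} (op i)) →
    (∀ y, ws.count y ≤ (U.filter fun i => op i = some (MemOp.wr y)).card) →
    SatComp Sys S ⟨c.1, c.2, mix src dst U⟩ (n + opCount op U) ⟨d.1, d.2, dst⟩ := by
  induction h with
  | nil q a =>
    intro U htrans hin _
    have h1 := flush (q := q) (a := a) hsrc hdst U U (Finset.Subset.refl _) htrans (by
      intro i hi
      have := hin i hi
      revert this
      rcases op i with _ | b | b <;> simp [LabelIn, MemEffect, eq_comm])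
    have h2 : mix src dst ∅ = dst := by funext i; simp [mix]
    simpa [h2] using h1
  | @leader p p' a b d x ms ws n htr hmem h ih =>
    intro U htrans hin hcount
    obtain ⟨U', hU', m, h1, h2, h3, h4⟩ := flush_last_visit (q := p) hsrc hdst htrans hin hcount
      fun y hy => (h.writes_subset y hy).1
    have h5 := ih U' (fun i hi => htrans i (hU' hi)) h3 h4
    have h6 := h5.head (mix_contribStates hsrc hdst U' p a) (Step.leader htr hmem)
    refine (h2.trans h6).weaken ?_
    omega
  | @write p a b d ms ws n hb h ih =>
    intro U htrans hin hcount
    obtain ⟨U', hU', m, h1, h2, h3, h4⟩ := flush_last_visit (q := p) hsrc hdst htrans hin hcount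
      (by
        intro y hy
        rcases List.mem_cons.1 hy with rfl | hy
        · exact h.head_mem
        · exact (h.writes_subset y hy).1)
    have h5 := h4 b
    rw [List.count_cons_self] at h5
    obtain ⟨i, hi⟩ := Finset.card_pos.1 (by omega :
      0 < (U'.filter fun i => op i = some (MemOp.wr b)).card)
    obtain ⟨hiU, hop⟩ := Finset.mem_filter.1 hi
    have h6 := ih (U'.erase i) (fun j hj => htrans j (hU' (Finset.mem_of_mem_erase hj)))
      (fun j hj => h3 j (Finset.mem_of_mem_erase hj)) (by
        intro y
        rw [Finset.filter_erase]
        have h7 := h4 y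
        by_cases hy : y = b
        · subst hy
          rw [Finset.card_erase_of_mem hi]
          omega
        · rw [List.count_cons_of_ne (Ne.symm hy)] at h7
          rw [Finset.erase_eq_of_notMem]
          · exact h7
          · simp [hop, Ne.symm hy])
    have h8 := h6.head (mix_contribStates hsrc hdst U' p a)
      (step_mix (q := p) (a := a) (b := b) hiU (htrans i (hU' hiU)) (by rw [hop]; rfl))
    refine (h2.trans h8).weaken ?_
    have h9 : opCount op U' = (op i).toList.length + opCount op (U'.erase i) :=
      (Finset.add_sum_erase U' _ hiU).symm
    omega

end Round

/-! ### Closed walks of contributors -/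

section ClosedWalks

variable {QL QC D : Type}

theorem exists_path {α : Type} {r : α → α → Prop} {u v : α} (h : ReflTransGen r u v) :
    ∃ (n : ℕ) (f : ℕ → α), f 0 = u ∧ f n = v ∧ ∀ j < n, r (f j) (f (j + 1)) := by
  induction h using ReflTransGen.head_induction_on with
  | refl => exact ⟨0, fun _ => v, rfl, rfl, by simp⟩
  | @head u u' h1 h2 ih =>
    obtain ⟨n, f, h3, h4, h5⟩ := ih
    refine ⟨n + 1, fun j => Nat.casesOn j u f, rfl, h4, ?_⟩
    rintro (_ | j) hj
    · simpa [h3] using h1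
    · exact h5 j (by omega)

/-- A transition inside a strongly connected component starts a closed walk, given here as a
periodic sequence of states and labels. -/
theorem exists_periodic_walk {Sys : LCSystem QL QC D} {S : Set QC} {B : Set D} {u v : QC}
    {x : Option (MemOp D)} (htrans : (u, x, v) ∈ Sys.contributor.trans) (hu : u ∈ S)
    (hx : LabelIn B x) (h : ReflTransGen (ContribEdge Sys S B) v u) :
    ∃ (l : ℕ) (γ : ℕ → QC) (lab : ℕ → Option (MemOp D)), 0 < l ∧
      (∀ j k, j ≡ k [MOD l] → γ j = γ k ∧ lab j = lab k) ∧ lab 0 = x ∧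
      ∀ j, (γ j, lab j, γ (j + 1)) ∈ Sys.contributor.trans ∧ γ j ∈ S ∧ LabelIn B (lab j) := by
  obtain ⟨n, f, h1, h2, h3⟩ := exists_path h
  set g : ℕ → QC := fun j => Nat.casesOn j u f with hg
  have hedge : ∀ j, ∃ y, j < n + 1 → (j = 0 → y = x) ∧
      (g j, y, g (j + 1)) ∈ Sys.contributor.trans ∧ g j ∈ S ∧ LabelIn B y := by
    rintro (_ | j)
    · exact ⟨x, fun _ => ⟨fun _ => rfl, by simpa [hg, h1] using htrans, hu, hx⟩⟩
    · by_cases hj : j < n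
      · obtain ⟨y, h4, h5, -, h6⟩ := h3 j hj
        exact ⟨y, fun _ => ⟨by simp, h4, h5, h6⟩⟩
      · exact ⟨none, fun h => absurd h (by omega)⟩
  choose lab hlab using hedge
  refine ⟨n + 1, fun j => g (j % (n + 1)), fun j => lab (j % (n + 1)), by omega, ?_, ?_, ?_⟩
  · intro j k hjk
    exact ⟨congrArg g hjk, congrArg lab hjk⟩
  · exact (hlab 0 (by omega)).1 rfl
  · intro j
    have hlt : j % (n + 1) < n + 1 := Nat.mod_lt _ (by omega)
    have h4 := (hlab (j % (n + 1)) hlt).2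
    have h5 : g ((j + 1) % (n + 1)) = g (j % (n + 1) + 1) := by
      rw [← Nat.mod_add_mod]
      rcases Nat.lt_or_ge (j % (n + 1) + 1) (n + 1) with h6 | h6
      · rw [Nat.mod_eq_of_lt h6]
      · have h7 : j % (n + 1) = n := by omega
        rw [h7, Nat.mod_self]
        exact h2.symm
    rw [← h5] at h4
    exact h4

instance MemOp.finite [Finite D] : Finite (MemOp D) := by
  refine Finite.of_injective (β := D ⊕ D)
    (fun o => match o with
      | MemOp.rd b => Sum.inl b
      | MemOp.wr b => Sum.inr b) ?_
  rintro (a | a) (b | b) h <;> simp_all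

end ClosedWalks

section Rotation

open scoped Classical

variable {QL QC D : Type}

/-- On every closed walk `k` there are `m` contributors at each of the `l` positions, and every
round moves all of them by one position. One idle contributor for each state in `S` makes sure
that the interface is matched. After `l` rounds, all contributors are back. -/
theorem exists_satCycle [Finite QC] {κ : Type} [Finite κ] {Sys : LCSystem QL QC D}
    {I : Interface QL QC D} {A : Set D} {ms ws : List D} {n l : ℕ}
    {γ : κ → ℕ → QC} {lab : κ → ℕ → Option (MemOp D)} (hl : 0 < l)
    (hwalk : LeaderWalk Sys A (I.leader, I.mem) ms ws n (I.leader, I.mem))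
    (hper : ∀ k i j, i ≡ j [MOD l] → γ k i = γ k j ∧ lab k i = lab k j)
    (hγ : ∀ k j, (γ k j, lab k j, γ k (j + 1)) ∈ Sys.contributor.trans ∧ γ k j ∈ I.contribs ∧
      LabelIn {y | y ∈ ms} (lab k j))
    (hA : ∀ y ∈ A, ∃ k, lab k 0 = some (MemOp.wr y))
    (hop : 1 ≤ n ∨ ∃ k, lab k 0 ≠ none) :
    ∃ (t : ℕ) (c : Config QL QC D t), I.Matches c ∧ HasSatCycleAt Sys c := by
  set m := ws.length + 1 with hm
  let ι := (κ × Fin m × Fin l) ⊕ I.contribs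
  obtain ⟨t, ⟨e⟩⟩ := Finite.exists_equiv_fin ι
  let place : ℕ → ι → QC := fun r i => Sum.elim (fun z => γ z.1 (z.2.2 + r)) (fun s => s.1) i
  let label : ℕ → ι → Option (MemOp D) :=
    fun r i => Sum.elim (fun z => lab z.1 (z.2.2 + r)) (fun _ => none) i
  let pc : ℕ → Fin t → QC := fun r i => place r (e.symm i)
  let op : ℕ → Fin t → Option (MemOp D) := fun r i => label r (e.symm i)
  let U : Finset (Fin t) := Finset.univ.filter fun i => (e.symm i).isLeft
  have hpc : ∀ r i, pc r i ∈ I.contribs := by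
    intro r i
    rcases h : e.symm i with z | s
    · simpa [pc, place, h] using (hγ _ _).2.1
    · simp [pc, place, h]
  -- In every round, `m` of the contributors on the walk `k` are at its first transition.
  have hfirst : ∀ r k, ∃ j : Fin l, ∀ x : Fin m,
      e (Sum.inl (k, x, j)) ∈ U ∧ op r (e (Sum.inl (k, x, j))) = lab k 0 := by
    intro r k
    refine ⟨⟨(l - r % l) % l, Nat.mod_lt _ hl⟩, fun x => ⟨by simp [U], ?_⟩⟩
    simp only [op, label, Equiv.symm_apply_apply, Sum.elim_inl]
    refine (hper k _ _ ?_).2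
    have h1 : r % l < l := Nat.mod_lt _ hl
    have h2 : ((l - r % l) % l + r) ≡ (l - r % l) + r % l [MOD l] :=
      Nat.ModEq.add (Nat.mod_modEq _ _) (Nat.mod_modEq _ _).symm
    refine h2.trans ?_
    rw [Nat.sub_add_cancel h1.le]
    simp [Nat.ModEq]
  have hround : ∀ r, SatComp Sys I.contribs ⟨I.leader, I.mem, pc r⟩ 1
      ⟨I.leader, I.mem, pc (r + 1)⟩ := by
    intro r
    have h1 := satComp_of_leaderWalk (src := pc r) (dst := pc (r + 1)) (op := op r) hwalk
      (hpc r) (hpc (r + 1)) U (by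
        intro i hi
        rcases h : e.symm i with z | s
        · simpa [pc, place, op, label, h, add_assoc] using (hγ z.1 (z.2.2 + r)).1
        · simp [U, h] at hi) (by
        intro i hi
        rcases h : e.symm i with z | s
        · simpa [op, label, h] using (hγ z.1 (z.2.2 + r)).2.2
        · simp [op, label, h, LabelIn]) (by
        intro y
        by_cases hy : y ∈ ws
        · obtain ⟨k, hk⟩ := hA y (hwalk.writes_subset y hy).2
          obtain ⟨j, hj⟩ := hfirst r k
          calc ws.count y ≤ m := (List.count_le_length).trans (by omega)
            _ = (Finset.univ.image fun x : Fin m => e (Sum.inl (k, x, j))).card := by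
              rw [Finset.card_image_of_injective]
              · simp
              · intro x x' h
                simpa [ι] using h
            _ ≤ _ := by
              refine Finset.card_le_card ?_
              intro i hi
              obtain ⟨x, -, rfl⟩ := Finset.mem_image.1 hi
              exact Finset.mem_filter.2 ⟨(hj x).1, (hj x).2.trans hk⟩
        · rw [List.count_eq_zero_of_not_mem hy]; exact Nat.zero_le _)
    have h2 : mix (pc r) (pc (r + 1)) U = pc r := by
      funext i
      by_cases hi : i ∈ U
      · simp [mix, hi]
      · rcases h : e.symm i with z | s
        · simp [U, h] at hi
        · simp [mix, hi, pc, place, h]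
    rw [h2] at h1
    refine h1.weaken ?_
    rcases hop with h3 | ⟨k, hk⟩
    · omega
    · obtain ⟨j, hj⟩ := hfirst r k
      have h4 := hj ⟨0, by omega⟩
      have h5 := Finset.single_le_sum (f := fun i => (op r i).toList.length)
        (fun i _ => Nat.zero_le _) h4.1
      have h6 : 1 ≤ (op r (e (Sum.inl (k, ⟨0, by omega⟩, j)))).toList.length := by
        rw [h4.2]
        rcases h7 : lab k 0 with _ | o
        · exact absurd h7 hk
        · simp
      have h7 : 1 ≤ opCount (op r) U := h6.trans h5
      omega
  have hrounds : ∀ r, SatComp Sys I.contribs ⟨I.leader, I.mem, pc 0⟩ r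
      ⟨I.leader, I.mem, pc r⟩ := by
    intro r
    induction r with
    | zero =>
      refine SatComp.refl ?_
      rintro _ ⟨i, rfl⟩
      exact hpc 0 i
    | succ r ih => exact ih.trans (hround r)
  have hback : pc l = pc 0 := by
    funext i
    rcases h : e.symm i with z | s
    · simpa [pc, place, h] using (hper z.1 (z.2.2 + l) z.2.2 (by simp [Nat.ModEq])).1
    · simp [pc, place, h]
  have hstates : (Config.mk I.leader I.mem (pc 0)).contribStates = I.contribs := by
    refine Set.Subset.antisymm ?_ ?_
    · rintro _ ⟨i, rfl⟩
      exact hpc 0 i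
    · intro s hs
      exact ⟨e (Sum.inr ⟨s, hs⟩), by simp [pc, place]⟩
  obtain ⟨w, cs, h1, h2, h3⟩ := hrounds l
  rw [hback] at h1
  refine ⟨t, ⟨I.leader, I.mem, pc 0⟩, ⟨hstates, rfl, rfl⟩, w, cs, h1, by omega, ?_⟩
  rw [hstates]
  exact h3

/-- A post-fixpoint with an operation on a cycle yields a saturated cycle: every contributor
transition inside a strongly connected component gets its own closed walk, and the product of the
lengths is a common period. -/
theorem satCycle_of_postfixpoint [Finite QC] [Finite D] {Sys : LCSystem QL QC D}
    {I : Interface QL QC D} {A B : Set D} (hA : A ⊆ nextWritable Sys I B)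
    (hB : B ⊆ nextVisited Sys I A) (hop : OpOnCycle Sys I A B) :
    ∃ (t : ℕ) (c : Config QL QC D t), I.Matches c ∧ HasSatCycleAt Sys c := by
  let κ := {z : Transition QC D // z ∈ Sys.contributor.trans ∧ z.1 ∈ I.contribs ∧
    z.2.2 ∈ I.contribs ∧ LabelIn B z.2.1 ∧
    StronglyConn (ContribEdge Sys I.contribs B) z.1 z.2.2}
  have : Fintype κ := Fintype.ofFinite κ
  choose l γ lab h1 h2 h3 h4 using fun z : κ =>
    exists_periodic_walk z.2.1 z.2.2.1 z.2.2.2.2.1 z.2.2.2.2.2.2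
  obtain ⟨ms, ws, n, hw, hms⟩ := exists_covering_walk B hB
  have hper : ∀ k i j, i ≡ j [MOD ∏ z, l z] → γ k i = γ k j ∧ lab k i = lab k j :=
    fun k i j hij => h2 k i j (hij.of_dvd (Finset.dvd_prod_of_mem l (Finset.mem_univ k)))
  have hl : 0 < ∏ z, l z := Finset.prod_pos fun z _ => h1 z
  have hAk : ∀ y ∈ A, ∃ k, lab k 0 = some (MemOp.wr y) := by
    intro y hy
    obtain ⟨u, v, g1, g2, g3, g4, g5⟩ := hA hy
    exact ⟨⟨(u, some (MemOp.wr y), v), g1, g2, g3, g4, g5⟩, h3 _⟩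
  have hfin : ∀ {ms ws n}, LeaderWalk Sys A (I.leader, I.mem) ms ws n (I.leader, I.mem) →
      (∀ b ∈ B, b ∈ ms) → (1 ≤ n ∨ ∃ k, lab k 0 ≠ none) →
      ∃ (t : ℕ) (c : Config QL QC D t), I.Matches c ∧ HasSatCycleAt Sys c :=
    fun hw hms hn => exists_satCycle hl hw hper
      (fun k j => ⟨(h4 k j).1, (h4 k j).2.1, (h4 k j).2.2.mono hms⟩) hAk hn
  rcases hop with ⟨p, o, p', x, y, g1, g2, g3, g4⟩ | ⟨u, o, v, g1, g2, g3, g4, g5⟩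
  · obtain ⟨ms₁, ws₁, n₁, w₁⟩ := exists_leaderWalk g3.1
    obtain ⟨ms₂, ws₂, n₂, w₂⟩ := exists_leaderWalk g4.2
    obtain ⟨ms₃, ws₃, w₃, -, -⟩ := w₁.trans (LeaderWalk.leader g1 g2 w₂)
    obtain ⟨ms₄, ws₄, w₄, h5, -⟩ := hw.trans w₃
    exact hfin w₄ (fun b hb => h5 (hms b hb)) (Or.inl (by simp; omega))
  · exact hfin hw hms (Or.inr ⟨⟨(u, some o, v), g1, g2, g3, g4, g5⟩, by rw [h3]; simp⟩)

theorem cyc_iff_postfixpoint (P : CycInstance) :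
    CYC P ↔ ∃ A B, A ⊆ nextWritable P.system P.iface B ∧ B ⊆ nextVisited P.system P.iface A ∧
      OpOnCycle P.system P.iface A B := by
  constructor
  · rintro ⟨t, c, h1, h2⟩
    exact postfixpoint_of_satCycle h1 h2
  · rintro ⟨A, B, h1, h2, h3⟩
    exact satCycle_of_postfixpoint h1 h2 h3

end Rotation

end LeaderContributor

namespace LeaderContributor

/-! ### Iterating a monotone map on a finite power set -/

theorem iterate_succ_subset {α : Type} {f : Set α → Set α} (hf : Monotone f) (n : ℕ) :
    f (f^[n] Set.univ) ⊆ f^[n] Set.univ := by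
  induction n with
  | zero => exact Set.subset_univ _
  | succ n ih =>
    rw [Function.iterate_succ_apply']
    exact hf ih

theorem subset_iterate {α : Type} {f : Set α → Set α} (hf : Monotone f) {T : Set α}
    (hT : T ⊆ f T) (n : ℕ) : T ⊆ f^[n] Set.univ := by
  induction n with
  | zero => exact Set.subset_univ _
  | succ n ih =>
    rw [Function.iterate_succ_apply']
    exact hT.trans (hf ih)

/-- The iterates decrease, so each of them is the greatest fixpoint or has lost one more
element. -/
theorem iterate_card_fixed {α : Type} [Fintype α] {f : Set α → Set α} (hf : Monotone f) :
    f (f^[Fintype.card α] Set.univ) = f^[Fintype.card α] Set.univ := by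
  have key : ∀ n, f (f^[n] Set.univ) = f^[n] Set.univ ∨
      (f^[n] Set.univ).ncard + n ≤ Fintype.card α := by
    intro n
    induction n with
    | zero => right; simp [Set.ncard_univ]
    | succ n ih =>
      rw [Function.iterate_succ_apply']
      rcases ih with h | h
      · left; rw [h, h]
      · by_cases h1 : f (f^[n] Set.univ) = f^[n] Set.univ
        · left; rw [h1, h1]
        · right
          have := Set.ncard_lt_ncard ((iterate_succ_subset hf n).ssubset_of_ne h1)
            (Set.toFinite _)
          omega
  rcases key (Fintype.card α) with h | h
  · exact h
  · have h1 : f^[Fintype.card α] Set.univ = ∅ := by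
      rw [← Set.ncard_eq_zero (Set.toFinite _)]; omega
    have h2 := iterate_succ_subset hf (Fintype.card α)
    rw [h1] at h2 ⊢
    exact Set.subset_eq_empty h2 rfl

/-! ### Counting programs -/

namespace Ram

@[simp] theorem State.setReg_reg (σ : State) (x v y : ℕ) :
    (σ.setReg x v).reg y = if y = x then v else σ.reg y := by
  simp [State.setReg, Function.update_apply]

@[simp] theorem State.setReg_arr (σ : State) (x v : ℕ) : (σ.setReg x v).arr = σ.arr := rfl

@[simp] theorem State.setArr_reg (σ : State) (k i v : ℕ) : (σ.setArr k i v).reg = σ.reg := rfl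

theorem State.setArr_arr (σ : State) (k i v l j : ℕ) :
    (σ.setArr k i v).arr l j = if l = k ∧ j = i then v else σ.arr l j := by
  by_cases h : l = k
  · subst h; simp [State.setArr, Function.update_apply]
  · simp [State.setArr, h]

@[simp] theorem State.setArr_arr_same (σ : State) (k i v j : ℕ) :
    (σ.setArr k i v).arr k j = if j = i then v else σ.arr k j := by
  simp [State.setArr_arr]

@[simp] theorem State.setArr_arr_ne (σ : State) {k l : ℕ} (i v : ℕ) (h : l ≠ k) :
    (σ.setArr k i v).arr l = σ.arr l := by
  simp [State.setArr, h]

/-- Programs whose loops count up to the value of a register. `count x b p` runs `p` with `x`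
equal to `0`, `1`, and so on, as long as `x` is less than `b`, and `inc x b` increments `x` if it
is less than `b`. Every such program halts, so that it has a meaning `Cmd.den`, and a bound for
its running time can be read off. -/
inductive Cmd : Type
  | skip
  | assign (x : ℕ) (e : Expr)
  | store (k : ℕ) (e f : Expr)
  | seq (p r : Cmd)
  | ite (e : Expr) (p r : Cmd)
  | count (x b : ℕ) (p : Cmd)
  | inc (x b : ℕ)

namespace Cmd

/-- The final state of a program. -/
def den : Cmd → State → State
  | skip, σ => σ
  | assign x e, σ => σ.setReg x (e.eval σ)
  | store k e f, σ => σ.setArr k (e.eval σ) (f.eval σ)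
  | seq p r, σ => r.den (p.den σ)
  | ite e p r, σ => if e.eval σ ≠ 0 then p.den σ else r.den σ
  | count x b p, σ => (fun τ => (p.den τ).setReg x (τ.reg x + 1))^[σ.reg b] (σ.setReg x 0)
  | inc x b, σ => if σ.reg x < σ.reg b then σ.setReg x (σ.reg x + 1) else σ

/-- The translation to programs of the machine. -/
def compile : Cmd → Prog
  | skip => Prog.skip
  | assign x e => Prog.assign x e
  | store k e f => Prog.store k e f
  | seq p r => Prog.seq p.compile r.compile
  | ite e p r => Prog.cond e p.compile r.compile
  | count x b p =>
    Prog.seq (Prog.assign x (Expr.const 0)) (Prog.loop (Expr.lt (Expr.reg x) (Expr.reg b))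
      (Prog.seq p.compile (Prog.assign x (Expr.add (Expr.reg x) (Expr.const 1)))))
  | inc x b => Prog.cond (Expr.lt (Expr.reg x) (Expr.reg b))
      (Prog.assign x (Expr.add (Expr.reg x) (Expr.const 1))) Prog.skip

/-- An upper bound for the running time, for given values of the registers that bound loops. -/
def cost : Cmd → (ℕ → ℕ) → ℕ
  | skip, _ => 1
  | assign _ e, _ => e.cost + 1
  | store _ e f, _ => e.cost + f.cost + 1
  | seq p r, ρ => p.cost ρ + r.cost ρ
  | ite e p r, ρ => e.cost + 1 + (p.cost ρ + r.cost ρ)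
  | count _ b p, ρ => 6 + ρ b * (8 + p.cost ρ)
  | inc _ _, _ => 8

/-- The program may write the register. -/
def writesReg : Cmd → ℕ → Bool
  | skip, _ => false
  | assign x _, y => x == y
  | store _ _ _, _ => false
  | seq p r, y => p.writesReg y || r.writesReg y
  | ite _ p r, y => p.writesReg y || r.writesReg y
  | count x _ p, y => x == y || p.writesReg y
  | inc x _, y => x == y

/-- The program may write the array. -/
def writesArr : Cmd → ℕ → Bool
  | skip, _ => false
  | assign _ _, _ => false
  | store k _ _, l => k == l
  | seq p r, l => p.writesArr l || r.writesArr l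
  | ite _ p r, l => p.writesArr l || r.writesArr l
  | count _ _ p, l => p.writesArr l
  | inc _ _, _ => false

end Cmd

/-- If all registers and array entries are smaller than `V`, then the value of the expression
is smaller than `V` to the power of its degree. -/
def Expr.deg : Expr → ℕ
  | const _ => 1
  | reg _ => 1
  | arr _ _ => 1
  | add e f => max e.deg f.deg + 1
  | sub e _ => e.deg
  | mul e f => e.deg + f.deg
  | lt _ _ => 1
  | eq _ _ => 1

/-- All subexpressions have degree at most `d`, and all constants are smaller than `3`. -/
def Expr.ok (d : ℕ) : Expr → Bool
  | const n => n < 3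
  | reg _ => true
  | arr _ e => e.ok d
  | add e f => e.ok d && f.ok d && max e.deg f.deg + 1 ≤ d
  | sub e f => e.ok d && f.ok d
  | mul e f => e.ok d && f.ok d && e.deg + f.deg ≤ d
  | lt e f => e.ok d && f.ok d
  | eq e f => e.ok d && f.ok d

/-- The conditions under which a counting program keeps all values small: only values of degree
`1` are stored, the registers below `20` are constants, they alone bound loops, and the body of
a loop leaves the loop variable alone. -/
def Cmd.wf : Cmd → Bool
  | skip => true
  | assign x e => 20 ≤ x && e.ok 8 && e.deg ≤ 1
  | store _ e f => e.ok 8 && f.ok 8 && f.deg ≤ 1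
  | seq p r => p.wf && r.wf
  | ite e p r => e.ok 8 && p.wf && r.wf
  | count x b p => 20 ≤ x && b < 20 && !p.writesReg x && p.wf
  | inc x b => 20 ≤ x && b < 20

/-- All registers and array entries are smaller than `V`. -/
def State.Bounded (V : ℕ) (σ : State) : Prop :=
  (∀ x, σ.reg x < V) ∧ ∀ k i, σ.arr k i < V

theorem State.Bounded.setReg {V : ℕ} {σ : State} (h : σ.Bounded V) {x v : ℕ} (hv : v < V) :
    (σ.setReg x v).Bounded V := by
  refine ⟨fun y => ?_, h.2⟩
  rw [State.setReg_reg]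
  split_ifs
  · exact hv
  · exact h.1 y

theorem State.Bounded.setArr {V : ℕ} {σ : State} (h : σ.Bounded V) {k i v : ℕ} (hv : v < V) :
    (σ.setArr k i v).Bounded V := by
  refine ⟨h.1, fun l j => ?_⟩
  rw [State.setArr_arr]
  split_ifs
  · exact hv
  · exact h.2 l j

theorem Expr.deg_pos (e : Expr) : 1 ≤ e.deg := by
  induction e <;> simp only [Expr.deg] <;> omega

theorem Expr.eval_lt {V d : ℕ} {σ : State} (hV : 3 ≤ V) (h : σ.Bounded V) (e : Expr)
    (he : e.ok d = true) : e.eval σ < V ^ e.deg := by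
  induction e with
  | const n => simp only [Expr.ok, decide_eq_true_eq] at he; simp [eval, deg]; omega
  | reg x => simpa [eval, deg] using h.1 x
  | arr k e ih => simpa [eval, deg] using h.2 k _
  | add e f ihe ihf =>
    simp only [Expr.ok, Bool.and_eq_true] at he
    have h1 := ihe he.1.1
    have h2 := ihf he.1.2
    have h3 : V ^ e.deg ≤ V ^ max e.deg f.deg := Nat.pow_le_pow_right (by omega) (le_max_left _ _)
    have h4 : V ^ f.deg ≤ V ^ max e.deg f.deg := Nat.pow_le_pow_right (by omega) (le_max_right _ _)
    simp only [eval, deg, pow_succ]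
    nlinarith
  | sub e f ihe ihf =>
    simp only [Expr.ok, Bool.and_eq_true] at he
    exact (Nat.sub_le _ _).trans_lt (ihe he.1)
  | mul e f ihe ihf =>
    simp only [Expr.ok, Bool.and_eq_true] at he
    simp only [eval, deg, pow_add]
    exact Nat.mul_lt_mul'' (ihe he.1.1) (ihf he.1.2)
  | lt e f ihe ihf => simp only [eval, deg, pow_one]; split_ifs <;> omega
  | eq e f ihe ihf => simp only [eval, deg, pow_one]; split_ifs <;> omega

theorem Expr.fits_of_ok {V W d : ℕ} {σ : State} (hV : 3 ≤ V) (hd : 1 ≤ d) (hW : V ^ d ≤ W)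
    (h : σ.Bounded V) (e : Expr) (he : e.ok d = true) : e.Fits W σ := by
  have hVW : V ≤ W := (Nat.le_self_pow (by omega) V).trans hW
  have hval : ∀ e : Expr, e.ok d = true → e.deg ≤ d → e.eval σ < W := fun e he hdeg =>
    (e.eval_lt hV h he).trans_le ((Nat.pow_le_pow_right (by omega) hdeg).trans hW)
  induction e with
  | const n => exact hval _ he hd
  | reg x => exact (h.1 x).trans_le hVW
  | arr k e ih => exact ⟨ih he, (h.2 k _).trans_le hVW⟩
  | add e f ihe ihf =>
    have he' := he
    simp only [Expr.ok, Bool.and_eq_true, decide_eq_true_eq] at he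
    exact ⟨ihe he.1.1, ihf he.1.2, hval (add e f) he' he.2⟩
  | sub e f ihe ihf =>
    simp only [Expr.ok, Bool.and_eq_true] at he
    exact ⟨ihe he.1, ihf he.2⟩
  | mul e f ihe ihf =>
    have he' := he
    simp only [Expr.ok, Bool.and_eq_true, decide_eq_true_eq] at he
    exact ⟨ihe he.1.1, ihf he.1.2, hval (mul e f) he' he.2⟩
  | lt e f ihe ihf =>
    simp only [Expr.ok, Bool.and_eq_true] at he
    exact ⟨ihe he.1, ihf he.2, by omega⟩
  | eq e f ihe ihf =>
    simp only [Expr.ok, Bool.and_eq_true] at he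
    exact ⟨ihe he.1, ihf he.2, by omega⟩

namespace Cmd

theorem den_seq (p r : Cmd) (σ : State) : (seq p r).den σ = r.den (p.den σ) := rfl

theorem den_assign (x : ℕ) (e : Expr) (σ : State) :
    (assign x e).den σ = σ.setReg x (e.eval σ) := rfl

theorem den_store (k : ℕ) (e f : Expr) (σ : State) :
    (store k e f).den σ = σ.setArr k (e.eval σ) (f.eval σ) := rfl

theorem den_inc (x b : ℕ) (σ : State) :
    (inc x b).den σ = if σ.reg x < σ.reg b then σ.setReg x (σ.reg x + 1) else σ := rfl

theorem den_ite (e : Expr) (p r : Cmd) (σ : State) :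
    (ite e p r).den σ = if e.eval σ ≠ 0 then p.den σ else r.den σ := rfl

theorem den_reg (p : Cmd) {r : ℕ} (h : p.writesReg r = false) (σ : State) :
    (p.den σ).reg r = σ.reg r := by
  induction p generalizing σ with
  | skip => rfl
  | assign x e => simp [writesReg] at h; simp [den, Ne.symm h]
  | store k e f => rfl
  | seq p q ihp ihq =>
    simp [writesReg] at h
    simp [den, ihp h.1, ihq h.2]
  | ite e p q ihp ihq =>
    simp [writesReg] at h
    simp only [den]
    split_ifs
    · exact ihp h.1 σ
    · exact ihq h.2 σ
  | count x b p ih =>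
    simp [writesReg] at h
    have key : ∀ n τ, ((fun τ => (p.den τ).setReg x (τ.reg x + 1))^[n] τ).reg r = τ.reg r := by
      intro n
      induction n with
      | zero => intro τ; rfl
      | succ n ihn =>
        intro τ
        rw [Function.iterate_succ_apply, ihn]
        simp [ih h.2, Ne.symm h.1]
    simp only [den]
    rw [key]
    simp [Ne.symm h.1]
  | inc x b =>
    simp [writesReg] at h
    simp only [den]
    split_ifs <;> simp [Ne.symm h]

theorem den_arr (p : Cmd) {k : ℕ} (h : p.writesArr k = false) (σ : State) :
    (p.den σ).arr k = σ.arr k := by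
  induction p generalizing σ with
  | skip => rfl
  | assign x e => rfl
  | store k' e f => simp [writesArr] at h; simp [den, Ne.symm h]
  | seq p q ihp ihq =>
    simp [writesArr] at h
    simp [den, ihp h.1, ihq h.2]
  | ite e p q ihp ihq =>
    simp [writesArr] at h
    simp only [den]
    split_ifs
    · exact ihp h.1 σ
    · exact ihq h.2 σ
  | count x b p ih =>
    have key : ∀ n τ, ((fun τ => (p.den τ).setReg x (τ.reg x + 1))^[n] τ).arr k = τ.arr k := by
      intro n
      induction n with
      | zero => intro τ; rfl
      | succ n ihn =>
        intro τ
        rw [Function.iterate_succ_apply, ihn]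
        simp [ih h]
    simp only [den]
    rw [key]
    simp
  | inc x b =>
    simp only [den]
    split_ifs <;> simp

/-- The rule for loops: an invariant indexed by the number of rounds. What the body does not
write keeps its initial value. -/
theorem den_count_inv {x b : ℕ} {p : Cmd} {σ : State} (Inv : ℕ → State → Prop)
    (h0 : Inv 0 (σ.setReg x 0))
    (hstep : ∀ i τ, i < σ.reg b → τ.reg x = i →
      (∀ r, (count x b p).writesReg r = false → τ.reg r = σ.reg r) →
      (∀ k, p.writesArr k = false → τ.arr k = σ.arr k) → Inv i τ →
      Inv (i + 1) ((p.den τ).setReg x (i + 1))) :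
    Inv (σ.reg b) ((count x b p).den σ) := by
  have key : ∀ n ≤ σ.reg b, ∀ τ, τ = (fun τ => (p.den τ).setReg x (τ.reg x + 1))^[n]
      (σ.setReg x 0) → τ.reg x = n ∧
      (∀ r, (count x b p).writesReg r = false → τ.reg r = σ.reg r) ∧
      (∀ k, p.writesArr k = false → τ.arr k = σ.arr k) ∧ Inv n τ := by
    intro n
    induction n with
    | zero =>
      rintro - τ rfl
      refine ⟨by simp, fun r hr => ?_, fun k _ => rfl, h0⟩
      simp only [writesReg, Bool.or_eq_false_iff, beq_eq_false_iff_ne] at hr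
      simp [Ne.symm hr.1]
    | succ n ih =>
      rintro hn τ' rfl
      rw [Function.iterate_succ_apply']
      obtain ⟨h1, h2, h3, h4⟩ := ih (by omega) _ rfl
      generalize (fun τ => (p.den τ).setReg x (τ.reg x + 1))^[n] (σ.setReg x 0) = τ at *
      refine ⟨by simp [h1], fun r hr => ?_, fun k hk => ?_, ?_⟩
      · have hr' := hr
        simp only [writesReg, Bool.or_eq_false_iff, beq_eq_false_iff_ne] at hr
        rw [← h2 r hr', State.setReg_reg, if_neg (Ne.symm hr.1), den_reg p hr.2]
      · rw [← h3 k hk, State.setReg_arr, den_arr p hk]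
      · have h5 := hstep n _ (by omega) h1 h2 h3 h4
        rwa [h1]
  exact (key _ le_rfl _ rfl).2.2.2

theorem wf_writesReg {p : Cmd} (hp : p.wf = true) {r : ℕ} (hr : r < 20) :
    p.writesReg r = false := by
  induction p with
  | skip => rfl
  | assign x e => simp [wf, writesReg] at *; omega
  | store k e f => rfl
  | seq p q ihp ihq => simp [wf, writesReg] at *; exact ⟨ihp hp.1, ihq hp.2⟩
  | ite e p q ihp ihq => simp [wf, writesReg] at *; exact ⟨ihp hp.1.2, ihq hp.2⟩
  | count x b p ih => simp [wf, writesReg] at *; exact ⟨by omega, ih hp.2⟩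
  | inc x b => simp [wf, writesReg] at *; omega

theorem cost_congr {p : Cmd} (hp : p.wf = true) {ρ ρ' : ℕ → ℕ} (h : ∀ r < 20, ρ r = ρ' r) :
    p.cost ρ = p.cost ρ' := by
  induction p with
  | skip => rfl
  | assign x e => rfl
  | store k e f => rfl
  | seq p q ihp ihq => simp [wf, cost] at *; rw [ihp hp.1, ihq hp.2]
  | ite e p q ihp ihq => simp [wf, cost] at *; rw [ihp hp.1.2, ihq hp.2]
  | count x b p ih => simp [wf, cost] at *; rw [ih hp.2, h b hp.1.1.2]
  | inc x b => rfl

/-- The translation of a well-formed program computes its meaning, within the cost bound and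
with small values. -/
theorem exec_compile {V W : ℕ} (hV : 3 ≤ V) (hW : V ^ 8 ≤ W) (p : Cmd) (hp : p.wf = true)
    (σ : State) (hσ : σ.Bounded V) :
    (∃ n ≤ p.cost σ.reg, Exec W p.compile σ n (p.den σ)) ∧ (p.den σ).Bounded V := by
  have hfit : ∀ (e : Expr) (τ : State), τ.Bounded V → e.ok 8 = true → e.Fits W τ :=
    fun e τ hτ he => e.fits_of_ok hV (by omega) hW hτ he
  have hval : ∀ (e : Expr) (τ : State), τ.Bounded V → e.ok 8 = true → e.deg ≤ 1 →
      e.eval τ < V := fun e τ hτ he hd => by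
    simpa [le_antisymm hd e.deg_pos] using e.eval_lt hV hτ he
  have hVW : V ≤ W := (Nat.le_self_pow (by omega) V).trans hW
  have hV2 : V * V ≤ W := by
    refine le_trans ?_ hW
    rw [← pow_two]
    exact Nat.pow_le_pow_right (by omega) (by omega)
  induction p generalizing σ with
  | skip => exact ⟨⟨_, le_rfl, Exec.skip σ⟩, hσ⟩
  | assign x e =>
    simp [wf] at hp
    exact ⟨⟨_, le_rfl, Exec.assign σ x e (hfit e σ hσ hp.1.2)⟩,
      hσ.setReg (hval e σ hσ hp.1.2 hp.2)⟩
  | store k e f =>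
    simp [wf] at hp
    exact ⟨⟨_, le_rfl, Exec.store σ k e f (hfit e σ hσ hp.1.1) (hfit f σ hσ hp.1.2)⟩,
      hσ.setArr (hval f σ hσ hp.1.2 hp.2)⟩
  | seq p q ihp ihq =>
    simp [wf] at hp
    obtain ⟨⟨m, hm, h1⟩, h2⟩ := ihp hp.1 σ hσ
    obtain ⟨⟨n, hn, h3⟩, h4⟩ := ihq hp.2 _ h2
    rw [cost_congr hp.2 fun r hr => den_reg p (wf_writesReg hp.1 hr) σ] at hn
    exact ⟨⟨_, Nat.add_le_add hm hn, Exec.seq h1 h3⟩, h4⟩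
  | ite e p q ihp ihq =>
    simp [wf] at hp
    by_cases he : e.eval σ = 0
    · obtain ⟨⟨m, hm, h1⟩, h2⟩ := ihq hp.2 σ hσ
      simp only [den, he, ne_eq, not_true_eq_false, if_false]
      exact ⟨⟨_, by simp only [cost]; omega,
        Exec.cond_false _ (hfit e σ hσ hp.1.1) he h1⟩, h2⟩
    · obtain ⟨⟨m, hm, h1⟩, h2⟩ := ihp hp.1.2 σ hσ
      simp only [den, he, ne_eq, not_false_eq_true, if_true]
      exact ⟨⟨_, by simp only [cost]; omega,
        Exec.cond_true _ (hfit e σ hσ hp.1.1) he h1⟩, h2⟩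
  | count x b p ih =>
    simp [wf] at hp
    obtain ⟨⟨⟨hx, hb⟩, hpx⟩, hp⟩ := hp
    have hxb : b ≠ x := by omega
    have hfits : ∀ τ : State, τ.Bounded V → (Expr.lt (Expr.reg x) (Expr.reg b)).Fits W τ :=
      fun τ hτ => hfit _ τ hτ rfl
    have key : ∀ m τ, τ.Bounded V → τ.reg x + m = τ.reg b →
        (∃ n ≤ 4 + m * (8 + p.cost τ.reg), Exec W (Prog.loop (Expr.lt (Expr.reg x) (Expr.reg b))
          (Prog.seq p.compile (Prog.assign x (Expr.add (Expr.reg x) (Expr.const 1))))) τ n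
          ((fun τ => (p.den τ).setReg x (τ.reg x + 1))^[m] τ)) ∧
        ((fun τ => (p.den τ).setReg x (τ.reg x + 1))^[m] τ).Bounded V := by
      intro m
      induction m with
      | zero =>
        intro τ hτ hm
        refine ⟨⟨_, le_of_eq ?_, Exec.loop_false _ (hfits τ hτ) ?_⟩, hτ⟩
        · simp [Expr.cost]
        · rw [Expr.eval, Expr.eval, Expr.eval, if_neg (by omega)]
      | succ m ihm =>
        intro τ hτ hm
        obtain ⟨⟨n, hn, h1⟩, h2⟩ := ih hp τ hτ
        have h3 : (p.den τ).reg x = τ.reg x := den_reg p hpx τ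
        have h4 : (p.den τ).reg b = τ.reg b := den_reg p (wf_writesReg hp hb) τ
        have h5 : τ.reg x + 1 < V := by have := hτ.1 b; omega
        have h6 : ((p.den τ).setReg x (τ.reg x + 1)).Bounded V := h2.setReg h5
        obtain ⟨⟨n', hn', h7⟩, h8⟩ := ihm _ h6 (by simp [hxb, h4]; omega)
        rw [Function.iterate_succ_apply]
        refine ⟨⟨_, ?_, Exec.loop_true (n := n') (hfits τ hτ) ?_ (Exec.seq h1
          (Exec.assign _ _ _ (hfit _ _ h2 rfl))) ?_⟩, h8⟩
        · have h9 : p.cost ((p.den τ).setReg x (τ.reg x + 1)).reg = p.cost τ.reg := by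
            refine cost_congr hp fun r hr => ?_
            rw [State.setReg_reg, if_neg (by omega), den_reg p (wf_writesReg hp hr)]
          rw [h9] at hn'
          simp only [Expr.cost]
          rw [Nat.succ_mul]
          omega
        · rw [Expr.eval, Expr.eval, Expr.eval, if_pos (by omega)]
          exact one_ne_zero
        · simp only [Expr.eval, h3]
          exact h7
    obtain ⟨⟨n, hn, h1⟩, h2⟩ := key (σ.reg b) (σ.setReg x 0) (hσ.setReg (by omega))
      (by simp [hxb])
    rw [cost_congr hp (ρ' := σ.reg) fun r hr => by
      rw [State.setReg_reg, if_neg (by omega)]] at hn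
    refine ⟨⟨_, ?_, Exec.seq (Exec.assign σ x _ ?_) h1⟩, h2⟩
    · simp only [cost, Expr.cost]; omega
    · simp [Expr.Fits]; omega
  | inc x b =>
    have hf : (Expr.lt (Expr.reg x) (Expr.reg b)).Fits W σ := hfit _ σ hσ rfl
    by_cases h : σ.reg x < σ.reg b
    · have h1 := hσ.1 b
      simp only [den, h, if_true]
      refine ⟨⟨_, ?_, Exec.cond_true _ hf (by simp [Expr.eval, h]) (Exec.assign _ _ _ ?_)⟩,
        hσ.setReg (by omega)⟩
      · simp [cost, Expr.cost]
      · exact hfit _ σ hσ rfl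
    · simp only [den, h, if_false]
      refine ⟨⟨_, ?_, Exec.cond_false _ hf (by rw [Expr.eval, Expr.eval, Expr.eval, if_neg h]) (Exec.skip σ)⟩, hσ⟩
      simp [cost, Expr.cost]

/-! ### Marking loops -/

/-- The program marks the entries in `Q` of the array `k`, where marked means nonzero. -/
def Marks (p : Cmd) (k : ℕ) (σ : State) (Q : ℕ → Prop) : Prop :=
  ∀ i, (p.den σ).arr k i ≠ 0 ↔ σ.arr k i ≠ 0 ∨ Q i

theorem Marks.congr {p : Cmd} {k : ℕ} {σ : State} {Q Q' : ℕ → Prop} (h : Marks p k σ Q)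
    (hQ : ∀ i, Q i ↔ Q' i) : Marks p k σ Q' := fun i => by rw [h i, hQ i]

theorem marks_skip (k : ℕ) (σ : State) : Marks skip k σ fun _ => False := fun i => by simp [den]

theorem marks_store (k : ℕ) (e : Expr) (σ : State) :
    Marks (store k e (Expr.const 1)) k σ fun i => i = e.eval σ := fun i => by
  simp only [den, State.setArr_arr_same, Expr.eval]
  split_ifs with h <;> simp [h]

theorem marks_ite {e : Expr} {p r : Cmd} {k : ℕ} {σ : State} {Q Q' : ℕ → Prop}
    (hp : Marks p k σ Q) (hr : Marks r k σ Q') :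
    Marks (ite e p r) k σ fun i => (e.eval σ ≠ 0 ∧ Q i) ∨ (e.eval σ = 0 ∧ Q' i) := fun i => by
  by_cases h : e.eval σ = 0
  · simp [den, h, hr i]
  · simp [den, h, hp i]

theorem marks_when {e : Expr} {p : Cmd} {k : ℕ} {σ : State} {Q : ℕ → Prop}
    (hp : Marks p k σ Q) : Marks (ite e p skip) k σ fun i => e.eval σ ≠ 0 ∧ Q i :=
  (marks_ite hp (marks_skip k σ)).congr fun i => by simp

theorem marks_count {x b k : ℕ} {p : Cmd} {σ : State} {Q : ℕ → ℕ → Prop}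
    (h : ∀ i τ, i < σ.reg b → τ.reg x = i →
      (∀ r, (count x b p).writesReg r = false → τ.reg r = σ.reg r) →
      (∀ l, p.writesArr l = false → τ.arr l = σ.arr l) → Marks p k τ (Q i)) :
    Marks (count x b p) k σ fun j => ∃ i < σ.reg b, Q i j := by
  refine den_count_inv (σ := σ) (x := x) (b := b) (p := p)
    (fun n τ => ∀ j, τ.arr k j ≠ 0 ↔ σ.arr k j ≠ 0 ∨ ∃ i < n, Q i j) (by simp) ?_
  intro i τ hi h1 h2 h3 h4 j
  rw [State.setReg_arr, h i τ hi h1 h2 h3 j, h4 j, or_assoc]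
  refine or_congr Iff.rfl ⟨?_, ?_⟩
  · rintro (⟨i', h5, h6⟩ | h6)
    · exact ⟨i', by omega, h6⟩
    · exact ⟨i, by omega, h6⟩
  · rintro ⟨i', h5, h6⟩
    rcases Nat.lt_or_ge i' i with h7 | h7
    · exact Or.inl ⟨i', h7, h6⟩
    · obtain rfl : i' = i := by omega
      exact Or.inr h6

end Cmd

end Ram

end LeaderContributor

namespace LeaderContributor

open Relation

/-! ### Strongly connected components by path contraction -/

theorem index_inj {N i j i' j' : ℕ} (hj : j < N) (hj' : j' < N) (h : i * N + j = i' * N + j') :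
    i = i' ∧ j = j' := by
  have h1 : (i * N + j) / N = (i' * N + j') / N := by rw [h]
  have h2 : (i * N + j) % N = (i' * N + j') % N := by rw [h]
  rw [mul_comm i, mul_comm i', Nat.mul_add_div (by omega), Nat.mul_add_div (by omega),
    Nat.div_eq_of_lt hj, Nat.div_eq_of_lt hj'] at h1
  rw [mul_comm i, mul_comm i', Nat.mul_add_mod, Nat.mul_add_mod, Nat.mod_eq_of_lt hj,
    Nat.mod_eq_of_lt hj'] at h2
  exact ⟨by simpa using h1, h2⟩

/-- The graph on the vertices below `N` with the adjacency matrix `adj`, stored row by row. -/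
def matrixEdge (N : ℕ) (adj : ℕ → ℕ) (u v : ℕ) : Prop :=
  u < N ∧ v < N ∧ adj (u * N + v) ≠ 0

/-- The vertices that the search has not met yet. -/
def newVertices (N : ℕ) (idx done : ℕ → ℕ) : Finset ℕ :=
  (Finset.range N).filter fun v => idx v = 0 ∧ done v = 0

/-- The invariant of the search. It maintains a path of contracted sets of vertices, at the
positions `2` to `k`. The position `1` is a virtual root with edges to all vertices. The vertex
`v` is on the path at position `idx v` if `idx v ≠ 0`, and if `done v ≠ 0`, then it belongs to a
finished component, called `comp v`. Row `j` of the matrix `out` has the edges that leave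
position `j`. -/
structure PathInv (N : ℕ) (adj : ℕ → ℕ) (s k : ℕ) (out idx done comp : ℕ → ℕ) : Prop where
  pos : 1 ≤ k
  idx_le : ∀ v < N, idx v ≤ k
  idx_ne_one : ∀ v < N, idx v ≠ 1
  idx_of_done : ∀ v < N, done v ≠ 0 → idx v = 0
  reach : ∀ u < N, ∀ v < N, 2 ≤ idx u → idx u ≤ idx v → ReflTransGen (matrixEdge N adj) u v
  out_iff : ∀ j, 2 ≤ j → j ≤ k → ∀ w < N,
    out (j * N + w) ≠ 0 ↔ ∃ u < N, idx u = j ∧ matrixEdge N adj u w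
  out_root : ∀ w < N, out (1 * N + w) ≠ 0
  closed : ∀ u < N, ∀ w < N, done u ≠ 0 → matrixEdge N adj u w → done w ≠ 0
  comp_iff : ∀ u < N, ∀ v < N, done u ≠ 0 → done v ≠ 0 →
    (comp u = comp v ↔ StronglyConn (matrixEdge N adj) u v)
  comp_lt : ∀ u < N, done u ≠ 0 → comp u < s
  progress : 2 * (newVertices N idx done).card + k + s ≤ 2 * N + 1 ∨
    (k = 1 ∧ ∀ v < N, done v ≠ 0)

theorem pathInv_init {N : ℕ} {adj out idx done comp : ℕ → ℕ} (hidx : ∀ v < N, idx v = 0)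
    (hdone : ∀ v < N, done v = 0) (hout : ∀ w < N, out (1 * N + w) ≠ 0) :
    PathInv N adj 0 1 out idx done comp where
  pos := le_rfl
  idx_le v hv := by simp [hidx v hv]
  idx_ne_one v hv := by simp [hidx v hv]
  idx_of_done v hv _ := hidx v hv
  reach u hu v hv h := by simp [hidx u hu] at h
  out_iff j h1 h2 := by omega
  out_root := hout
  closed u hu w hw h := absurd (hdone u hu) h
  comp_iff u hu v hv h := absurd (hdone u hu) h
  comp_lt u hu h := absurd (hdone u hu) h
  progress := by
    left
    have : (newVertices N idx done).card ≤ N := by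
      simpa [newVertices] using Finset.card_filter_le (Finset.range N) fun v => idx v = 0 ∧ done v = 0
    omega

variable {N s k : ℕ} {adj out idx done comp : ℕ → ℕ}

/-- An edge from the end of the path to a new vertex extends the path. -/
theorem PathInv.push (h : PathInv N adj s k out idx done comp) {w : ℕ} (hw : w < N)
    (hout : out (k * N + w) ≠ 0) (hnew : idx w = 0) (hdone : done w = 0) {out' idx' : ℕ → ℕ}
    (hidx' : ∀ v < N, idx' v = if v = w then k + 1 else idx v)
    (hold : ∀ j ≤ k, ∀ v < N, out' (j * N + v) = out (j * N + v))
    (htop : ∀ v < N, out' ((k + 1) * N + v) = adj (w * N + v)) :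
    PathInv N adj (s + 1) (k + 1) out' idx' done comp where
  pos := by omega
  idx_le v hv := by
    have := h.idx_le v hv
    rw [hidx' v hv]; split_ifs <;> omega
  idx_ne_one v hv := by
    have := h.idx_ne_one v hv
    have := h.pos
    rw [hidx' v hv]; split_ifs <;> omega
  idx_of_done v hv hd := by
    rw [hidx' v hv, if_neg (by rintro rfl; exact hd hdone)]
    exact h.idx_of_done v hv hd
  reach u hu v hv h2 hle := by
    rw [hidx' u hu] at h2 hle
    rw [hidx' v hv] at hle
    have hku := h.idx_le u hu
    have hkv := h.idx_le v hv
    by_cases huw : u = w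
    · by_cases hvw : v = w
      · rw [huw, hvw]
      · rw [if_pos huw, if_neg hvw] at hle; omega
    · rw [if_neg huw] at h2 hle
      by_cases hvw : v = w
      · subst hvw
        obtain ⟨u', hu', hi, he⟩ := (h.out_iff k (by omega) le_rfl v hv).1 hout
        exact (h.reach u hu u' hu' h2 (by omega)).tail he
      · rw [if_neg hvw] at hle
        exact h.reach u hu v hv h2 hle
  out_iff j h2 hj v hv := by
    rcases Nat.lt_or_ge k j with hjk | hjk
    · obtain rfl : j = k + 1 := by omega
      rw [htop v hv]
      constructor
      · intro ha
        exact ⟨w, hw, by rw [hidx' w hw, if_pos rfl], hw, hv, ha⟩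
      · rintro ⟨u, hu, hi, he⟩
        have := h.idx_le u hu
        rw [hidx' u hu] at hi
        split_ifs at hi with huw
        · rw [← huw]; exact he.2.2
        · omega
    · rw [hold j hjk v hv, h.out_iff j h2 hjk v hv]
      refine exists_congr fun u => and_congr_right fun hu => and_congr_left fun _ => ?_
      rw [hidx' u hu]
      split_ifs with huw
      · rw [huw, hnew]; omega
      · exact Iff.rfl
  out_root v hv := by rw [hold 1 h.pos v hv]; exact h.out_root v hv
  closed := h.closed
  comp_iff := h.comp_iff
  comp_lt u hu hd := (h.comp_lt u hu hd).trans (by omega)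
  progress := by
    left
    rcases h.progress with hp | ⟨-, hp⟩
    · have hss : newVertices N idx' done ⊂ newVertices N idx done := by
        refine Finset.ssubset_iff_subset_ne.2 ⟨fun v hv => ?_, fun heq => ?_⟩
        · simp only [newVertices, Finset.mem_filter, Finset.mem_range] at hv ⊢
          refine ⟨hv.1, ?_, hv.2.2⟩
          have h1 := hv.2.1
          rw [hidx' v hv.1] at h1
          split_ifs at h1
          exact h1
        · have h1 : w ∈ newVertices N idx done := by simp [newVertices, hw, hnew, hdone]
          rw [← heq] at h1
          simp [newVertices, hidx' w hw] at h1
      have := Finset.card_lt_card hss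
      omega
    · exact absurd hdone (hp w hw)

/-- An edge from the end of the path to an earlier position closes a cycle, and the last two
positions are contracted. -/
theorem PathInv.merge (h : PathInv N adj s (k + 1) out idx done comp) {w : ℕ} (hw : w < N)
    (hout : out ((k + 1) * N + w) ≠ 0) (hon : idx w ≠ 0) (hlow : idx w ≠ k + 1)
    {out' idx' : ℕ → ℕ} (hidx' : ∀ v < N, idx' v = if idx v = k + 1 then k else idx v)
    (hold : ∀ j < k, ∀ v < N, out' (j * N + v) = out (j * N + v))
    (htop : ∀ v < N, out' (k * N + v) ≠ 0 ↔
      out (k * N + v) ≠ 0 ∨ out ((k + 1) * N + v) ≠ 0) :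
    PathInv N adj (s + 1) k out' idx' done comp := by
  have hk : 2 ≤ idx w ∧ idx w ≤ k := by
    have := h.idx_le w hw
    have := h.idx_ne_one w hw
    omega
  have hreach : ∀ u < N, ∀ v < N, idx u = k + 1 → idx w ≤ idx v →
      ReflTransGen (matrixEdge N adj) u v := by
    intro u hu v hv hiu hiv
    obtain ⟨u', hu', hi, he⟩ := (h.out_iff (k + 1) (by omega) le_rfl w hw).1 hout
    exact ((h.reach u hu u' hu' (by omega) (by omega)).tail he).trans
      (h.reach w hw v hv hk.1 hiv)
  have hnew : newVertices N idx' done = newVertices N idx done := by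
    refine Finset.filter_congr fun v hv => ?_
    rw [hidx' v (Finset.mem_range.1 hv)]
    split_ifs
    · simp; omega
    · exact Iff.rfl
  refine
    { pos := by omega
      idx_le := fun v hv => ?_
      idx_ne_one := fun v hv => ?_
      idx_of_done := fun v hv hd => ?_
      reach := fun u hu v hv h2 hle => ?_
      out_iff := fun j h2 hj v hv => ?_
      out_root := fun v hv => ?_
      closed := h.closed
      comp_iff := h.comp_iff
      comp_lt := fun u hu hd => (h.comp_lt u hu hd).trans (by omega)
      progress := ?_ }
  · have := h.idx_le v hv
    rw [hidx' v hv]; split_ifs <;> omega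
  · have := h.idx_ne_one v hv
    rw [hidx' v hv]; split_ifs <;> omega
  · have := h.idx_of_done v hv hd
    rw [hidx' v hv, if_neg (by omega)]; exact this
  · rw [hidx' u hu] at h2 hle
    rw [hidx' v hv] at hle
    by_cases hu1 : idx u = k + 1
    · rw [if_pos hu1] at hle
      refine hreach u hu v hv hu1 ?_
      split_ifs at hle <;> omega
    · rw [if_neg hu1] at h2 hle
      refine h.reach u hu v hv h2 ?_
      split_ifs at hle <;> omega
  · rcases Nat.lt_or_ge j k with hjk | hjk
    · rw [hold j hjk v hv, h.out_iff j h2 (by omega) v hv]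
      refine exists_congr fun u => and_congr_right fun hu => and_congr_left fun _ => ?_
      rw [hidx' u hu]
      split_ifs <;> omega
    · obtain rfl : j = k := by omega
      rw [htop v hv, h.out_iff j h2 (by omega) v hv, h.out_iff (j + 1) (by omega) le_rfl v hv]
      constructor
      · rintro (⟨u, hu, hi, he⟩ | ⟨u, hu, hi, he⟩)
        · exact ⟨u, hu, by rw [hidx' u hu, if_neg (by omega)]; exact hi, he⟩
        · exact ⟨u, hu, by rw [hidx' u hu, if_pos hi], he⟩
      · rintro ⟨u, hu, hi, he⟩
        rw [hidx' u hu] at hi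
        split_ifs at hi with h1
        · exact Or.inr ⟨u, hu, h1, he⟩
        · exact Or.inl ⟨u, hu, hi, he⟩
  · rw [hold 1 (by omega) v hv]; exact h.out_root v hv
  · left
    rw [hnew]
    rcases h.progress with hp | ⟨hp, -⟩ <;> omega

/-- If no edge leaves the end of the path, except to finished components, then it is a strongly
connected component. -/
theorem PathInv.pop (h : PathInv N adj s (k + 1) out idx done comp) (hk : 1 ≤ k)
    (hnone : ∀ w < N, out ((k + 1) * N + w) ≠ 0 → done w = 0 → idx w = k + 1)
    {idx' done' comp' : ℕ → ℕ} (hidx' : ∀ v < N, idx' v = if idx v = k + 1 then 0 else idx v)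
    (hdone' : ∀ v < N, done' v = if idx v = k + 1 then 1 else done v)
    (hcomp' : ∀ v < N, comp' v = if idx v = k + 1 then s else comp v) :
    PathInv N adj (s + 1) k out idx' done' comp' := by
  have hd : ∀ v < N, done' v ≠ 0 ↔ idx v = k + 1 ∨ done v ≠ 0 := by
    intro v hv
    rw [hdone' v hv]
    split_ifs with h1 <;> simp [h1]
  have hclosed : ∀ u < N, done u ≠ 0 → ∀ v, ReflTransGen (matrixEdge N adj) u v →
      v < N ∧ done v ≠ 0 := by
    intro u hu hdu v hr
    induction hr with
    | refl => exact ⟨hu, hdu⟩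
    | tail _ he ih => exact ⟨he.2.1, h.closed _ ih.1 _ he.2.1 ih.2 he⟩
  have hnd : ∀ v < N, idx v = k + 1 → ¬ done v ≠ 0 := fun v hv hi hdv => by
    have := h.idx_of_done v hv hdv; omega
  have hnew : newVertices N idx' done' = newVertices N idx done := by
    refine Finset.filter_congr fun v hv => ?_
    rw [hidx' v (Finset.mem_range.1 hv), hdone' v (Finset.mem_range.1 hv)]
    split_ifs with h1
    · simp [h1]
    · exact Iff.rfl
  refine
    { pos := hk
      idx_le := fun v hv => ?_
      idx_ne_one := fun v hv => ?_
      idx_of_done := fun v hv hdv => ?_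
      reach := fun u hu v hv h2 hle => ?_
      out_iff := fun j h2 hj v hv => ?_
      out_root := h.out_root
      closed := fun u hu w hw hdu he => ?_
      comp_iff := fun u hu v hv hdu hdv => ?_
      comp_lt := fun u hu hdu => ?_
      progress := ?_ }
  · have := h.idx_le v hv
    rw [hidx' v hv]; split_ifs <;> omega
  · have := h.idx_ne_one v hv
    rw [hidx' v hv]; split_ifs <;> omega
  · rw [hidx' v hv]
    split_ifs with h1
    · rfl
    · exact h.idx_of_done v hv (((hd v hv).1 hdv).resolve_left h1)
  · rw [hidx' u hu] at h2 hle
    rw [hidx' v hv] at hle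
    by_cases hu1 : idx u = k + 1
    · rw [if_pos hu1] at h2; omega
    · rw [if_neg hu1] at h2 hle
      refine h.reach u hu v hv h2 ?_
      split_ifs at hle <;> omega
  · rw [h.out_iff j h2 (by omega) v hv]
    refine exists_congr fun u => and_congr_right fun hu => and_congr_left fun _ => ?_
    rw [hidx' u hu]
    split_ifs <;> omega
  · rw [hd w hw]
    rcases (hd u hu).1 hdu with h1 | h1
    · have h2 := (h.out_iff (k + 1) (by omega) le_rfl w hw).2 ⟨u, hu, h1, he⟩
      by_cases h3 : done w = 0
      · exact Or.inl (hnone w hw h2 h3)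
      · exact Or.inr h3
    · exact Or.inr (h.closed u hu w hw h1 he)
  · rw [hcomp' u hu, hcomp' v hv]
    rcases (hd u hu).1 hdu with h1 | h1 <;> rcases (hd v hv).1 hdv with h2 | h2
    · rw [if_pos h1, if_pos h2]
      exact iff_of_true rfl ⟨h.reach u hu v hv (by omega) (by omega),
        h.reach v hv u hu (by omega) (by omega)⟩
    · have h3 : idx v ≠ k + 1 := fun h4 => hnd v hv h4 h2
      rw [if_pos h1, if_neg h3]
      have h4 := h.comp_lt v hv h2
      refine iff_of_false (by omega) fun h5 => hnd u hu h1 (hclosed v hv h2 u h5.2).2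
    · have h3 : idx u ≠ k + 1 := fun h4 => hnd u hu h4 h1
      rw [if_neg h3, if_pos h2]
      have h4 := h.comp_lt u hu h1
      refine iff_of_false (by omega) fun h5 => hnd v hv h2 (hclosed u hu h1 v h5.1).2
    · rw [if_neg fun h4 => hnd u hu h4 h1, if_neg fun h4 => hnd v hv h4 h2]
      exact h.comp_iff u hu v hv h1 h2
  · rw [hcomp' u hu]
    split_ifs with h1
    · omega
    · have := h.comp_lt u hu (((hd u hu).1 hdu).resolve_left h1)
      omega
  · left
    rw [hnew]
    rcases h.progress with hp | ⟨hp, -⟩ <;> omega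

/-- At the root, when there is no vertex left, the search has ended. -/
theorem PathInv.stay (h : PathInv N adj s 1 out idx done comp)
    (hnone : ∀ w < N, out (1 * N + w) ≠ 0 → done w = 0 → idx w = 1) :
    PathInv N adj (s + 1) 1 out idx done comp := by
  refine { h with
    comp_lt := fun u hu hd => (h.comp_lt u hu hd).trans (by omega)
    progress := Or.inr ⟨rfl, fun v hv hd => ?_⟩ }
  exact h.idx_ne_one v hv (hnone v hv (h.out_root v hv) hd)

theorem PathInv.final (h : PathInv N adj (2 * N) k out idx done comp) (u v : ℕ) (hu : u < N)
    (hv : v < N) : comp u = comp v ↔ StronglyConn (matrixEdge N adj) u v := by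
  have hall : ∀ v < N, done v ≠ 0 := by
    rcases h.progress with hp | ⟨-, hp⟩
    · intro w hw hd
      have h1 : 0 < (newVertices N idx done).card ∨ idx w ≠ 0 := by
        by_cases h2 : idx w = 0
        · exact Or.inl (Finset.card_pos.2 ⟨w, by simp [newVertices, hw, h2, hd]⟩)
        · exact Or.inr h2
      have := h.pos
      have := h.idx_le w hw
      have := h.idx_ne_one w hw
      omega
    · exact hp
  exact h.comp_iff u hu v hv (hall u hu) (hall v hv)

end LeaderContributor

namespace LeaderContributor

/-! ### The program for strongly connected components -/

/- Registers `r...` hold constants, registers `v...` variables, and `a...` are names of arrays. -/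

notation "rVertices" => 10
notation "rSteps" => 11
notation "vStep" => 20
notation "vTop" => 21
notation "vFound" => 22
notation "vHit" => 23
notation "vVertex" => 24
notation "aAdj" => 22
notation "aOut" => 23
notation "aIdx" => 24
notation "aDone" => 25
notation "aComp" => 26

namespace Ram

/-- The index of the entry in row `i` and column `j` of a square matrix of vertices. -/
def Expr.cell (i j : Expr) : Expr := (i.mul (Expr.reg rVertices)).add j

open LeaderContributor.Ram.Expr (const reg arr)
open LeaderContributor.Ram.Cmd

/-- Record the vertex if it is neither finished nor at the end of the path, and the end of the
path has an edge to it. -/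
def findEdgeAt : Cmd :=
  ite ((arr aOut ((reg vTop).cell (reg vVertex))).mul
      (((arr aDone (reg vVertex)).eq (const 0)).mul
        (((arr aIdx (reg vVertex)).eq (reg vTop)).eq (const 0))))
    ((assign vFound (const 1)).seq (assign vHit (reg vVertex))) skip

/-- Find an edge from the end of the path to a vertex outside of it that is not finished. -/
def findEdge : Cmd :=
  (assign vFound (const 0)).seq (count vVertex rVertices findEdgeAt)

/-- Copy an entry of the adjacency matrix to the row of the end of the path. -/
def copyEdgeAt : Cmd :=
  store aOut ((reg vTop).cell (reg vVertex)) (arr aAdj ((reg vHit).cell (reg vVertex)))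

/-- Append a new vertex to the path. -/
def pushHit : Cmd :=
  (inc vTop rSteps).seq <| (store aIdx (reg vHit) (reg vTop)).seq <|
    count vVertex rVertices copyEdgeAt

/-- Pass on the edge from the end of the path to the vertex, and the vertex itself if it is at
the end of the path, to the position before. -/
def mergeAt : Cmd :=
  (ite (arr aOut ((reg vTop).cell (reg vVertex)))
    (store aOut (((reg vTop).sub (const 1)).cell (reg vVertex)) (const 1)) skip).seq
  (ite ((arr aIdx (reg vVertex)).eq (reg vTop))
    (store aIdx (reg vVertex) ((reg vTop).sub (const 1))) skip)

/-- Contract the last two positions of the path. -/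
def mergeTop : Cmd :=
  (count vVertex rVertices mergeAt).seq
  (assign vTop ((reg vTop).sub (const 1)))

/-- Finish the vertex if it is at the end of the path. -/
def popAt : Cmd :=
  ite ((arr aIdx (reg vVertex)).eq (reg vTop))
    ((store aIdx (reg vVertex) (const 0)).seq <|
      (store aDone (reg vVertex) (const 1)).seq <|
        store aComp (reg vVertex) (reg vStep)) skip

/-- Turn the last position of the path into a finished component, named by the step. -/
def popTop : Cmd :=
  (count vVertex rVertices popAt).seq
  (assign vTop ((reg vTop).sub (const 1)))

/-- One step of the search. -/
def sccStep : Cmd :=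
  findEdge.seq <| ite (reg vFound)
    (ite ((arr aIdx (reg vHit)).eq (const 0)) pushHit mergeTop)
    (ite ((const 1).lt (reg vTop)) popTop skip)

/-- Make the vertex new, and give the root an edge to it. -/
def sccInitAt : Cmd :=
  (store aIdx (reg vVertex) (const 0)).seq <|
    (store aDone (reg vVertex) (const 0)).seq <|
      store aOut ((const 1).cell (reg vVertex)) (const 1)

/-- An empty path and no finished components. -/
def sccInit : Cmd :=
  (count vVertex rVertices sccInitAt).seq
  (assign vTop (const 1))

/-- Compute the strongly connected components of the graph with the adjacency matrix `aAdj`. -/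
def scc : Cmd :=
  sccInit.seq (count vStep rSteps sccStep)

theorem findEdge_spec (σ : State) :
    ((findEdge.den σ).reg vFound = 0 ∧ ∀ w < σ.reg rVertices,
      σ.arr aOut (σ.reg vTop * σ.reg rVertices + w) ≠ 0 → σ.arr aDone w = 0 →
        σ.arr aIdx w = σ.reg vTop) ∨
    ((findEdge.den σ).reg vFound ≠ 0 ∧ (findEdge.den σ).reg vHit < σ.reg rVertices ∧
      σ.arr aOut (σ.reg vTop * σ.reg rVertices + (findEdge.den σ).reg vHit) ≠ 0 ∧
      σ.arr aDone ((findEdge.den σ).reg vHit) = 0 ∧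
      σ.arr aIdx ((findEdge.den σ).reg vHit) ≠ σ.reg vTop) := by
  have hN : (σ.setReg vFound 0).reg rVertices = σ.reg rVertices := by simp
  have key := den_count_inv (σ := σ.setReg vFound 0) (x := vVertex) (b := rVertices)
    (p := findEdgeAt) (fun n τ =>
    (τ.reg vFound = 0 ∧ ∀ w < n, σ.arr aOut (σ.reg vTop * σ.reg rVertices + w) ≠ 0 →
      σ.arr aDone w = 0 → σ.arr aIdx w = σ.reg vTop) ∨
    (τ.reg vFound ≠ 0 ∧ τ.reg vHit < σ.reg rVertices ∧
      σ.arr aOut (σ.reg vTop * σ.reg rVertices + τ.reg vHit) ≠ 0 ∧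
      σ.arr aDone (τ.reg vHit) = 0 ∧ σ.arr aIdx (τ.reg vHit) ≠ σ.reg vTop)) (by simp) ?_
  · rwa [hN] at key
  intro i τ hi hx hr ha hInv
  have e1 : τ.reg rVertices = σ.reg rVertices := by rw [hr rVertices (by decide)]; simp
  have e2 : τ.reg vTop = σ.reg vTop := by rw [hr vTop (by decide)]; simp
  rw [hN] at hi
  simp only [findEdgeAt, den, Expr.eval, Expr.cell, hx, e1, e2, ha aOut (by decide), ha aDone (by decide),
    ha aIdx (by decide), State.setReg_arr]
  by_cases h : σ.arr aOut (σ.reg vTop * σ.reg rVertices + i) ≠ 0 ∧ σ.arr aDone i = 0 ∧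
      σ.arr aIdx i ≠ σ.reg vTop
  · right
    simp [h, hi, hx]
  · rw [if_neg]
    · rcases hInv with ⟨h1, h2⟩ | hInv
      · left
        refine ⟨by simp [h1], fun w hw g1 g2 => ?_⟩
        rcases Nat.lt_succ_iff_lt_or_eq.1 hw with h3 | rfl
        · exact h2 w h3 g1 g2
        · by_contra g3
          exact h ⟨g1, g2, g3⟩
      · right
        simpa using hInv
    · simp only [ne_eq, mul_eq_zero, not_and, not_not] at h ⊢
      simp
      tauto

theorem pushHit_spec (σ : State) (hk : σ.reg vTop < σ.reg rSteps) :
    (pushHit.den σ).reg vTop = σ.reg vTop + 1 ∧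
    (∀ v, (pushHit.den σ).arr aIdx v = if v = σ.reg vHit then σ.reg vTop + 1 else σ.arr aIdx v) ∧
    (∀ j, (∀ v < σ.reg rVertices, j ≠ (σ.reg vTop + 1) * σ.reg rVertices + v) →
      (pushHit.den σ).arr aOut j = σ.arr aOut j) ∧
    ∀ v < σ.reg rVertices, (pushHit.den σ).arr aOut ((σ.reg vTop + 1) * σ.reg rVertices + v) =
      σ.arr aAdj (σ.reg vHit * σ.reg rVertices + v) := by
  rw [pushHit, den_seq, den_seq, den_inc, if_pos hk, den_store]
  simp only [Expr.eval]
  set σ' := (σ.setReg vTop (σ.reg vTop + 1)).setArr aIdx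
    ((σ.setReg vTop (σ.reg vTop + 1)).reg vHit) ((σ.setReg vTop (σ.reg vTop + 1)).reg vTop)
    with hσ'
  have hN : σ'.reg rVertices = σ.reg rVertices := by simp [hσ']
  have ht : σ'.reg vTop = σ.reg vTop + 1 := by simp [hσ']
  have hh : σ'.reg vHit = σ.reg vHit := by simp [hσ']
  have hadj : σ'.arr aAdj = σ.arr aAdj := by simp [hσ']
  have hout : σ'.arr aOut = σ.arr aOut := by simp [hσ']
  refine ⟨?_, fun v => ?_, ?_⟩
  · rw [← ht]
    exact den_reg _ (by decide) σ'
  · rw [den_arr _ (by decide) σ']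
    simp [hσ']
  · have key := den_count_inv (σ := σ') (x := vVertex) (b := rVertices)
      (p := copyEdgeAt)
      (fun n τ => (∀ j, (∀ v < σ.reg rVertices, j ≠ (σ.reg vTop + 1) * σ.reg rVertices + v) →
        τ.arr aOut j = σ.arr aOut j) ∧
        ∀ v < n, τ.arr aOut ((σ.reg vTop + 1) * σ.reg rVertices + v) =
          σ.arr aAdj (σ.reg vHit * σ.reg rVertices + v)) (by simp [hout]) ?_
    · rwa [hN] at key
    · intro i τ hi hx hr ha hInv
      rw [hN] at hi
      have e1 : τ.reg rVertices = σ.reg rVertices := by rw [hr rVertices (by decide), hN]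
      have e2 : τ.reg vTop = σ.reg vTop + 1 := by rw [hr vTop (by decide), ht]
      have e3 : τ.reg vHit = σ.reg vHit := by rw [hr vHit (by decide), hh]
      simp only [copyEdgeAt, den, Expr.eval, Expr.cell, hx, e1, e2, e3, ha aAdj (by decide), hadj,
        State.setReg_arr, State.setArr_arr_same]
      refine ⟨fun j hj => ?_, fun v hv => ?_⟩
      · rw [if_neg (hj i hi)]
        exact hInv.1 j hj
      · split_ifs with h1
        · obtain rfl : v = i := by omega
          rfl
        · exact hInv.2 v (by omega)

theorem mergeTop_spec (σ : State) {k : ℕ} (hk : σ.reg vTop = k + 1) :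
    (mergeTop.den σ).reg vTop = k ∧
    (∀ v < σ.reg rVertices, (mergeTop.den σ).arr aIdx v =
      if σ.arr aIdx v = k + 1 then k else σ.arr aIdx v) ∧
    (∀ j, (∀ v < σ.reg rVertices, j ≠ k * σ.reg rVertices + v) →
      (mergeTop.den σ).arr aOut j = σ.arr aOut j) ∧
    ∀ v < σ.reg rVertices, (mergeTop.den σ).arr aOut (k * σ.reg rVertices + v) ≠ 0 ↔
      σ.arr aOut (k * σ.reg rVertices + v) ≠ 0 ∨
        σ.arr aOut ((k + 1) * σ.reg rVertices + v) ≠ 0 := by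
  have key := den_count_inv (σ := σ) (x := vVertex) (b := rVertices) (p := mergeAt)
    (fun n τ =>
      (∀ v < σ.reg rVertices, τ.arr aIdx v =
        if v < n ∧ σ.arr aIdx v = k + 1 then k else σ.arr aIdx v) ∧
      (∀ j, (∀ v < σ.reg rVertices, j ≠ k * σ.reg rVertices + v) →
        τ.arr aOut j = σ.arr aOut j) ∧
      (∀ v < σ.reg rVertices, n ≤ v →
        τ.arr aOut (k * σ.reg rVertices + v) = σ.arr aOut (k * σ.reg rVertices + v)) ∧
      ∀ v < n, τ.arr aOut (k * σ.reg rVertices + v) ≠ 0 ↔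
        σ.arr aOut (k * σ.reg rVertices + v) ≠ 0 ∨
          σ.arr aOut ((k + 1) * σ.reg rVertices + v) ≠ 0) (by simp) (by
      intro i τ hi hx hr ha hInv
      obtain ⟨h1, h2, h3, h4⟩ := hInv
      have e1 : τ.reg rVertices = σ.reg rVertices := hr rVertices (by decide)
      have e2 : τ.reg vTop = k + 1 := by rw [hr vTop (by decide), hk]
      have h5 : τ.arr aOut ((k + 1) * σ.reg rVertices + i) =
          σ.arr aOut ((k + 1) * σ.reg rVertices + i) := by
        refine h2 _ fun v hv h => ?_
        have := (index_inj hi hv h).1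
        omega
      have hOut : ∀ j, ((mergeAt.den τ).setReg vVertex (i + 1)).arr aOut j =
          if σ.arr aOut ((k + 1) * σ.reg rVertices + i) ≠ 0 ∧ j = k * σ.reg rVertices + i then 1
          else τ.arr aOut j := by
        intro j
        by_cases g1 : σ.arr aOut ((k + 1) * σ.reg rVertices + i) = 0 <;>
        by_cases g2 : τ.arr aIdx i = k + 1 <;>
        simp [mergeAt, den, Expr.eval, Expr.cell, hx, e1, e2, h5, g1, g2]
      have hIdx : ∀ v, ((mergeAt.den τ).setReg vVertex (i + 1)).arr aIdx v =
          if τ.arr aIdx i = k + 1 ∧ v = i then k else τ.arr aIdx v := by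
        intro j
        by_cases g1 : σ.arr aOut ((k + 1) * σ.reg rVertices + i) = 0 <;>
        by_cases g2 : τ.arr aIdx i = k + 1 <;>
        simp [mergeAt, den, Expr.eval, Expr.cell, hx, e1, e2, h5, g1, g2]
      refine ⟨fun v hv => ?_, fun j hj => ?_, fun v hv hvi => ?_, fun v hv => ?_⟩
      · rw [hIdx, h1 v hv, h1 i hi]
        simp only [lt_irrefl, false_and, if_false]
        by_cases hvi : v = i
        · subst hvi; simp
        · simp only [hvi, and_false, if_false]
          congr 1
          simp only [eq_iff_iff, and_congr_left_iff]
          intro _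
          omega
      · rw [hOut, if_neg fun h => hj i hi h.2, h2 j hj]
      · rw [hOut, if_neg, h3 v hv (by omega)]
        rintro ⟨-, h⟩
        have := (index_inj hv hi h).2
        omega
      · rw [hOut]
        rcases Nat.lt_succ_iff_lt_or_eq.1 hv with hvi | rfl
        · rw [if_neg, h4 v hvi]
          rintro ⟨-, h⟩
          have := (index_inj (by omega) hi h).2
          omega
        · rw [h3 v hi le_rfl]
          split_ifs with h
          · simp [h.1]
          · simp only [and_true] at h
            simp only [h, or_false])
  have hreg : ((count vVertex rVertices mergeAt).den σ).reg vTop = k + 1 := by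
    rw [den_reg _ (by decide), hk]
  simp only [mergeTop, den_seq, den_assign]
  refine ⟨by simp [Expr.eval, hreg], fun v hv => ?_, key.2.1, key.2.2.2⟩
  rw [State.setReg_arr, key.1 v hv]
  simp [hv]

theorem popTop_spec (σ : State) {k : ℕ} (hk : σ.reg vTop = k + 1) :
    (popTop.den σ).reg vTop = k ∧
    ∀ v < σ.reg rVertices,
      (popTop.den σ).arr aIdx v = (if σ.arr aIdx v = k + 1 then 0 else σ.arr aIdx v) ∧
      (popTop.den σ).arr aDone v = (if σ.arr aIdx v = k + 1 then 1 else σ.arr aDone v) ∧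
      (popTop.den σ).arr aComp v =
        (if σ.arr aIdx v = k + 1 then σ.reg vStep else σ.arr aComp v) := by
  have key := den_count_inv (σ := σ) (x := vVertex) (b := rVertices) (p := popAt)
    (fun n τ => ∀ v < σ.reg rVertices,
      τ.arr aIdx v = (if v < n ∧ σ.arr aIdx v = k + 1 then 0 else σ.arr aIdx v) ∧
      τ.arr aDone v = (if v < n ∧ σ.arr aIdx v = k + 1 then 1 else σ.arr aDone v) ∧
      τ.arr aComp v = (if v < n ∧ σ.arr aIdx v = k + 1 then σ.reg vStep else σ.arr aComp v))
    (by simp) (by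
      intro i τ hi hx hr ha hInv v hv
      have e2 : τ.reg vTop = k + 1 := by rw [hr vTop (by decide), hk]
      have e3 : τ.reg vStep = σ.reg vStep := hr vStep (by decide)
      have e4 : τ.arr aIdx i = σ.arr aIdx i := by simpa using (hInv i hi).1
      obtain ⟨h1, h2, h3⟩ := hInv v hv
      have h4 : v < i + 1 ↔ v < i ∨ v = i := Nat.lt_succ_iff_lt_or_eq
      by_cases g1 : σ.arr aIdx i = k + 1
      · by_cases hvi : v = i
        · subst hvi
          simp [popAt, den, Expr.eval, hx, e2, e3, e4, g1]
        · simp [popAt, den, Expr.eval, hx, e2, e3, e4, g1, hvi, h1, h2, h3, h4]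
      · by_cases hvi : v = i
        · subst hvi
          simp [popAt, den, Expr.eval, hx, e2, e4, g1, h2, h3]
        · simp [popAt, den, Expr.eval, hx, e2, e4, g1, hvi, h1, h2, h3, h4])
  have hreg : ((count vVertex rVertices popAt).den σ).reg vTop = k + 1 := by
    rw [den_reg _ (by decide), hk]
  simp only [popTop, den_seq, den_assign]
  refine ⟨by simp [Expr.eval, hreg], fun v hv => ?_⟩
  simpa [hv] using key v hv

/-- The invariant of the search for the data in the memory. -/
def State.PathInv (σ : State) (s : ℕ) : Prop :=
  LeaderContributor.PathInv (σ.reg rVertices) (σ.arr aAdj) s (σ.reg vTop) (σ.arr aOut)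
    (σ.arr aIdx) (σ.arr aDone) (σ.arr aComp)

theorem sccStep_spec (σ : State) (hsteps : σ.reg rSteps = 2 * σ.reg rVertices)
    (h : σ.PathInv (σ.reg vStep)) : (sccStep.den σ).PathInv (σ.reg vStep + 1) := by
  have hN : (sccStep.den σ).reg rVertices = σ.reg rVertices := den_reg _ (by decide) σ
  have hA : (sccStep.den σ).arr aAdj = σ.arr aAdj := den_arr _ (by decide) σ
  have hS : (findEdge.den σ).reg rSteps = σ.reg rSteps := den_reg _ (by decide) σ
  have hs : (findEdge.den σ).reg vStep = σ.reg vStep := den_reg _ (by decide) σ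
  have hN' : (findEdge.den σ).reg rVertices = σ.reg rVertices := den_reg _ (by decide) σ
  have hT : (findEdge.den σ).reg vTop = σ.reg vTop := den_reg _ (by decide) σ
  have hA' : (findEdge.den σ).arr aAdj = σ.arr aAdj := den_arr _ (by decide) σ
  have hO : (findEdge.den σ).arr aOut = σ.arr aOut := den_arr _ (by decide) σ
  have hI : (findEdge.den σ).arr aIdx = σ.arr aIdx := den_arr _ (by decide) σ
  have hD : (findEdge.den σ).arr aDone = σ.arr aDone := den_arr _ (by decide) σ
  have hC : (findEdge.den σ).arr aComp = σ.arr aComp := den_arr _ (by decide) σ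
  rw [State.PathInv, hN, hA]
  have hpos := h.pos
  obtain ⟨k, hk⟩ : ∃ k, σ.reg vTop = k + 1 := ⟨σ.reg vTop - 1, by omega⟩
  simp only [sccStep, den_seq, den_ite, Expr.eval]
  rcases findEdge_spec σ with ⟨h0, hnone⟩ | ⟨h0, hw, hout, hdone, hne⟩
  · simp only [h0, ne_eq, not_true_eq_false, if_false, hT]
    by_cases h1 : 1 < σ.reg vTop
    · simp only [h1, if_true, one_ne_zero, not_false_eq_true]
      obtain ⟨g1, g2⟩ := popTop_spec (findEdge.den σ) (hT.trans hk)
      rw [hN', hI, hD, hC, hs] at g2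
      have g3 : (popTop.den (findEdge.den σ)).arr aOut = σ.arr aOut := by
        rw [den_arr _ (by decide), hO]
      rw [g1, g3]
      rw [State.PathInv, hk] at h
      rw [hk] at hnone h1
      exact h.pop (by omega) hnone (fun v hv => (g2 v hv).1) (fun v hv => (g2 v hv).2.1)
        (fun v hv => (g2 v hv).2.2)
    · simp only [h1, if_false, not_true_eq_false, den]
      have h2 : σ.reg vTop = 1 := by omega
      rw [hT, hO, hI, hD, hC, h2]
      rw [State.PathInv, h2] at h
      rw [h2] at hnone
      exact h.stay hnone
  · simp only [h0, ne_eq, not_false_eq_true, if_true, hI]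
    set w := (findEdge.den σ).reg vHit with hwdef
    by_cases h1 : σ.arr aIdx w = 0
    · simp only [h1, if_true, one_ne_zero, not_false_eq_true]
      have hcap : (findEdge.den σ).reg vTop < (findEdge.den σ).reg rSteps := by
        rw [hT, hS, hsteps]
        rcases h.progress with hp | ⟨-, hp⟩
        · have : 0 < (newVertices (σ.reg rVertices) (σ.arr aIdx) (σ.arr aDone)).card :=
            Finset.card_pos.2 ⟨w, by simp [newVertices, hw, h1, hdone]⟩
          omega
        · exact absurd hdone (hp w hw)
      obtain ⟨g1, g2, g3, g4⟩ := pushHit_spec (findEdge.den σ) hcap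
      rw [hN', hT, hO] at g3
      rw [hN', hT, hA'] at g4
      rw [hT, hI] at g2
      have g5 : (pushHit.den (findEdge.den σ)).arr aDone = σ.arr aDone := by
        rw [den_arr _ (by decide), hD]
      have g6 : (pushHit.den (findEdge.den σ)).arr aComp = σ.arr aComp := by
        rw [den_arr _ (by decide), hC]
      rw [g1, hT, g5, g6]
      refine h.push hw hout h1 hdone (fun v _ => g2 v) (fun j hj v hv => g3 _ ?_) g4
      intro v' hv' heq
      have := (index_inj hv hv' heq).1
      omega
    · simp only [h1, if_false, not_true_eq_false]
      obtain ⟨g1, g2, g3, g4⟩ := mergeTop_spec (findEdge.den σ) (hT.trans hk)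
      rw [hN', hI] at g2
      rw [hN', hO] at g3 g4
      have g5 : (mergeTop.den (findEdge.den σ)).arr aDone = σ.arr aDone := by
        rw [den_arr _ (by decide), hD]
      have g6 : (mergeTop.den (findEdge.den σ)).arr aComp = σ.arr aComp := by
        rw [den_arr _ (by decide), hC]
      rw [g1, g5, g6]
      rw [State.PathInv, hk] at h
      rw [hk] at hout hne
      refine h.merge hw hout h1 hne g2 (fun j hj v hv => g3 _ ?_) g4
      intro v' hv' heq
      have := (index_inj hv hv' heq).1
      omega

theorem sccInit_spec (σ : State) : (sccInit.den σ).PathInv 0 := by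
  have key := den_count_inv (σ := σ) (x := vVertex) (b := rVertices) (p := sccInitAt)
    (fun n τ => ∀ v < n, τ.arr aIdx v = 0 ∧ τ.arr aDone v = 0 ∧
      τ.arr aOut (1 * σ.reg rVertices + v) ≠ 0) (by simp) (by
      intro i τ hi hx hr ha hInv v hv
      have e1 : τ.reg rVertices = σ.reg rVertices := hr rVertices (by decide)
      by_cases hvi : v = i
      · subst hvi
        simp [sccInitAt, den, Expr.eval, Expr.cell, hx, e1]
      · simpa [sccInitAt, den, Expr.eval, Expr.cell, hx, e1, hvi] using hInv v (by omega))
  have hN : ((count vVertex rVertices sccInitAt).den σ).reg rVertices = σ.reg rVertices :=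
    den_reg _ (by decide) σ
  simp only [sccInit, den_seq, den_assign, State.PathInv, Expr.eval]
  simp only [State.setReg_reg, State.setReg_arr, if_true]
  refine pathInv_init ?_ ?_ ?_
  · intro v hv
    exact (key v (by simpa [hN] using hv)).1
  · intro v hv
    exact (key v (by simpa [hN] using hv)).2.1
  · intro v hv
    have := (key v (by simpa [hN] using hv)).2.2
    simpa [hN] using this

/-- Two vertices get the same value in the array `aComp` if and only if they are in the same
strongly connected component. -/
theorem scc_spec (σ : State) (hsteps : σ.reg rSteps = 2 * σ.reg rVertices) {u v : ℕ}
    (hu : u < σ.reg rVertices) (hv : v < σ.reg rVertices) :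
    (scc.den σ).arr aComp u = (scc.den σ).arr aComp v ↔
      StronglyConn (matrixEdge (σ.reg rVertices) (σ.arr aAdj)) u v := by
  have hN : (sccInit.den σ).reg rVertices = σ.reg rVertices := den_reg _ (by decide) σ
  have hS : (sccInit.den σ).reg rSteps = σ.reg rSteps := den_reg _ (by decide) σ
  have key := den_count_inv (σ := sccInit.den σ) (x := vStep) (b := rSteps) (p := sccStep)
    (fun n τ => τ.PathInv n) (by simpa [State.PathInv] using sccInit_spec σ) (by
      intro i τ hi hx hr ha hInv
      have e1 : τ.reg rVertices = σ.reg rVertices := by rw [hr _ (by decide), hN]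
      have e2 : τ.reg rSteps = σ.reg rSteps := by rw [hr _ (by decide), hS]
      have := sccStep_spec τ (by rw [e1, e2, hsteps]) (by rw [hx]; exact hInv)
      rw [hx] at this
      simpa [State.PathInv] using this)
  have h1 : (scc.den σ).PathInv (2 * (scc.den σ).reg rVertices) := by
    rw [den_reg scc (by decide), ← hsteps, ← hS]
    exact key
  have h2 := h1.final u v (by rwa [den_reg scc (by decide)]) (by rwa [den_reg scc (by decide)])
  rwa [den_reg scc (by decide), den_arr scc (k := aAdj) (by decide)] at h2

end Ram

end LeaderContributor

namespace LeaderContributor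

open Relation

/-! ### One round of the fixpoint iteration -/

notation "rLeaderStates" => 0
notation "rContribStates" => 1
notation "rDomain" => 2
notation "rTargetLeader" => 6
notation "rTargetMem" => 7
notation "rLeaderEdges" => 8
notation "rContribEdges" => 9
notation "rRounds" => 12
notation "rCells" => 13
notation "vEdge" => 25
notation "vX" => 26
notation "vY" => 27
notation "vLeader" => 28
notation "vRound" => 29
notation "aInterface" => 0
notation "aLeaderSrc" => 1
notation "aLeaderKind" => 2
notation "aLeaderSym" => 3
notation "aLeaderTgt" => 4
notation "aContribSrc" => 5
notation "aContribKind" => 6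
notation "aContribSym" => 7
notation "aContribTgt" => 8
notation "aWritable" => 20
notation "aVisited" => 21
notation "aNextWritable" => 27
notation "aNextVisited" => 28
notation "aAnswer" => 29

namespace Ram

open LeaderContributor.Ram.Expr (const reg arr)
open LeaderContributor.Ram.Cmd

/-- The vertex of a leader state with a memory value. It follows the contributor states. -/
def Expr.leaderVertex (p x : Expr) : Expr :=
  (reg rContribStates).add ((p.mul (reg rDomain)).add x)

/-- The component of the interface. -/
def Expr.targetComp : Expr :=
  arr aComp ((reg rTargetLeader).leaderVertex (reg rTargetMem))

/-- The contributor transition stays inside the interface, and its symbol is visited. -/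
def Expr.contribAllowed : Expr :=
  ((arr aInterface (arr aContribSrc (reg vEdge))).mul
    (arr aInterface (arr aContribTgt (reg vEdge)))).mul
  (((arr aContribKind (reg vEdge)).eq (const 0)).add (arr aVisited (arr aContribSym (reg vEdge))))

/-- The ends of the contributor transition are in the same component. -/
def Expr.contribCyclic : Expr :=
  (arr aComp (arr aContribSrc (reg vEdge))).eq (arr aComp (arr aContribTgt (reg vEdge)))

/-- Remove all edges. -/
def clearAdj : Cmd := count vX rCells (store aAdj (reg vX) (const 0))

/-- The edges of a leader transition for the memory value `vX`. -/
def leaderEdgeAt : Cmd :=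
  ite ((arr aLeaderKind (reg vEdge)).eq (const 2))
    (store aAdj (((arr aLeaderSrc (reg vEdge)).leaderVertex (reg vX)).cell
      ((arr aLeaderTgt (reg vEdge)).leaderVertex (arr aLeaderSym (reg vEdge)))) (const 1))
    (ite (((arr aLeaderKind (reg vEdge)).eq (const 0)).add
        ((arr aLeaderSym (reg vEdge)).eq (reg vX)))
      (store aAdj (((arr aLeaderSrc (reg vEdge)).leaderVertex (reg vX)).cell
        ((arr aLeaderTgt (reg vEdge)).leaderVertex (reg vX))) (const 1))
      skip)

/-- The edges of all leader transitions. -/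
def leaderEdges : Cmd := count vEdge rLeaderEdges (count vX rDomain leaderEdgeAt)

/-- The edges for writes of the contributors. -/
def writeEdges : Cmd :=
  count vLeader rLeaderStates <| count vX rDomain <| count vY rDomain <|
    ite (arr aWritable (reg vY))
      (store aAdj (((reg vLeader).leaderVertex (reg vX)).cell
        ((reg vLeader).leaderVertex (reg vY))) (const 1)) skip

/-- The edges of the allowed contributor transitions. -/
def contribEdges : Cmd :=
  count vEdge rContribEdges <|
    ite Expr.contribAllowed
      (store aAdj ((arr aContribSrc (reg vEdge)).cell (arr aContribTgt (reg vEdge))) (const 1))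
      skip

/-- The disjoint union of the graphs of `ContribEdge` and of `LeaderEdge`, for the current sets. -/
def buildGraph : Cmd := clearAdj.seq <| leaderEdges.seq <| writeEdges.seq contribEdges

/-- Empty next sets, and the answer no. -/
def clearNext : Cmd :=
  (count vX rDomain ((store aNextWritable (reg vX) (const 0)).seq
    (store aNextVisited (reg vX) (const 0)))).seq (store aAnswer (const 0) (const 0))

/-- The memory values in the component of the interface. -/
def markVisited : Cmd :=
  count vLeader rLeaderStates <| count vX rDomain <|
    ite (Expr.targetComp.eq (arr aComp ((reg vLeader).leaderVertex (reg vX))))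
      (store aNextVisited (reg vX) (const 1)) skip

/-- The symbols of allowed contributor writes inside a component. -/
def markWritable : Cmd :=
  count vEdge rContribEdges <|
    ite ((Expr.contribAllowed.mul ((arr aContribKind (reg vEdge)).eq (const 2))).mul
        Expr.contribCyclic)
      (store aNextWritable (arr aContribSym (reg vEdge)) (const 1)) skip

/-- Note in the answer that the leader transition can be executed on a cycle from the memory
value `vX`. -/
def leaderAnswerAt : Cmd :=
  ite (Expr.targetComp.eq (arr aComp ((arr aLeaderSrc (reg vEdge)).leaderVertex (reg vX))))
    (ite ((arr aLeaderKind (reg vEdge)).eq (const 2))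
      (ite (Expr.targetComp.eq (arr aComp ((arr aLeaderTgt (reg vEdge)).leaderVertex
          (arr aLeaderSym (reg vEdge)))))
        (store aAnswer (const 0) (const 1)) skip)
      (ite (((arr aLeaderKind (reg vEdge)).eq (const 1)).mul
          ((arr aLeaderSym (reg vEdge)).eq (reg vX)))
        (ite (Expr.targetComp.eq (arr aComp ((arr aLeaderTgt (reg vEdge)).leaderVertex (reg vX))))
          (store aAnswer (const 0) (const 1)) skip)
        skip))
    skip

/-- Look for a memory operation of the leader in the component of the interface. -/
def leaderAnswer : Cmd := count vEdge rLeaderEdges (count vX rDomain leaderAnswerAt)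

/-- Look for an allowed memory operation of a contributor inside a component. -/
def contribAnswer : Cmd :=
  count vEdge rContribEdges <|
    ite ((Expr.contribAllowed.mul ((const 0).lt (arr aContribKind (reg vEdge)))).mul
        Expr.contribCyclic)
      (store aAnswer (const 0) (const 1)) skip

/-- Make the next sets the current ones. -/
def copyNext : Cmd :=
  count vX rDomain <|
    (store aWritable (reg vX) (arr aNextWritable (reg vX))).seq
      (store aVisited (reg vX) (arr aNextVisited (reg vX)))

/-- Replace the writable and the visited symbols by the next ones, and answer whether the old ones
allow an operation on a cycle. -/
def round : Cmd :=
  buildGraph.seq <| scc.seq <| clearNext.seq <| markVisited.seq <| markWritable.seq <|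
    leaderAnswer.seq <| contribAnswer.seq copyNext

/-- All symbols are writable and visited. -/
def initSets : Cmd :=
  count vX rDomain <|
    (store aWritable (reg vX) (const 1)).seq (store aVisited (reg vX) (const 1))

/-- The greatest fixpoint is reached after `2 * D` rounds, and one more round gives the answer
for it. -/
def iterateRounds : Cmd := initSets.seq (count vRound rRounds round)

theorem iterateRounds_wf : iterateRounds.wf = true := by decide

end Ram

/-! ### The instance in the memory -/

/-- The state and the parameters of the instance are in the memory, and so are the numbers that
are computed in the beginning. -/
structure Ram.State.Holds (P : CycInstance) (lL : List (Transition (Fin P.L) (Fin P.D)))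
    (lC : List (Transition (Fin P.C) (Fin P.D))) (σ : Ram.State) : Prop where
  L : σ.reg rLeaderStates = P.L
  C : σ.reg rContribStates = P.C
  D : σ.reg rDomain = P.D
  q : σ.reg rTargetLeader = P.iface.leader
  a : σ.reg rTargetMem = P.iface.mem
  nL : σ.reg rLeaderEdges = lL.length
  nC : σ.reg rContribEdges = lC.length
  N : σ.reg rVertices = P.C + P.L * P.D
  steps : σ.reg rSteps = 2 * (P.C + P.L * P.D)
  rounds : σ.reg rRounds = 2 * P.D + 1
  cells : σ.reg rCells = (P.C + P.L * P.D) * (P.C + P.L * P.D)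
  arr : ∀ k < 9, σ.arr k = (P.inputState lL lC).arr k

namespace Ram

open LeaderContributor.Ram.Cmd

variable {P : CycInstance} {lL : List (Transition (Fin P.L) (Fin P.D))}
  {lC : List (Transition (Fin P.C) (Fin P.D))} {σ τ : State}

theorem State.Holds.of_frame (h : σ.Holds P lL lC) (hr : ∀ r < 20, τ.reg r = σ.reg r)
    (ha : ∀ k < 9, τ.arr k = σ.arr k) : τ.Holds P lL lC where
  L := by rw [hr _ (by decide), h.L]
  C := by rw [hr _ (by decide), h.C]
  D := by rw [hr _ (by decide), h.D]
  q := by rw [hr _ (by decide), h.q]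
  a := by rw [hr _ (by decide), h.a]
  nL := by rw [hr _ (by decide), h.nL]
  nC := by rw [hr _ (by decide), h.nC]
  N := by rw [hr _ (by decide), h.N]
  steps := by rw [hr _ (by decide), h.steps]
  rounds := by rw [hr _ (by decide), h.rounds]
  cells := by rw [hr _ (by decide), h.cells]
  arr k hk := by rw [ha k hk, h.arr k hk]

theorem State.Holds.den (h : σ.Holds P lL lC) {p : Cmd} (hp : p.wf = true)
    (ha : ∀ k < 9, p.writesArr k = false) : (p.den σ).Holds P lL lC :=
  h.of_frame (fun _ hr => den_reg p (wf_writesReg hp hr) σ) fun k hk => den_arr p (ha k hk) σ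

/-- A marking loop over a finite type. -/
theorem marks_count_fin {n x b k : ℕ} {p : Cmd} {Q : Fin n → ℕ → Prop}
    (hσ : σ.Holds P lL lC) (hb : σ.reg b = n) (hp : (count x b p).wf = true)
    (ha : ∀ k < 9, p.writesArr k = false)
    (h : ∀ (i : Fin n) (τ : State), τ.Holds P lL lC → τ.reg x = i →
      (∀ r, (count x b p).writesReg r = false → τ.reg r = σ.reg r) →
      (∀ l, p.writesArr l = false → τ.arr l = σ.arr l) → Marks p k τ (Q i)) :
    Marks (count x b p) k σ fun j => ∃ i, Q i j := by
  refine (marks_count (Q := fun i j => ∃ hi : i < n, Q ⟨i, hi⟩ j)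
    fun i τ hi hx hr har j => ?_).congr fun j => ?_
  · have hi' : i < n := hb ▸ hi
    rw [h ⟨i, hi'⟩ τ (hσ.of_frame (fun r hr' => hr r (wf_writesReg hp hr'))
      fun k hk => har k (ha k hk)) hx hr har j]
    simp [hi']
  · rw [hb]
    exact ⟨fun ⟨i, _, hi, hj⟩ => ⟨⟨i, hi⟩, hj⟩, fun ⟨i, hj⟩ => ⟨i, i.2, i.2, hj⟩⟩

/-- A marking loop over a list. -/
theorem marks_count_list {α : Type} {l : List α} {x b k : ℕ} {p : Cmd} {Q : α → ℕ → Prop}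
    (hσ : σ.Holds P lL lC) (hb : σ.reg b = l.length) (hp : (count x b p).wf = true)
    (ha : ∀ k < 9, p.writesArr k = false)
    (h : ∀ (i : ℕ) (hi : i < l.length) (τ : State), τ.Holds P lL lC → τ.reg x = i →
      (∀ r, (count x b p).writesReg r = false → τ.reg r = σ.reg r) →
      (∀ l, p.writesArr l = false → τ.arr l = σ.arr l) → Marks p k τ (Q l[i])) :
    Marks (count x b p) k σ fun j => ∃ z ∈ l, Q z j := by
  refine (marks_count_fin (Q := fun i j => Q l[i] j) hσ hb hp ha fun i => h i i.2).congr
    fun j => ?_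
  constructor
  · rintro ⟨i, hi⟩
    exact ⟨_, List.getElem_mem i.2, hi⟩
  · rintro ⟨z, hz, hj⟩
    obtain ⟨i, hi, rfl⟩ := List.getElem_of_mem hz
    exact ⟨⟨i, hi⟩, hj⟩

theorem State.Holds.leader_entry (h : σ.Holds P lL lC) {e : ℕ} (he : e < lL.length) :
    σ.arr aLeaderSrc e = lL[e].1 ∧ σ.arr aLeaderKind e = labelKind lL[e].2.1 ∧
      σ.arr aLeaderSym e = labelSymbol lL[e].2.1 ∧ σ.arr aLeaderTgt e = lL[e].2.2 := by
  rw [h.arr aLeaderSrc (by decide), h.arr aLeaderKind (by decide), h.arr aLeaderSym (by decide),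
    h.arr aLeaderTgt (by decide)]
  simp [CycInstance.inputState, List.getD_eq_getElem?_getD, he]

theorem State.Holds.contrib_entry (h : σ.Holds P lL lC) {e : ℕ} (he : e < lC.length) :
    σ.arr aContribSrc e = lC[e].1 ∧ σ.arr aContribKind e = labelKind lC[e].2.1 ∧
      σ.arr aContribSym e = labelSymbol lC[e].2.1 ∧ σ.arr aContribTgt e = lC[e].2.2 := by
  rw [h.arr aContribSrc (by decide), h.arr aContribKind (by decide),
    h.arr aContribSym (by decide), h.arr aContribTgt (by decide)]
  simp [CycInstance.inputState, List.getD_eq_getElem?_getD, he]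

/-- The vertex of a contributor state. -/
def contribVertex (P : CycInstance) (u : Fin P.C) : ℕ := u

/-- The vertex of a leader state with a memory value. -/
def leaderVertex (P : CycInstance) (c : Fin P.L × Fin P.D) : ℕ := P.C + (c.1 * P.D + c.2)

theorem contribVertex_lt (u : Fin P.C) : contribVertex P u < P.C + P.L * P.D :=
  u.2.trans_le (Nat.le_add_right _ _)

theorem leaderVertex_lt (c : Fin P.L × Fin P.D) : leaderVertex P c < P.C + P.L * P.D := by
  obtain ⟨p, x⟩ := c
  have h1 : (p.1 + 1) * P.D ≤ P.L * P.D := Nat.mul_le_mul_right _ p.2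
  have h2 := x.2
  rw [Nat.succ_mul] at h1
  simp only [leaderVertex]
  omega

theorem contribVertex_injective : Function.Injective (contribVertex P) :=
  fun _ _ h => Fin.ext h

theorem leaderVertex_injective : Function.Injective (leaderVertex P) := by
  rintro ⟨p, x⟩ ⟨p', x'⟩ h
  have h1 := index_inj x.2 x'.2 (Nat.add_left_cancel h)
  exact Prod.ext (Fin.ext h1.1) (Fin.ext h1.2)

theorem contribVertex_ne_leaderVertex (u : Fin P.C) (c : Fin P.L × Fin P.D) :
    contribVertex P u ≠ leaderVertex P c := by
  have := u.2
  simp only [contribVertex, leaderVertex]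
  omega

theorem State.Holds.interface (h : σ.Holds P lL lC) (u : Fin P.C) :
    σ.arr aInterface u ≠ 0 ↔ u ∈ P.iface.contribs := by
  rw [h.arr aInterface (by decide)]
  simp only [CycInstance.inputState, ne_eq, ite_eq_right_iff, one_ne_zero, imp_false, not_not]
  constructor
  · rintro ⟨s, hs, h⟩
    rwa [← Fin.ext h]
  · exact fun h => ⟨u, h, rfl⟩

/-! ### The graph -/

theorem clearAdj_spec (hσ : σ.Holds P lL lC) :
    ∀ i < (P.C + P.L * P.D) * (P.C + P.L * P.D), (clearAdj.den σ).arr aAdj i = 0 := by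
  rw [← hσ.cells]
  refine den_count_inv (σ := σ) (fun n τ => ∀ i < n, τ.arr aAdj i = 0) (by simp) ?_
  intro i τ hi hx hr ha hInv j hj
  simp only [Cmd.den, Expr.eval, hx, State.setReg_arr, State.setArr_arr_same]
  split_ifs with h
  · rfl
  · exact hInv j (by omega)

theorem eval_leaderVertex (hσ : σ.Holds P lL lC) {e f : Expr} {p : Fin P.L} {x : Fin P.D}
    (he : e.eval σ = p) (hf : f.eval σ = x) :
    (e.leaderVertex f).eval σ = leaderVertex P (p, x) := by
  simp [Expr.leaderVertex, Expr.eval, hσ.C, hσ.D, he, hf, leaderVertex]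

theorem eval_cell (hσ : σ.Holds P lL lC) (e f : Expr) :
    (e.cell f).eval σ = e.eval σ * (P.C + P.L * P.D) + f.eval σ := by
  simp [Expr.cell, Expr.eval, hσ.N]

theorem marks_leaderEdgeAt (hσ : σ.Holds P lL lC) {e : ℕ} (he : e < lL.length)
    (hE : σ.reg vEdge = e) {x : Fin P.D} (hX : σ.reg vX = x) :
    Marks leaderEdgeAt aAdj σ fun j => ∃ y, MemEffect lL[e].2.1 x y ∧
      j = leaderVertex P (lL[e].1, x) * (P.C + P.L * P.D) + leaderVertex P (lL[e].2.2, y) := by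
  obtain ⟨h1, h2, h3, h4⟩ := hσ.leader_entry he
  refine (marks_ite (marks_store _ _ σ) (marks_when (marks_store _ _ σ))).congr
    fun j => ?_
  have e1 : (Expr.arr aLeaderSrc (Expr.reg vEdge)).eval σ = lL[e].1 := by
    simp [Expr.eval, hE, h1]
  have e2 : (Expr.arr aLeaderTgt (Expr.reg vEdge)).eval σ = lL[e].2.2 := by
    simp [Expr.eval, hE, h4]
  have eX : (Expr.reg vX).eval σ = x := hX
  have e3 := eval_leaderVertex hσ e1 eX
  have e4 := eval_leaderVertex hσ e2 eX
  rw [eval_cell hσ, eval_cell hσ, e3, e4]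
  generalize lL[e] = z at *
  obtain ⟨p, lab, p'⟩ := z
  rcases lab with _ | b | b
  · simp [Expr.eval, hE, h2, labelKind, MemEffect]
  · simp [Expr.eval, hE, hX, h2, h3, labelKind, labelSymbol, MemEffect, Fin.ext_iff, and_assoc,
      eq_comm]
    exact fun _ => ⟨fun h => ⟨x, rfl, h⟩, fun ⟨x', h, h'⟩ => Fin.ext h ▸ h'⟩
  · have e5 : (Expr.arr aLeaderSym (Expr.reg vEdge)).eval σ = b := by
      simp [Expr.eval, hE, h3, labelSymbol]
    rw [eval_leaderVertex hσ e2 e5]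
    simp [Expr.eval, hE, h2, labelKind, MemEffect]

theorem marks_leaderEdges (hσ : σ.Holds P lL lC) :
    Marks leaderEdges aAdj σ fun j => ∃ z ∈ lL, ∃ x y, MemEffect z.2.1 x y ∧
      j = leaderVertex P (z.1, x) * (P.C + P.L * P.D) + leaderVertex P (z.2.2, y) :=
  marks_count_list hσ hσ.nL (by decide) (by decide) fun _ he _ hτ hE _ _ =>
    marks_count_fin hτ hτ.D (by decide) (by decide) fun _ _ hυ hX hr _ =>
      marks_leaderEdgeAt hυ he ((hr vEdge (by decide)).trans hE) hX

theorem marks_writeEdges (hσ : σ.Holds P lL lC) :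
    Marks writeEdges aAdj σ fun j => ∃ (p : Fin P.L) (x y : Fin P.D), σ.arr aWritable y ≠ 0 ∧
      j = leaderVertex P (p, x) * (P.C + P.L * P.D) + leaderVertex P (p, y) := by
  refine marks_count_fin hσ hσ.L (by decide) (by decide) fun p τ hτ hp _ ha =>
    marks_count_fin hτ hτ.D (by decide) (by decide) fun x υ hυ hx hr hb =>
      marks_count_fin hυ hυ.D (by decide) (by decide) fun y ω hω hy hs hc =>
        (marks_when (marks_store _ _ ω)).congr fun j => ?_
  have e1 : (Expr.reg vLeader).eval ω = p :=
    (hs vLeader (by decide)).trans ((hr vLeader (by decide)).trans hp)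
  have e2 : (Expr.reg vX).eval ω = x := (hs vX (by decide)).trans hx
  have e3 : (Expr.reg vY).eval ω = y := hy
  rw [eval_cell hω, eval_leaderVertex hω e1 e2, eval_leaderVertex hω e1 e3]
  simp [Expr.eval, hy, hc aWritable (by decide), hb aWritable (by decide), ha aWritable (by decide)]

theorem eval_contribAllowed (hσ : σ.Holds P lL lC) {e : ℕ} (he : e < lC.length)
    (hE : σ.reg vEdge = e) :
    Expr.contribAllowed.eval σ ≠ 0 ↔ lC[e].1 ∈ P.iface.contribs ∧ lC[e].2.2 ∈ P.iface.contribs ∧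
      LabelIn {y : Fin P.D | σ.arr aVisited y ≠ 0} lC[e].2.1 := by
  obtain ⟨h1, h2, h3, h4⟩ := hσ.contrib_entry he
  rw [← hσ.interface, ← hσ.interface]
  simp only [Expr.contribAllowed, Expr.eval, hE, h1, h2, h3, h4]
  generalize lC[e] = z at *
  obtain ⟨u, lab, v⟩ := z
  rcases lab with _ | b | b <;> simp [labelKind, labelSymbol, LabelIn, and_assoc]

theorem marks_contribEdges (hσ : σ.Holds P lL lC) :
    Marks contribEdges aAdj σ fun j => ∃ z ∈ lC, (z.1 ∈ P.iface.contribs ∧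
      z.2.2 ∈ P.iface.contribs ∧ LabelIn {y : Fin P.D | σ.arr aVisited y ≠ 0} z.2.1) ∧
      j = contribVertex P z.1 * (P.C + P.L * P.D) + contribVertex P z.2.2 := by
  refine marks_count_list hσ hσ.nC (by decide) (by decide) fun e he τ hτ hE _ ha =>
    (marks_when (marks_store _ _ τ)).congr fun j => ?_
  obtain ⟨h1, h2, h3, h4⟩ := hτ.contrib_entry he
  rw [eval_contribAllowed hτ he hE, ha aVisited (by decide), eval_cell hτ]
  simp [Expr.eval, hE, h1, h4, contribVertex]

/-- The writable symbols in the memory. -/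
def State.writable (P : CycInstance) (σ : State) : Set (Fin P.D) := {y | σ.arr aWritable y ≠ 0}

/-- The visited symbols in the memory. -/
def State.visited (P : CycInstance) (σ : State) : Set (Fin P.D) := {y | σ.arr aVisited y ≠ 0}

theorem buildGraph_spec (hL : Enumerates lL P.system.leader.trans)
    (hC : Enumerates lC P.system.contributor.trans) (hσ : σ.Holds P lL lC) (i j : ℕ) :
    matrixEdge (P.C + P.L * P.D) ((buildGraph.den σ).arr aAdj) i j ↔
      (∃ c d, LeaderEdge P.system (σ.writable P) c d ∧ i = leaderVertex P c ∧
        j = leaderVertex P d) ∨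
      ∃ u v, ContribEdge P.system P.iface.contribs (σ.visited P) u v ∧ i = contribVertex P u ∧
        j = contribVertex P v := by
  have h1 : (clearAdj.den σ).Holds P lL lC := hσ.den (by decide) (by decide)
  have h2 : (leaderEdges.den (clearAdj.den σ)).Holds P lL lC := h1.den (by decide) (by decide)
  have h3 : (writeEdges.den (leaderEdges.den (clearAdj.den σ))).Holds P lL lC :=
    h2.den (by decide) (by decide)
  have g2 : (leaderEdges.den (clearAdj.den σ)).arr aWritable = σ.arr aWritable := by
    rw [den_arr _ (by decide), den_arr _ (by decide)]
  have g3 : (writeEdges.den (leaderEdges.den (clearAdj.den σ))).arr aVisited =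
      σ.arr aVisited := by
    rw [den_arr _ (by decide), den_arr _ (by decide), den_arr _ (by decide)]
  have key : ∀ i < P.C + P.L * P.D, ∀ j < P.C + P.L * P.D,
      ((buildGraph.den σ).arr aAdj (i * (P.C + P.L * P.D) + j) ≠ 0 ↔
        ((∃ z ∈ lL, ∃ x y, MemEffect z.2.1 x y ∧ i * (P.C + P.L * P.D) + j =
            leaderVertex P (z.1, x) * (P.C + P.L * P.D) + leaderVertex P (z.2.2, y)) ∨
          ∃ (p : Fin P.L) (x y : Fin P.D), y ∈ σ.writable P ∧ i * (P.C + P.L * P.D) + j =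
            leaderVertex P (p, x) * (P.C + P.L * P.D) + leaderVertex P (p, y)) ∨
        ∃ z ∈ lC, (z.1 ∈ P.iface.contribs ∧ z.2.2 ∈ P.iface.contribs ∧
          LabelIn (σ.visited P) z.2.1) ∧ i * (P.C + P.L * P.D) + j =
            contribVertex P z.1 * (P.C + P.L * P.D) + contribVertex P z.2.2) :=
      fun i hi j hj => by
    have h4 : i * (P.C + P.L * P.D) + j < (P.C + P.L * P.D) * (P.C + P.L * P.D) := by
      have := Nat.mul_le_mul_right (P.C + P.L * P.D) (Nat.succ_le_of_lt hi)
      rw [Nat.succ_mul] at this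
      omega
    have h5 := clearAdj_spec hσ _ h4
    rw [buildGraph, den_seq, den_seq, den_seq, marks_contribEdges h3, marks_writeEdges h2,
      marks_leaderEdges h1, h5, g2, g3]
    simp only [ne_eq, not_true_eq_false, false_or]
    rfl
  constructor
  · rintro ⟨hi, hj, h⟩
    rcases (key i hi j hj).1 h with (⟨z, hz, x, y, h6, h7⟩ | ⟨p, x, y, h6, h7⟩) | ⟨z, hz, h6, h7⟩
    · obtain ⟨rfl, rfl⟩ := index_inj hj (leaderVertex_lt _) h7
      exact Or.inl ⟨_, _, Or.inl ⟨z.2.1, (hL.2 _).1 hz, h6⟩, rfl, rfl⟩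
    · obtain ⟨rfl, rfl⟩ := index_inj hj (leaderVertex_lt _) h7
      exact Or.inl ⟨(p, x), (p, y), Or.inr ⟨rfl, h6⟩, rfl, rfl⟩
    · obtain ⟨rfl, rfl⟩ := index_inj hj (contribVertex_lt _) h7
      exact Or.inr ⟨_, _, ⟨z.2.1, (hC.2 _).1 hz, h6⟩, rfl, rfl⟩
  · rintro (⟨c, d, h6, rfl, rfl⟩ | ⟨u, v, ⟨x, h6, h7⟩, rfl, rfl⟩)
    · refine ⟨leaderVertex_lt _, leaderVertex_lt _,
        (key _ (leaderVertex_lt _) _ (leaderVertex_lt _)).2 (Or.inl ?_)⟩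
      obtain ⟨p, x⟩ := c
      obtain ⟨p', y⟩ := d
      rcases h6 with ⟨lab, h6, h7⟩ | ⟨h6, h7⟩
      · exact Or.inl ⟨_, (hL.2 _).2 h6, x, y, h7, rfl⟩
      · obtain rfl : p' = p := h6
        exact Or.inr ⟨p', x, y, h7, rfl⟩
    · exact ⟨contribVertex_lt _, contribVertex_lt _,
        (key _ (contribVertex_lt _) _ (contribVertex_lt _)).2
          (Or.inr ⟨_, (hC.2 _).2 h6, h7, rfl⟩)⟩

/-- If the successors of `f a` are the images of those of `a`, then `f` preserves and reflects
reachability. -/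
theorem reflTransGen_embedding {α β : Type} {r : β → β → Prop} {s : α → α → Prop} {f : α → β}
    (hf : Function.Injective f) (h : ∀ a j, r (f a) j ↔ ∃ b, s a b ∧ j = f b) (a b : α) :
    ReflTransGen r (f a) (f b) ↔ ReflTransGen s a b := by
  constructor
  · intro hr
    have key : ∀ j, ReflTransGen r (f a) j → ∃ b, j = f b ∧ ReflTransGen s a b := by
      intro j hj
      induction hj with
      | refl => exact ⟨a, rfl, ReflTransGen.refl⟩
      | tail _ hjk ih =>
        obtain ⟨b, rfl, hb⟩ := ih
        obtain ⟨c, hc, rfl⟩ := (h b _).1 hjk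
        exact ⟨c, rfl, hb.tail hc⟩
    obtain ⟨b', hb', h1⟩ := key _ hr
    rwa [hf hb']
  · intro hs
    exact hs.lift f fun x y hxy => (h x (f y)).2 ⟨y, hxy, rfl⟩

theorem stronglyConn_embedding {α β : Type} {r : β → β → Prop} {s : α → α → Prop} {f : α → β}
    (hf : Function.Injective f) (h : ∀ a j, r (f a) j ↔ ∃ b, s a b ∧ j = f b) (a b : α) :
    StronglyConn r (f a) (f b) ↔ StronglyConn s a b :=
  and_congr (reflTransGen_embedding hf h a b) (reflTransGen_embedding hf h b a)

/-- After the computation of the strongly connected components, the array `aComp` describes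
those of both graphs. -/
structure State.CompFor (P : CycInstance) (A B : Set (Fin P.D)) (τ : State) : Prop where
  leader : ∀ c d, τ.arr aComp (leaderVertex P c) = τ.arr aComp (leaderVertex P d) ↔
    StronglyConn (LeaderEdge P.system A) c d
  contrib : ∀ u v, τ.arr aComp (contribVertex P u) = τ.arr aComp (contribVertex P v) ↔
    StronglyConn (ContribEdge P.system P.iface.contribs B) u v

theorem compFor_scc (hL : Enumerates lL P.system.leader.trans)
    (hC : Enumerates lC P.system.contributor.trans) (hσ : σ.Holds P lL lC) :
    (scc.den (buildGraph.den σ)).CompFor P (σ.writable P) (σ.visited P) := by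
  have h1 : (buildGraph.den σ).Holds P lL lC := hσ.den (by decide) (by decide)
  have key := fun u v => scc_spec (buildGraph.den σ) (u := u) (v := v) (by rw [h1.N, h1.steps])
  rw [h1.N] at key
  constructor
  · intro c d
    rw [key _ _ (leaderVertex_lt c) (leaderVertex_lt d)]
    refine stronglyConn_embedding leaderVertex_injective (fun a j => ?_) c d
    rw [buildGraph_spec hL hC hσ]
    constructor
    · rintro (⟨c, d, h2, h3, h4⟩ | ⟨u, v, -, h3, -⟩)
      · exact ⟨d, leaderVertex_injective h3 ▸ h2, h4⟩
      · exact absurd h3.symm (contribVertex_ne_leaderVertex u a)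
    · rintro ⟨b, h2, h3⟩
      exact Or.inl ⟨a, b, h2, rfl, h3⟩
  · intro u v
    rw [key _ _ (contribVertex_lt u) (contribVertex_lt v)]
    refine stronglyConn_embedding contribVertex_injective (fun a j => ?_) u v
    rw [buildGraph_spec hL hC hσ]
    constructor
    · rintro (⟨c, d, -, h3, -⟩ | ⟨u, v, h2, h3, h4⟩)
      · exact absurd h3 (contribVertex_ne_leaderVertex a c)
      · exact ⟨v, contribVertex_injective h3 ▸ h2, h4⟩
    · rintro ⟨b, h2, h3⟩
      exact Or.inr ⟨a, b, h2, rfl, h3⟩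

end Ram

end LeaderContributor

namespace LeaderContributor

namespace Ram

open LeaderContributor.Ram.Cmd

variable {P : CycInstance} {lL : List (Transition (Fin P.L) (Fin P.D))}
  {lC : List (Transition (Fin P.C) (Fin P.D))} {σ τ : State}

/-! ### The next sets and the answer -/

theorem eval_targetComp (hσ : σ.Holds P lL lC) :
    Expr.targetComp.eval σ = σ.arr aComp (leaderVertex P (P.iface.leader, P.iface.mem)) := by
  rw [Expr.targetComp, Expr.eval, 
    eval_leaderVertex hσ (e := Expr.reg rTargetLeader) (f := Expr.reg rTargetMem) hσ.q hσ.a]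

theorem eval_targetComp_eq {A B : Set (Fin P.D)} (hσ : σ.Holds P lL lC) (hc : σ.CompFor P A B)
    {e f : Expr} {p : Fin P.L} {x : Fin P.D} (he : e.eval σ = p) (hf : f.eval σ = x) :
    (Expr.targetComp.eq (Expr.arr aComp (e.leaderVertex f))).eval σ ≠ 0 ↔
      StronglyConn (LeaderEdge P.system A) (P.iface.leader, P.iface.mem) (p, x) := by
  rw [← hc.leader]
  simp [Expr.eval, eval_targetComp hσ, eval_leaderVertex hσ he hf]

theorem clearNext_spec (hσ : σ.Holds P lL lC) :
    (∀ y < P.D, (clearNext.den σ).arr aNextWritable y = 0 ∧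
      (clearNext.den σ).arr aNextVisited y = 0) ∧ (clearNext.den σ).arr aAnswer 0 = 0 := by
  have key := den_count_inv (σ := σ) (x := vX) (b := rDomain)
    (p := (Cmd.store aNextWritable (Expr.reg vX) (Expr.const 0)).seq
      (Cmd.store aNextVisited (Expr.reg vX) (Expr.const 0)))
    (fun n τ => ∀ y < n, τ.arr aNextWritable y = 0 ∧ τ.arr aNextVisited y = 0) (by simp) (by
      intro i τ hi hx hr ha hInv y hy
      by_cases hyi : y = i
      · subst hyi
        simp [Cmd.den, Expr.eval, hx]
      · simpa [Cmd.den, Expr.eval, hx, hyi] using hInv y (by omega))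
  rw [hσ.D] at key
  refine ⟨fun y hy => ?_, ?_⟩
  · simpa [clearNext, den_seq, den_store] using key y hy
  · simp [clearNext, den_seq, den_store, Expr.eval]

theorem marks_markVisited {A B : Set (Fin P.D)} (hσ : σ.Holds P lL lC) (hc : σ.CompFor P A B) :
    Marks markVisited aNextVisited σ fun j =>
      ∃ y ∈ nextVisited P.system P.iface A, j = (y : ℕ) := by
  refine Marks.congr (marks_count_fin hσ hσ.L (Q := fun p j => ∃ x : Fin P.D,
    StronglyConn (LeaderEdge P.system A) (P.iface.leader, P.iface.mem) (p, x) ∧ j = (x : ℕ))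
    (by decide) (by decide) fun p τ hτ hp _ ha =>
      marks_count_fin hτ hτ.D (by decide) (by decide) fun x υ hυ hx hr hb =>
        (marks_when (marks_store _ _ υ)).congr fun j => ?_) fun j => ?_
  · have e1 : (Expr.reg vLeader).eval υ = p := (hr vLeader (by decide)).trans hp
    have e2 : (Expr.reg vX).eval υ = x := hx
    have e3 : υ.arr aComp = σ.arr aComp := by rw [hb _ (by decide), ha _ (by decide)]
    have hc' : υ.CompFor P A B :=
      ⟨fun c d => by rw [e3]; exact hc.leader c d, fun c d => by rw [e3]; exact hc.contrib c d⟩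
    rw [eval_targetComp_eq hυ hc' e1 e2, e2]
  · exact ⟨fun ⟨p, y, h1, h2⟩ => ⟨y, ⟨p, h1⟩, h2⟩, fun ⟨y, ⟨p, h1⟩, h2⟩ => ⟨p, y, h1, h2⟩⟩

theorem eval_contribCyclic {A B : Set (Fin P.D)} (hσ : σ.Holds P lL lC) (hc : σ.CompFor P A B)
    {e : ℕ} (he : e < lC.length) (hE : σ.reg vEdge = e) :
    Expr.contribCyclic.eval σ ≠ 0 ↔
      StronglyConn (ContribEdge P.system P.iface.contribs B) lC[e].1 lC[e].2.2 := by
  obtain ⟨h1, h2, h3, h4⟩ := hσ.contrib_entry he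
  rw [← hc.contrib]
  simp [Expr.contribCyclic, Expr.eval, hE, h1, h4, contribVertex]

theorem marks_markWritable (hC : Enumerates lC P.system.contributor.trans) {A : Set (Fin P.D)}
    (hσ : σ.Holds P lL lC) (hc : σ.CompFor P A (σ.visited P)) :
    Marks markWritable aNextWritable σ fun j =>
      ∃ y ∈ nextWritable P.system P.iface (σ.visited P), j = (y : ℕ) := by
  refine Marks.congr (marks_count_list hσ hσ.nC (Q := fun z j => ∃ y : Fin P.D,
      z.2.1 = some (MemOp.wr y) ∧ z.1 ∈ P.iface.contribs ∧ z.2.2 ∈ P.iface.contribs ∧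
      y ∈ σ.visited P ∧
      StronglyConn (ContribEdge P.system P.iface.contribs (σ.visited P)) z.1 z.2.2 ∧
      j = (y : ℕ)) (by decide) (by decide) fun e he τ hτ hE _ ha =>
    (marks_when (marks_store _ _ τ)).congr fun j => ?_) fun j => ?_
  · obtain ⟨h1, h2, h3, h4⟩ := hτ.contrib_entry he
    have hc' : τ.CompFor P A (σ.visited P) := by
      constructor
      · intro c d; rw [ha aComp (by decide)]; exact hc.leader c d
      · intro c d; rw [ha aComp (by decide)]; exact hc.contrib c d
    have h5 := eval_contribCyclic hτ hc' he hE
    have h6 := eval_contribAllowed hτ he hE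
    rw [ha aVisited (by decide)] at h6
    simp only [Expr.eval, mul_ne_zero_iff, h5, h6, hE, h2, h3]
    generalize lC[e] = z at *
    obtain ⟨u, lab, v⟩ := z
    rcases lab with _ | b | b
    · simp [labelKind]
    · simp [labelKind]
    · simp [labelKind, labelSymbol, LabelIn, State.visited, and_assoc]
  · constructor
    · rintro ⟨⟨u, lab, v⟩, hz, y, rfl, h1, h2, h3, h4, h5⟩
      exact ⟨y, ⟨u, v, (hC.2 _).1 hz, h1, h2, h3, h4⟩, h5⟩
    · rintro ⟨y, ⟨u, v, hz, h1, h2, h3, h4⟩, h5⟩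
      exact ⟨_, (hC.2 _).2 hz, y, rfl, h1, h2, h3, h4, h5⟩

/-- Only the cell `0` of the answer is ever marked. -/
theorem marks_contribAnswer {A : Set (Fin P.D)}
    (hσ : σ.Holds P lL lC) (hc : σ.CompFor P A (σ.visited P)) :
    Marks contribAnswer aAnswer σ fun j => ∃ z ∈ lC, ∃ o, z.2.1 = some o ∧
      z.1 ∈ P.iface.contribs ∧ z.2.2 ∈ P.iface.contribs ∧ LabelIn (σ.visited P) (some o) ∧
      StronglyConn (ContribEdge P.system P.iface.contribs (σ.visited P)) z.1 z.2.2 ∧ j = 0 := by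
  refine marks_count_list hσ hσ.nC (by decide) (by decide) fun e he τ hτ hE _ ha =>
    (marks_when (marks_store _ _ τ)).congr fun j => ?_
  obtain ⟨h1, h2, h3, h4⟩ := hτ.contrib_entry he
  have hc' : τ.CompFor P A (σ.visited P) := by
    constructor
    · intro c d; rw [ha aComp (by decide)]; exact hc.leader c d
    · intro c d; rw [ha aComp (by decide)]; exact hc.contrib c d
  have h5 := eval_contribCyclic hτ hc' he hE
  have h6 := eval_contribAllowed hτ he hE
  rw [ha aVisited (by decide)] at h6
  simp only [Expr.eval, mul_ne_zero_iff, h5, h6, hE, h2]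
  generalize lC[e] = z at *
  obtain ⟨u, lab, v⟩ := z
  rcases lab with _ | b | b <;> simp [labelKind, LabelIn, State.visited, and_assoc]

theorem marks_leaderAnswerAt {A B : Set (Fin P.D)} (hσ : σ.Holds P lL lC)
    (hc : σ.CompFor P A B) {e : ℕ} (he : e < lL.length) (hE : σ.reg vEdge = e) {x : Fin P.D}
    (hX : σ.reg vX = x) :
    Marks leaderAnswerAt aAnswer σ fun j => ∃ o y, lL[e].2.1 = some o ∧
      MemEffect (some o) x y ∧
      StronglyConn (LeaderEdge P.system A) (P.iface.leader, P.iface.mem) (lL[e].1, x) ∧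
      StronglyConn (LeaderEdge P.system A) (P.iface.leader, P.iface.mem) (lL[e].2.2, y) ∧
      j = 0 := by
  obtain ⟨h1, h2, h3, h4⟩ := hσ.leader_entry he
  refine (marks_when (marks_ite (marks_when (marks_store _ _ σ))
    (marks_when (marks_when (marks_store _ _ σ))))).congr fun j => ?_
  have e1 : (Expr.arr aLeaderSrc (Expr.reg vEdge)).eval σ = lL[e].1 := by
    simp [Expr.eval, hE, h1]
  have e2 : (Expr.arr aLeaderTgt (Expr.reg vEdge)).eval σ = lL[e].2.2 := by
    simp [Expr.eval, hE, h4]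
  have eX : (Expr.reg vX).eval σ = x := hX
  rw [eval_targetComp_eq hσ hc e1 eX, eval_targetComp_eq hσ hc e2 eX]
  generalize lL[e] = z at *
  obtain ⟨p, lab, p'⟩ := z
  rcases lab with _ | b | b
  · simp [Expr.eval, hE, h2, labelKind]
  · simp [Expr.eval, hE, hX, h2, h3, labelKind, labelSymbol, MemEffect, ← Fin.ext_iff]
    exact ⟨fun ⟨g1, g2, g3⟩ => ⟨g2.symm, g1, g3⟩, fun ⟨g1, g2, g3⟩ => ⟨g2, g1.symm, g3⟩⟩
  · have e5 : (Expr.arr aLeaderSym (Expr.reg vEdge)).eval σ = b := by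
      simp [Expr.eval, hE, h3, labelSymbol]
    rw [eval_targetComp_eq hσ hc e2 e5]
    simp [Expr.eval, hE, h2, labelKind, MemEffect]

theorem marks_leaderAnswer {A B : Set (Fin P.D)} (hσ : σ.Holds P lL lC)
    (hc : σ.CompFor P A B) :
    Marks leaderAnswer aAnswer σ fun j => ∃ z ∈ lL, ∃ x o y, z.2.1 = some o ∧
      MemEffect (some o) x y ∧
      StronglyConn (LeaderEdge P.system A) (P.iface.leader, P.iface.mem) (z.1, x) ∧
      StronglyConn (LeaderEdge P.system A) (P.iface.leader, P.iface.mem) (z.2.2, y) ∧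
      j = 0 :=
  marks_count_list hσ hσ.nL (by decide) (by decide) fun _ he _ hτ hE _ ha =>
    marks_count_fin hτ hτ.D (by decide) (by decide) fun _ _ hυ hX hr hb =>
      marks_leaderAnswerAt hυ
        ⟨fun c d => by rw [hb _ (by decide), ha _ (by decide)]; exact hc.leader c d,
          fun c d => by rw [hb _ (by decide), ha _ (by decide)]; exact hc.contrib c d⟩
        he ((hr vEdge (by decide)).trans hE) hX

theorem copyNext_spec (hσ : σ.Holds P lL lC) :
    ∀ y < P.D, (copyNext.den σ).arr aWritable y = σ.arr aNextWritable y ∧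
      (copyNext.den σ).arr aVisited y = σ.arr aNextVisited y := by
  rw [← hσ.D]
  refine den_count_inv (σ := σ) (x := vX) (b := rDomain)
    (p := (Cmd.store aWritable (Expr.reg vX) (Expr.arr aNextWritable (Expr.reg vX))).seq
      (Cmd.store aVisited (Expr.reg vX) (Expr.arr aNextVisited (Expr.reg vX))))
    (fun n τ => ∀ y < n, τ.arr aWritable y = σ.arr aNextWritable y ∧
      τ.arr aVisited y = σ.arr aNextVisited y) (by simp) ?_
  intro i τ hi hx hr ha hInv y hy
  by_cases hyi : y = i
  · subst hyi
    simp [Cmd.den, Expr.eval, hx, ha aNextWritable (by decide), ha aNextVisited (by decide)]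
  · simpa [Cmd.den, Expr.eval, hx, hyi] using hInv y (by omega)

theorem round_spec (hL : Enumerates lL P.system.leader.trans)
    (hC : Enumerates lC P.system.contributor.trans) (hσ : σ.Holds P lL lC) :
    (round.den σ).writable P = nextWritable P.system P.iface (σ.visited P) ∧
    (round.den σ).visited P = nextVisited P.system P.iface (σ.writable P) ∧
    ((round.den σ).arr aAnswer 0 ≠ 0 ↔
      OpOnCycle P.system P.iface (σ.writable P) (σ.visited P)) := by
  set σ₁ := scc.den (buildGraph.den σ) with h₁
  set σ₂ := clearNext.den σ₁ with h₂
  set σ₃ := markVisited.den σ₂ with h₃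
  set σ₄ := markWritable.den σ₃ with h₄
  set σ₅ := leaderAnswer.den σ₄ with h₅
  set σ₆ := contribAnswer.den σ₅ with h₆
  have hround : round.den σ = copyNext.den σ₆ := by
    simp only [round, den_seq, h₁, h₂, h₃, h₄, h₅, h₆]
  have s₁ : σ₁.Holds P lL lC :=
    (hσ.den (p := buildGraph) (by decide) (by decide)).den (by decide) (by decide)
  have s₂ : σ₂.Holds P lL lC := s₁.den (by decide) (by decide)
  have s₃ : σ₃.Holds P lL lC := s₂.den (by decide) (by decide)
  have s₄ : σ₄.Holds P lL lC := s₃.den (by decide) (by decide)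
  have s₅ : σ₅.Holds P lL lC := s₄.den (by decide) (by decide)
  have s₆ : σ₆.Holds P lL lC := s₅.den (by decide) (by decide)
  have v₃ : σ₃.visited P = σ.visited P := by
    simp only [State.visited, h₃, h₂, h₁]
    rw [den_arr _ (by decide), den_arr _ (by decide), den_arr _ (by decide),
      den_arr _ (by decide)]
  have v₅ : σ₅.visited P = σ.visited P := by
    rw [← v₃]
    simp only [State.visited, h₅, h₄]
    rw [den_arr _ (by decide), den_arr _ (by decide)]
  have c₁ : σ₁.CompFor P (σ.writable P) (σ.visited P) := compFor_scc hL hC hσ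
  have comp : ∀ {τ τ' : State}, τ'.arr aComp = τ.arr aComp →
      τ.CompFor P (σ.writable P) (σ.visited P) → τ'.CompFor P (σ.writable P) (σ.visited P) :=
    fun h hc => ⟨fun c d => by rw [h]; exact hc.leader c d,
      fun c d => by rw [h]; exact hc.contrib c d⟩
  have c₂ := comp (den_arr clearNext (by decide) σ₁) c₁
  have c₃ := comp (den_arr markVisited (by decide) σ₂) c₂
  have c₄ := comp (den_arr markWritable (by decide) σ₃) c₃
  have c₅ := comp (den_arr leaderAnswer (by decide) σ₄) c₄
  obtain ⟨z₁, z₂⟩ := clearNext_spec s₁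
  have hW : ∀ y : Fin P.D, σ₆.arr aNextWritable y ≠ 0 ↔
      y ∈ nextWritable P.system P.iface (σ.visited P) := by
    intro y
    rw [h₆, h₅, den_arr _ (by decide), den_arr _ (by decide), h₄,
      marks_markWritable hC s₃ (by rw [v₃]; exact c₃), h₃, den_arr _ (by decide), h₂,
      (z₁ y y.2).1, ← h₂, ← h₃, v₃]
    simp [← Fin.ext_iff]
  have hV : ∀ y : Fin P.D, σ₆.arr aNextVisited y ≠ 0 ↔
      y ∈ nextVisited P.system P.iface (σ.writable P) := by
    intro y
    rw [h₆, h₅, h₄, den_arr _ (by decide), den_arr _ (by decide), den_arr _ (by decide), h₃,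
      marks_markVisited s₂ c₂, h₂, (z₁ y y.2).2]
    simp [← Fin.ext_iff]
  have hcopy := copyNext_spec s₆
  rw [hround]
  refine ⟨?_, ?_, ?_⟩
  · ext y
    rw [← hW, ← (hcopy y y.2).1]
    rfl
  · ext y
    rw [← hV, ← (hcopy y y.2).2]
    rfl
  · rw [den_arr _ (by decide), h₆, marks_contribAnswer s₅ (by rw [v₅]; exact c₅), h₅,
      marks_leaderAnswer s₄ c₄, h₄, den_arr _ (by decide), h₃, den_arr _ (by decide), h₂, z₂,
      ← h₂, ← h₃, ← h₄, ← h₅, v₅]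
    simp only [ne_eq, not_true_eq_false, false_or, and_true]
    refine or_congr ⟨?_, ?_⟩ ⟨?_, ?_⟩
    · rintro ⟨⟨p, lab, p'⟩, hz, x, o, y, rfl, h1, h2, h3⟩
      exact ⟨p, o, p', x, y, (hL.2 _).1 hz, h1, h2, h3⟩
    · rintro ⟨p, o, p', x, y, hz, h1, h2, h3⟩
      exact ⟨_, (hL.2 _).2 hz, x, o, y, rfl, h1, h2, h3⟩
    · rintro ⟨⟨u, lab, v⟩, hz, o, rfl, h1, h2, h3, h4⟩
      exact ⟨u, o, v, (hC.2 _).1 hz, h1, h2, h3, h4⟩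
    · rintro ⟨u, o, v, hz, h1, h2, h3, h4⟩
      exact ⟨_, (hC.2 _).2 hz, o, rfl, h1, h2, h3, h4⟩

end Ram

end LeaderContributor

namespace LeaderContributor

/-! ### The iteration -/

/-- The map of `nextWritable` and `nextVisited` on pairs of sets, written as subsets of the
disjoint union. -/
def nextSets {QL QC D : Type} (Sys : LCSystem QL QC D) (I : Interface QL QC D)
    (T : Set (D ⊕ D)) : Set (D ⊕ D) :=
  {z | Sum.elim (· ∈ nextWritable Sys I (Sum.inr ⁻¹' T)) (· ∈ nextVisited Sys I (Sum.inl ⁻¹' T)) z}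

theorem nextSets_mono {QL QC D : Type} (Sys : LCSystem QL QC D) (I : Interface QL QC D) :
    Monotone (nextSets Sys I) := by
  rintro T T' h (y | y) hy
  · exact nextWritable_mono (Set.preimage_mono h) hy
  · exact nextVisited_mono (Set.preimage_mono h) hy

theorem cyc_iff_iterate (P : CycInstance) :
    CYC P ↔ OpOnCycle P.system P.iface
      (Sum.inl ⁻¹' (nextSets P.system P.iface)^[2 * P.D] Set.univ)
      (Sum.inr ⁻¹' (nextSets P.system P.iface)^[2 * P.D] Set.univ) := by
  have hmono := nextSets_mono P.system P.iface
  rw [cyc_iff_postfixpoint]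
  constructor
  · rintro ⟨A, B, hA, hB, h⟩
    have hT : {z | Sum.elim (· ∈ A) (· ∈ B) z} ⊆
        nextSets P.system P.iface {z | Sum.elim (· ∈ A) (· ∈ B) z} := by
      rintro (y | y) hy
      · exact hA hy
      · exact hB hy
    have h1 := subset_iterate hmono hT (2 * P.D)
    exact h.mono (fun y hy => h1 (a := Sum.inl y) hy) (fun y hy => h1 (a := Sum.inr y) hy)
  · intro h
    have hfix := iterate_card_fixed hmono
    rw [show Fintype.card (Fin P.D ⊕ Fin P.D) = 2 * P.D by simp [two_mul]] at hfix
    refine ⟨_, _, fun y hy => ?_, fun y hy => ?_, h⟩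
    · rw [Set.mem_preimage, ← hfix] at hy
      exact hy
    · rw [Set.mem_preimage, ← hfix] at hy
      exact hy

namespace Ram

open LeaderContributor.Ram.Cmd

section

variable {P : CycInstance} {lL : List (Transition (Fin P.L) (Fin P.D))}
  {lC : List (Transition (Fin P.C) (Fin P.D))} {σ : State}

theorem initSets_spec (hσ : σ.Holds P lL lC) : ∀ y < P.D,
    (initSets.den σ).arr aWritable y ≠ 0 ∧ (initSets.den σ).arr aVisited y ≠ 0 := by
  rw [← hσ.D]
  refine den_count_inv (σ := σ) (x := vX) (b := rDomain)
    (p := (Cmd.store aWritable (Expr.reg vX) (Expr.const 1)).seq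
      (Cmd.store aVisited (Expr.reg vX) (Expr.const 1)))
    (fun n τ => ∀ y < n, τ.arr aWritable y ≠ 0 ∧ τ.arr aVisited y ≠ 0) (by simp) ?_
  intro i τ hi hx hr ha hInv y hy
  by_cases hyi : y = i
  · subst hyi
    simp [Cmd.den, Expr.eval, hx]
  · simpa [Cmd.den, Expr.eval, hx, hyi] using hInv y (by omega)

theorem iterateRounds_spec (hL : Enumerates lL P.system.leader.trans)
    (hC : Enumerates lC P.system.contributor.trans) (hσ : σ.Holds P lL lC) :
    (iterateRounds.den σ).arr aAnswer 0 ≠ 0 ↔ CYC P := by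
  rw [cyc_iff_iterate]
  have h0 : (initSets.den σ).Holds P lL lC := hσ.den (by decide) (by decide)
  have key := den_count_inv (σ := initSets.den σ) (x := vRound) (b := rRounds) (p := round)
    (fun n τ => τ.Holds P lL lC ∧
      τ.writable P = Sum.inl ⁻¹' (nextSets P.system P.iface)^[n] Set.univ ∧
      τ.visited P = Sum.inr ⁻¹' (nextSets P.system P.iface)^[n] Set.univ ∧
      ∀ m, n = m + 1 → (τ.arr aAnswer 0 ≠ 0 ↔ OpOnCycle P.system P.iface
        (Sum.inl ⁻¹' (nextSets P.system P.iface)^[m] Set.univ)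
        (Sum.inr ⁻¹' (nextSets P.system P.iface)^[m] Set.univ))) ?_ ?_
  · rw [h0.rounds] at key
    exact key.2.2.2 _ rfl
  · refine ⟨h0.of_frame (fun r hr => ?_) fun k _ => rfl, ?_, ?_, fun m hm => by omega⟩
    · rw [State.setReg_reg, if_neg (by omega)]
    · ext y
      exact iff_of_true (initSets_spec hσ y y.2).1 trivial
    · ext y
      exact iff_of_true (initSets_spec hσ y y.2).2 trivial
  · rintro i τ - - - - ⟨h1, h2, h3, -⟩
    obtain ⟨g1, g2, g3⟩ := round_spec hL hC h1
    have g0 : (round.den τ).Holds P lL lC := h1.den (by decide) (by decide)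
    generalize round.den τ = υ at *
    refine ⟨g0.of_frame (fun r hr => ?_)
      fun k _ => rfl, ?_, ?_, ?_⟩
    · rw [State.setReg_reg, if_neg (by omega)]
    · rw [Function.iterate_succ_apply']
      exact g1.trans (by rw [h3]; rfl)
    · rw [Function.iterate_succ_apply']
      exact g2.trans (by rw [h2]; rfl)
    · intro m hm
      obtain rfl : i = m := by omega
      rw [← h2, ← h3]
      exact g3

end

/-! ### The running time -/

/-- The graph has `N = C + L * D` vertices, and `N * N ≤ 2 * (C ^ 2 + L ^ 2 * D ^ 2)`. The
contributor transitions, of which there can be `3 * C ^ 2 * D`, cost the factor `D`. -/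
theorem round_cost_le {L C D nL nC : ℕ} {ρ : ℕ → ℕ} (hL1 : 1 ≤ L) (hC1 : 1 ≤ C) (hD1 : 1 ≤ D)
    (hL : ρ rLeaderStates = L) (hD : ρ rDomain = D) (hnL : ρ rLeaderEdges = nL)
    (hnC : ρ rContribEdges = nC) (hN : ρ rVertices = C + L * D)
    (hsteps : ρ rSteps = 2 * (C + L * D))
    (hcells : ρ rCells = (C + L * D) * (C + L * D)) (hlL : nL ≤ 3 * (L ^ 2 * D))
    (hlC : nC ≤ 3 * (C ^ 2 * D)) :
    round.cost ρ ≤ 10000 * (D * (C ^ 2 + L ^ 2 * D ^ 2)) := by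
  simp only [round, buildGraph, clearAdj, leaderEdges, leaderEdgeAt, writeEdges, contribEdges,
    scc, sccInit, sccInitAt, sccStep, findEdge, findEdgeAt, pushHit, copyEdgeAt, mergeTop,
    mergeAt, popTop, popAt, clearNext, markVisited, markWritable, leaderAnswer, leaderAnswerAt,
    contribAnswer, copyNext, Expr.leaderVertex, Expr.targetComp, Expr.contribAllowed,
    Expr.contribCyclic, Expr.cell, Cmd.cost, Expr.cost, hL, hD, hnL, hnC, hN, hsteps, hcells]
  norm_num
  set N := C + L * D with hNdef
  set G := C ^ 2 + L ^ 2 * D ^ 2 with hG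
  have hGX : G ≤ D * G := Nat.le_mul_of_pos_left _ hD1
  have hG1 : L * (D * D) ≤ G := by
    have : L * (D * D) ≤ L ^ 2 * D ^ 2 := by
      rw [← pow_two]; exact Nat.mul_le_mul_right _ (Nat.le_self_pow (by omega) L)
    omega
  have hLD : L * D ≤ L * (D * D) := Nat.mul_le_mul_left _ (Nat.le_mul_of_pos_left _ hD1)
  have hLe : L ≤ L * D := Nat.le_mul_of_pos_right _ hD1
  have hDe : D ≤ L * D := Nat.le_mul_of_pos_left _ hL1
  have hNN : N * N ≤ 2 * G := by
    rw [hNdef, hG]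
    zify
    nlinarith [sq_nonneg ((C : ℤ) - L * D)]
  have hNe : N ≤ N * N := Nat.le_mul_of_pos_left _ (by omega)
  have hnLD : nL * D ≤ 3 * G := by
    have h1 := Nat.mul_le_mul_right D hlL
    have h2 : 3 * (L ^ 2 * D) * D = 3 * (L ^ 2 * D ^ 2) := by ring
    omega
  have hnLe : nL ≤ nL * D := Nat.le_mul_of_pos_right _ hD1
  have hnCe : nC ≤ 3 * (D * G) := by
    have h1 : C ^ 2 * D ≤ D * G := by
      rw [mul_comm]; exact Nat.mul_le_mul_left _ (Nat.le_add_right _ _)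
    omega
  generalize D * G = X at *
  linarith

/-- A transition is determined by its source, the kind and the symbol of its label, and its
target. -/
theorem length_le {n d : ℕ} (hd : 1 ≤ d) {l : List (Transition (Fin n) (Fin d))}
    (hl : l.Nodup) : l.length ≤ 3 * (n ^ 2 * d) := by
  have hk : ∀ x : Option (MemOp (Fin d)), labelKind x < 3 := by
    rintro (_ | _ | _) <;> simp [labelKind]
  have hs : ∀ x : Option (MemOp (Fin d)), labelSymbol x < d := by
    rintro (_ | b | b)
    · exact hd
    · exact b.2
    · exact b.2
  let f : Transition (Fin n) (Fin d) → Fin n × Fin 3 × Fin d × Fin n := fun z =>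
    (z.1, ⟨labelKind z.2.1, hk _⟩, ⟨labelSymbol z.2.1, hs _⟩, z.2.2)
  have hf : Function.Injective f := by
    rintro ⟨u, x, v⟩ ⟨u', x', v'⟩ h
    simp only [f, Prod.mk.injEq, Fin.mk.injEq] at h
    obtain ⟨rfl, h1, h2, rfl⟩ := h
    rcases x with _ | b | b <;> rcases x' with _ | b' | b' <;>
      simp_all [labelKind, labelSymbol, ← Fin.ext_iff]
  have h1 := (hl.map hf).length_le_card
  simp only [List.length_map, Fintype.card_prod, Fintype.card_fin] at h1
  calc l.length ≤ n * (3 * (d * n)) := h1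
    _ = 3 * (n ^ 2 * d) := by ring

theorem iterateRounds_cost_le {P : CycInstance} {lL : List (Transition (Fin P.L) (Fin P.D))}
    {lC : List (Transition (Fin P.C) (Fin P.D))} {σ : State} (hL1 : 1 ≤ P.L) (hC1 : 1 ≤ P.C)
    (hD1 : 1 ≤ P.D) (hσ : σ.Holds P lL lC) (hlL : lL.length ≤ 3 * (P.L ^ 2 * P.D))
    (hlC : lC.length ≤ 3 * (P.C ^ 2 * P.D)) :
    iterateRounds.cost σ.reg ≤ 50000 * (P.D ^ 2 * (P.C ^ 2 + P.L ^ 2 * P.D ^ 2)) := by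
  have h1 := round_cost_le hL1 hC1 hD1 hσ.L hσ.D hσ.nL hσ.nC hσ.N hσ.steps hσ.cells hlL hlC
  have hG : 1 ≤ P.C ^ 2 + P.L ^ 2 * P.D ^ 2 := Nat.add_pos_left (Nat.pow_pos hC1) _
  simp only [iterateRounds, initSets, Cmd.cost, Expr.cost, hσ.D, hσ.rounds]
  generalize round.cost σ.reg = r at *
  generalize P.C ^ 2 + P.L ^ 2 * P.D ^ 2 = G at *
  have h2 : P.D ≤ P.D * G := Nat.le_mul_of_pos_right _ hG
  have h3 : P.D ^ 2 * G = P.D * (P.D * G) := by ring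
  rw [h3]
  generalize P.D * G = X at *
  have h4 : X ≤ P.D * X := Nat.le_mul_of_pos_left _ hD1
  have h5 : (2 * P.D + 1) * (8 + r) ≤ (3 * P.D) * (10008 * X) :=
    Nat.mul_le_mul (by omega) (by omega)
  have h6 : (3 * P.D) * (10008 * X) = 30024 * (P.D * X) := by ring
  omega

/-! ### The complete program -/

/-- Compute the numbers that bound the loops, iterate, and answer. -/
def cycProg : Prog :=
  (Prog.assign rVertices ((Expr.reg rContribStates).add
    ((Expr.reg rLeaderStates).mul (Expr.reg rDomain)))).seq <|
  (Prog.assign rSteps ((Expr.const 2).mul (Expr.reg rVertices))).seq <|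
  (Prog.assign rRounds (((Expr.const 2).mul (Expr.reg rDomain)).add (Expr.const 1))).seq <|
  (Prog.assign rCells ((Expr.reg rVertices).mul (Expr.reg rVertices))).seq <|
  iterateRounds.compile.seq <|
  Prog.assign 0 (((Expr.arr aAnswer (Expr.const 0)).eq (Expr.const 0)).eq (Expr.const 0))

theorem inputState_bounded {P : CycInstance} {lL : List (Transition (Fin P.L) (Fin P.D))}
    {lC : List (Transition (Fin P.C) (Fin P.D))} {V : ℕ} (hV : 3 ≤ V) (hL : P.L < V)
    (hC : P.C < V) (hD : P.D < V) (hlL : lL.length < V) (hlC : lC.length < V) :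
    (P.inputState lL lC).Bounded V := by
  have hk : ∀ x : Option (MemOp (Fin P.D)), labelKind x < V := by
    rintro (_ | _ | _) <;> simp [labelKind] <;> omega
  have hs : ∀ x : Option (MemOp (Fin P.D)), labelSymbol x < V := by
    rintro (_ | b | b)
    · simp [labelSymbol]; omega
    · exact b.2.trans hD
    · exact b.2.trans hD
  have hget : ∀ {α : Type} (l : List α) (f : α → ℕ) (i : ℕ), (∀ z, f z < V) →
      (l.map f).getD i 0 < V := by
    intro α l f i hf
    by_cases hi : i < l.length
    · simpa [List.getD_eq_getElem?_getD, hi] using hf _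
    · have : (l.map f).length ≤ i := by simpa using hi
      rw [List.getD_eq_default _ _ this]
      omega
  constructor
  · intro x
    have h1 := P.system.leader.init.2
    have h2 := P.system.contributor.init.2
    have h3 := P.system.initMem.2
    have h4 := P.iface.leader.2
    have h5 := P.iface.mem.2
    unfold CycInstance.inputState
    dsimp only
    split <;> omega
  · intro k i
    unfold CycInstance.inputState
    dsimp only
    split
    · dsimp only
      split_ifs <;> omega
    all_goals dsimp only
    all_goals first
      | exact hget _ _ _ fun z => z.1.2.trans (by assumption)
      | exact hget _ _ _ fun z => hk _
      | exact hget _ _ _ fun z => hs _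
      | exact hget _ _ _ fun z => z.2.2.2.trans (by assumption)
      | omega

/-- All values in the memory stay below the sixth power of the size, and expressions have degree
at most `8`, so that words for numbers up to the power `48` suffice. -/
theorem cycProg_spec {P : CycInstance} {σ : State} (hP : P.IsInput σ) :
    ∃ (n : ℕ) (σ' : State), Exec (P.size ^ 48) cycProg σ n σ' ∧
      n ≤ 100000 * (P.D ^ 2 * (P.C ^ 2 + P.L ^ 2 * P.D ^ 2)) ∧
      (CYC P → σ'.reg 0 = 1) ∧ (¬ CYC P → σ'.reg 0 = 0) := by
  obtain ⟨lL, lC, hL, hC, rfl⟩ := hP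
  have hL1 : 1 ≤ P.L := (Nat.zero_le _).trans_lt P.iface.leader.2
  have hC1 : 1 ≤ P.C := (Nat.zero_le _).trans_lt P.system.contributor.init.2
  have hD1 : 1 ≤ P.D := (Nat.zero_le _).trans_lt P.iface.mem.2
  have hlL := length_le hD1 hL.1
  have hlC := length_le hD1 hC.1
  set s := P.size with hs
  have hsum : s = P.L + P.C + P.D := rfl
  have hs3 : 3 ≤ s := by omega
  set V := s ^ 6 with hV
  have hsV : s ^ 4 < V := Nat.pow_lt_pow_right (by omega) (by omega)
  have hs14 : s ≤ s ^ 4 := Nat.le_self_pow (by omega) s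
  have hN : P.C + P.L * P.D < s ^ 3 := by
    have h1 : P.L * P.D ≤ s * s := Nat.mul_le_mul (by omega) (by omega)
    have h2 : 3 * s ≤ s * s := Nat.mul_le_mul_right s hs3
    have h3 : 3 * (s * s) ≤ s * (s * s) := Nat.mul_le_mul_right _ hs3
    have h4 : s ^ 3 = s * (s * s) := by ring
    omega
  have hs13 : 3 * s ≤ s ^ 3 := by
    have h1 : 3 * s ≤ s ^ 2 * s := Nat.mul_le_mul_right s (by nlinarith)
    have h2 : s ^ 2 * s = s ^ 3 := by ring
    omega
  have h34 : 3 * s ^ 3 ≤ s ^ 4 := by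
    rw [pow_succ s 3, mul_comm]; exact Nat.mul_le_mul_left _ hs3
  have hlen : ∀ {n : ℕ}, n ≤ s → 3 * (n ^ 2 * P.D) < V := by
    intro n hn
    have h1 : n ^ 2 * P.D ≤ s ^ 2 * s :=
      Nat.mul_le_mul (Nat.pow_le_pow_left hn 2) (by omega)
    have h2 : s ^ 2 * s = s ^ 3 := by ring
    omega
  have hcells : (P.C + P.L * P.D) * (P.C + P.L * P.D) < V := by
    calc (P.C + P.L * P.D) * (P.C + P.L * P.D) < s ^ 3 * s ^ 3 := Nat.mul_lt_mul'' hN hN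
      _ = V := by rw [hV]; ring
  have hVW : V ^ 8 ≤ s ^ 48 := by rw [hV, ← pow_mul]
  have hVW1 : V ≤ s ^ 48 := Nat.pow_le_pow_right (by omega) (by omega)
  have hV3 : 3 ≤ V := by omega
  have hb : (P.inputState lL lC).Bounded V := inputState_bounded hV3 (by omega) (by omega)
    (by omega) (hlL.trans_lt (hlen (by omega)))
    (hlC.trans_lt (hlen (by omega)))
  set σ₀ := P.inputState lL lC with hσ₀
  set N := P.C + P.L * P.D with hNdef
  set σ₁ := (((σ₀.setReg rVertices N).setReg rSteps (2 * N)).setReg rRounds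
    (2 * P.D + 1)).setReg rCells (N * N) with hσ₁
  have hb₁ : σ₁.Bounded V := (((hb.setReg (by omega)).setReg (by omega)).setReg
    (by omega)).setReg hcells
  have hH : σ₁.Holds P lL lC := by
    constructor <;> simp [hσ₁, hσ₀, CycInstance.inputState, hNdef]
  obtain ⟨⟨n, hn, hexec⟩, hb₂⟩ := exec_compile hV3 hVW iterateRounds iterateRounds_wf σ₁ hb₁
  have hspec := iterateRounds_spec hL hC hH
  set σ₂ := iterateRounds.den σ₁ with hσ₂
  have hLD : P.L * P.D ≤ N := by omega
  refine ⟨_, _, Exec.seq (Exec.assign σ₀ _ _ ?_) (Exec.seq (Exec.assign _ _ _ ?_)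
    (Exec.seq (Exec.assign _ _ _ ?_) (Exec.seq (Exec.assign _ _ _ ?_)
      (Exec.seq (σ₂ := σ₂) (m := n) ?_ (Exec.assign _ _ _ ?_))))), ?_, ?_⟩
  · simp [Expr.Fits, Expr.eval, hσ₀, CycInstance.inputState]; omega
  · simp [Expr.Fits, Expr.eval, hσ₀, CycInstance.inputState]; omega
  · simp [Expr.Fits, Expr.eval, hσ₀, CycInstance.inputState]; omega
  · simp [Expr.Fits, Expr.eval, hσ₀, CycInstance.inputState, ← hNdef]
    omega
  · exact hexec
  · exact Expr.fits_of_ok hV3 (by omega) hVW hb₂ _ (by decide)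
  · have h1 := hn.trans (iterateRounds_cost_le hL1 hC1 hD1 hH hlL hlC)
    have h2 : 1 ≤ P.D ^ 2 * (P.C ^ 2 + P.L ^ 2 * P.D ^ 2) :=
      Nat.mul_pos (Nat.pow_pos hD1) (Nat.add_pos_left (Nat.pow_pos hC1) _)
    simp only [Expr.cost]
    omega
  · simp only [State.setReg_reg, if_true, Expr.eval]
    rw [← hspec]
    constructor <;> intro h <;> simp_all

end Ram

end LeaderContributor

theorem theorem5 :
    LeaderContributor.Ram.SolvableInTime
      LeaderContributor.CycInstance.IsInput
      LeaderContributor.CycInstance.size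
      LeaderContributor.CYC
      (fun P => P.D ^ 2 * (P.C ^ 2 + P.L ^ 2 * P.D ^ 2)) :=
  ⟨LeaderContributor.Ram.cycProg, 48, 100000, fun _ _ h =>
    LeaderContributor.Ram.cycProg_spec h⟩
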